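/- All matroids and graphs are finite; graphs may have loops and parallel edges. A matroid $M$ is \emph{frame} if it can be extended to a matroid having a basis $B$ such that every element is spanned by two elements of $B$. A \emph{biased graph} $\Omega=(G,\mathcal B)$ is a graph $G$ with a collection $\mathcal B$ of its cycles, called balanced (the other cycles are unbalanced), such that no theta subgraph (two distinct vertices joined by three internally disjoint paths) contains exactly two balanced cycles. $F(\Omega)$ is the matroid on $E(G)$ whose circuits are the edge sets of: balanced cycles; two edge-disjoint unbalanced cycles meeting in exactly one vertex; two vertex-disjoint unbalanced cycles together with a path connecting them; theta subgraphs all of whose cycles are unbalanced. A \emph{matroidal} is a pair $(M,L)$ where $M$ is a matroid and $L\subseteq E(M)$ is a set of elements none of which is a loop of $M$. It is \emph{frame} if $M=F(\Omega)$ for some biased graph $\Omega$ in which every element of $L$ is an unbalanced loop. A \emph{minor} of a matroidal $(M,L)$ is any matroidal obtained from it by a sequence of the following operations, each applied only when the result is again a matroidal: deleting an element not in $L$, contracting an element not in $L$, removing an element from the set $L$ (keeping it in $M$). An \emph{excluded minor} for the class of frame matroids (frame matroidals) is a matroid (matroidal) that is not frame but all of whose proper minors are frame. For matroids $M_1,M_2$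 with $e_i\in E(M_i)$, the 2-sum on $e_1,e_2$ is the matroid on $(E(M_1)\setminus\{e_1\})\,\dot\cup\,(E(M_2)\setminus\{e_2\})$ whose circuits are the circuits of $M_i$ avoiding $e_i$ ($i=1,2$) and the sets $(C_1\setminus\{e_1\})\cup (C_2\setminus\{e_2\})$ with $C_i$ a circuit of $M_i$ containing $e_i$. For a set $L$ of non-loop elements of $N$, let $N\oplus_2 U_{2,4}^L$ denote the matroid obtained from $N$ by taking a 2-sum with a copy of $U_{2,4}$ on each element of $L$. \textbf{Corollary.} Let $N$ be a matroid and let $L\subseteq E(N)$ be a set of elements none of which is a loop of $N$. Then $N\oplus_2 U_{2,4}^L$ is an excluded minor for the class of frame matroids if and only if $(N,L)$ is an excluded minor for the class of frame matroidals. -/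

import Mathlib

open Set

universe u v

/-! ## Cycles, paths, thetas and biased graphs -/

namespace Graph

variable {V : Type v} {α : Type u}

/-- `C` is the edge set of a cycle of the multigraph `G`: there are distinct vertices
`v₀, …, vₙ` and distinct edges `e₀, …, eₙ` such that `eᵢ` joins `vᵢ` and `vᵢ₊₁` (indices modulo
`n + 1`). Loops are the cycles of length one; two parallel links form a cycle of length two. -/
def IsCycleSet (G : Graph V α) (C : Set α) : Prop :=
  ∃ (n : ℕ) (v : Fin (n + 1) → V) (e : Fin (n + 1) → α),
    Function.Injective v ∧ Function.Injective e ∧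
      (∀ i, G.IsLink (e i) (v i) (v (i + 1))) ∧ C = range e

/-- `P` is the edge set of a path of `G` (no repeated vertex) with ends `x` and `y`. -/
def IsPathSet (G : Graph V α) (P : Set α) (x y : V) : Prop :=
  ∃ (n : ℕ) (v : Fin (n + 1) → V) (e : Fin n → α),
    Function.Injective v ∧ (∀ i, G.IsLink (e i) (v i.castSucc) (v i.succ)) ∧
      v 0 = x ∧ v (Fin.last n) = y ∧ P = range e

/-- The set of vertices incident with an edge in `X`. -/
def vertsOf (G : Graph V α) (X : Set α) : Set V := {x | ∃ e ∈ X, G.Inc e x}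

/-- `P₁, P₂, P₃` are the edge sets of three internally disjoint paths with the same two distinct
ends; so `P₁ ∪ P₂ ∪ P₃` is the edge set of a theta subgraph, whose cycles are `P₁ ∪ P₂`,
`P₁ ∪ P₃` and `P₂ ∪ P₃`. -/
def IsTheta (G : Graph V α) (P₁ P₂ P₃ : Set α) : Prop :=
  ∃ x y, x ≠ y ∧ G.IsPathSet P₁ x y ∧ G.IsPathSet P₂ x y ∧ G.IsPathSet P₃ x y ∧
    Disjoint P₁ P₂ ∧ Disjoint P₁ P₃ ∧ Disjoint P₂ P₃ ∧
    G.vertsOf P₁ ∩ G.vertsOf P₂ = {x, y} ∧ G.vertsOf P₁ ∩ G.vertsOf P₃ = {x, y} ∧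
    G.vertsOf P₂ ∩ G.vertsOf P₃ = {x, y}

end Graph

/-- A finite biased graph with vertices in `V` and edges in `α`: a finite multigraph (loops and
parallel edges allowed) with a collection of cycles, called balanced, such that no theta subgraph
contains exactly two balanced cycles. A cycle is recorded by its edge set. -/
structure BiasedGraph (V : Type v) (α : Type u) where
  graph : Graph V α
  finite_verts : graph.vertexSet.Finite
  finite_edges : graph.edgeSet.Finite
  balanced : Set (Set α)
  isCycleSet_of_balanced : ∀ C ∈ balanced, graph.IsCycleSet C
  theta : ∀ P₁ P₂ P₃, graph.IsTheta P₁ P₂ P₃ →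
    P₁ ∪ P₂ ∈ balanced → P₁ ∪ P₃ ∈ balanced → P₂ ∪ P₃ ∈ balanced

namespace BiasedGraph

variable {V : Type v} {α : Type u}

/-- An unbalanced cycle: a cycle that is not in the collection of balanced cycles. -/
def IsUnbalanced (Ω : BiasedGraph V α) (C : Set α) : Prop :=
  Ω.graph.IsCycleSet C ∧ C ∉ Ω.balanced

/-- The edge `e` is an unbalanced loop. -/
def IsUnbalancedLoop (Ω : BiasedGraph V α) (e : α) : Prop :=
  (∃ x, Ω.graph.IsLoopAt e x) ∧ {e} ∉ Ω.balanced

/-- Two edge-disjoint unbalanced cycles that meet in exactly one vertex. -/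
def IsTightHandcuff (Ω : BiasedGraph V α) (C : Set α) : Prop :=
  ∃ C₁ C₂ x, Ω.IsUnbalanced C₁ ∧ Ω.IsUnbalanced C₂ ∧ Disjoint C₁ C₂ ∧
    Ω.graph.vertsOf C₁ ∩ Ω.graph.vertsOf C₂ = {x} ∧ C = C₁ ∪ C₂

/-- Two vertex-disjoint unbalanced cycles with a path connecting them, the path meeting each of
the two cycles exactly in one of its ends. -/
def IsLooseHandcuff (Ω : BiasedGraph V α) (C : Set α) : Prop :=
  ∃ C₁ C₂ P x y, Ω.IsUnbalanced C₁ ∧ Ω.IsUnbalanced C₂ ∧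
    Disjoint (Ω.graph.vertsOf C₁) (Ω.graph.vertsOf C₂) ∧ Ω.graph.IsPathSet P x y ∧
    Ω.graph.vertsOf P ∩ Ω.graph.vertsOf C₁ = {x} ∧
    Ω.graph.vertsOf P ∩ Ω.graph.vertsOf C₂ = {y} ∧ C = C₁ ∪ C₂ ∪ P

/-- A theta subgraph all of whose three cycles are unbalanced. -/
def IsContrabalancedTheta (Ω : BiasedGraph V α) (C : Set α) : Prop :=
  ∃ P₁ P₂ P₃, Ω.graph.IsTheta P₁ P₂ P₃ ∧ P₁ ∪ P₂ ∉ Ω.balanced ∧ P₁ ∪ P₃ ∉ Ω.balanced ∧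
    P₂ ∪ P₃ ∉ Ω.balanced ∧ C = P₁ ∪ P₂ ∪ P₃

/-- `M = F(Ω)`: the ground set of `M` is the edge set of `Ω`, and the circuits of `M` are the edge
sets of the balanced cycles, the tight and loose handcuffs and the contrabalanced thetas. -/
def Represents (Ω : BiasedGraph V α) (M : Matroid α) : Prop :=
  M.E = Ω.graph.edgeSet ∧
    ∀ C, M.IsCircuit C ↔
      C ∈ Ω.balanced ∨ Ω.IsTightHandcuff C ∨ Ω.IsLooseHandcuff C ∨ Ω.IsContrabalancedTheta C

end BiasedGraph

/-! ## Frame matroids and their excluded minors -/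

namespace Matroid

variable {α : Type u}

/-- A matroid `M` is *frame* if it can be extended, by finitely many new elements, to a finite
matroid `P` that has a basis `B` such that every element of `P` is spanned by two elements of `B`.
The new elements are taken from `ι`, and `P.comap Sum.inl = M` says that `M` is the restriction
of `P` to the old elements. -/
def IsFrame (M : Matroid α) : Prop :=
  ∃ (ι : Type) (P : Matroid (α ⊕ ι)), P.Finite ∧ P.comap Sum.inl = M ∧
    ∃ B, P.IsBase B ∧ ∀ e ∈ P.E, ∃ b ∈ B, ∃ b' ∈ B, e ∈ P.closure {b, b'}

/-- An excluded minor for the class of frame matroids: a matroid that is not frame, all of whose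
proper minors are frame. -/
def IsExcludedMinorFrame (M : Matroid α) : Prop :=
  ¬ M.IsFrame ∧ ∀ M' : Matroid α, M' <m M → M'.IsFrame

end Matroid

/-! ## Matroidals -/

/-- A *matroidal* `(M, L)`: a matroid with a distinguished set of elements, none of them a loop. -/
@[ext] structure Matroidal (α : Type u) where
  M : Matroid α
  L : Set α
  isNonloop : ∀ e ∈ L, M.IsNonloop e

namespace Matroidal

variable {α : Type u}

/-- `(M, L)` is *frame* if `M = F(Ω)` for a biased graph `Ω` in which every element of `L` is an
unbalanced loop. -/
def IsFrame (A : Matroidal α) : Prop :=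
  ∃ (V : Type) (Ω : BiasedGraph V α), Ω.Represents A.M ∧ ∀ e ∈ A.L, Ω.IsUnbalancedLoop e

/-- `B` is obtained from `A = (M, L)` by deleting or contracting one element not in `L`, or by
removing one element from `L`. -/
def IsStep (A B : Matroidal α) : Prop :=
  (∃ e ∈ A.M.E \ A.L, (B.M = A.M.delete {e} ∨ B.M = A.M.contract {e}) ∧ B.L = A.L) ∨
    (∃ e ∈ A.L, B.M = A.M ∧ B.L = A.L \ {e})

/-- `B` is a minor of `A`: it is obtained from `A` by a sequence of the operations above. -/
def IsMinor (B A : Matroidal α) : Prop := Relation.ReflTransGen IsStep A B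

/-- An excluded minor for the class of frame matroidals: a matroidal that is not frame, all of
whose proper minors are frame. -/
def IsExcludedMinor (A : Matroidal α) : Prop :=
  ¬ A.IsFrame ∧ ∀ B : Matroidal α, B.IsMinor A → B ≠ A → B.IsFrame

end Matroidal

/-! ## 2-sums with copies of `U_{2,4}` -/

namespace Matroid

variable {α : Type u}

/-- `M` is the 2-sum of `M₁` and `M₂` on `e₁` and `e₂`, described by its circuits. -/
def IsTwoSum (M M₁ : Matroid α) (e₁ : α) (M₂ : Matroid α) (e₂ : α) : Prop :=
  e₁ ∈ M₁.E ∧ e₂ ∈ M₂.E ∧ Disjoint (M₁.E \ {e₁}) (M₂.E \ {e₂}) ∧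
    M.E = (M₁.E \ {e₁}) ∪ (M₂.E \ {e₂}) ∧
    ∀ C, M.IsCircuit C ↔
      (M₁.IsCircuit C ∧ e₁ ∉ C) ∨ (M₂.IsCircuit C ∧ e₂ ∉ C) ∨
      ∃ C₁ C₂, M₁.IsCircuit C₁ ∧ e₁ ∈ C₁ ∧ M₂.IsCircuit C₂ ∧ e₂ ∈ C₂ ∧
        C = (C₁ \ {e₁}) ∪ (C₂ \ {e₂})

/-- The uniform matroid of rank two on the finite set `S` (for `|S| ≥ 2`). -/
def uniformTwo (S : Set α) (hS : S.Finite) : Matroid α :=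
  (IndepMatroid.ofFinite hS (fun I ↦ I ⊆ S ∧ I.encard ≤ 2) (by simp)
    (fun I J hJ hIJ ↦ ⟨hIJ.trans hJ.1, (encard_le_encard hIJ).trans hJ.2⟩)
    (by
      intro I J hI hJ hlt
      obtain ⟨e, heJ, heI⟩ := exists_mem_notMem_of_ncard_lt_ncard hlt (hS.subset hI.1)
      refine ⟨e, heJ, heI, insert_subset (hJ.1 heJ) hI.1, ?_⟩
      rw [encard_insert_of_notMem heI]
      refine le_trans ?_ hJ.2
      rw [← (hS.subset hI.1).cast_ncard_eq, ← (hS.subset hJ.1).cast_ncard_eq]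
      exact_mod_cast hlt)
    (fun I hI ↦ hI.1)).matroid

/-- For a set `I` of elements of `N ⊕₂ U_{2,4}^L`, the elements of `N` that `I` accounts for: those
in `I` itself, and those `e ∈ L` for which `I` contains two of the three new elements at `e`. -/
def u24Trace (I : Set (α ⊕ α × Fin 3)) : Set α :=
  {x | Sum.inl x ∈ I ∨ ∃ i j : Fin 3, i ≠ j ∧ Sum.inr (x, i) ∈ I ∧ Sum.inr (x, j) ∈ I}

/-- The independent sets of `N ⊕₂ U_{2,4}^L`. -/
def U24Indep (N : Matroid α) (L : Set α) (I : Set (α ⊕ α × Fin 3)) : Prop :=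
  (∀ x, Sum.inl x ∈ I → x ∈ N.E \ L) ∧ (∀ x i, Sum.inr (x, i) ∈ I → x ∈ N.E ∩ L) ∧
    (∀ x, ∃ i, Sum.inr (x, i) ∉ I) ∧ N.Indep (u24Trace I)

theorem u24_card (I : Finset (α ⊕ α × Fin 3)) (hlr : ∀ x i, Sum.inl x ∈ I → Sum.inr (x, i) ∉ I)
    (h3 : ∀ x, ∃ i, Sum.inr (x, i) ∉ I) :
    I.card = (u24Trace (I : Set (α ⊕ α × Fin 3))).ncard +
      {x | ∃ i, Sum.inr (x, i) ∈ I}.ncard := by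
  classical
  set S : Finset α := I.toRight.image Prod.fst with hS
  set F : α → Finset (α × Fin 3) := fun x ↦ I.toRight.filter (fun p ↦ p.1 = x) with hF
  have hsum : I.toRight.card = ∑ x ∈ S, (F x).card :=
    Finset.card_eq_sum_card_image Prod.fst I.toRight
  set D : Finset α := S.filter (fun x ↦ 1 < (F x).card) with hD
  have hmem : ∀ x y i, (y, i) ∈ F x ↔ Sum.inr (x, i) ∈ I ∧ y = x := by
    intro x y i
    simp only [hF, Finset.mem_filter, Finset.mem_toRight]
    constructor
    · rintro ⟨h, rfl⟩; exact ⟨h, rfl⟩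
    · rintro ⟨h, rfl⟩; exact ⟨h, rfl⟩
  have hle : ∀ x, (F x).card ≤ 2 := by
    intro x
    obtain ⟨i, hi⟩ := h3 x
    have hsub : F x ⊆ ((Finset.univ.erase i).image (fun j ↦ (x, j))) := by
      rintro ⟨y, j⟩ hy
      obtain ⟨hy, rfl⟩ := (hmem _ _ _).1 hy
      simp only [Finset.mem_image, Finset.mem_erase, Finset.mem_univ, and_true, Prod.mk.injEq]
      exact ⟨j, fun h ↦ hi (h ▸ hy), trivial, rfl⟩
    refine (Finset.card_le_card hsub).trans (Finset.card_image_le.trans ?_)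
    simp
  have htwo : ∀ x, 1 < (F x).card ↔
      ∃ i j : Fin 3, i ≠ j ∧ Sum.inr (x, i) ∈ I ∧ Sum.inr (x, j) ∈ I := by
    intro x
    rw [Finset.one_lt_card]
    constructor
    · rintro ⟨⟨y, i⟩, hy, ⟨z, j⟩, hz, hne⟩
      obtain ⟨hy, rfl⟩ := (hmem _ _ _).1 hy
      obtain ⟨hz, rfl⟩ := (hmem _ _ _).1 hz
      exact ⟨i, j, fun h ↦ hne (by rw [h]), hy, hz⟩
    · rintro ⟨i, j, hne, hi, hj⟩
      exact ⟨(x, i), (hmem _ _ _).2 ⟨hi, rfl⟩, (x, j), (hmem _ _ _).2 ⟨hj, rfl⟩, by simpa using hne⟩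
  have hmemS : ∀ x, x ∈ S ↔ ∃ i, Sum.inr (x, i) ∈ I := by
    intro x
    simp [hS]
  have hone : ∀ x ∈ S, (F x).card = 1 + if 1 < (F x).card then 1 else 0 := by
    intro x hx
    obtain ⟨i, hi⟩ := (hmemS x).1 hx
    have hpos : 0 < (F x).card := Finset.card_pos.2 ⟨(x, i), (hmem _ _ _).2 ⟨hi, rfl⟩⟩
    have := hle x
    split_ifs <;> omega
  have hS' : {x | ∃ i, Sum.inr (x, i) ∈ I} = (S : Set α) := by
    ext x; simp [hmemS]
  have hD' : u24Trace (I : Set (α ⊕ α × Fin 3)) = ((I.toLeft ∪ D : Finset α) : Set α) := by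
    ext x
    simp only [u24Trace, Finset.mem_coe, mem_ofPred_eq, Finset.mem_union, Finset.mem_toLeft, hD,
      Finset.mem_filter, htwo, hmemS]
    constructor
    · rintro (h | ⟨i, j, h⟩)
      · exact Or.inl h
      · exact Or.inr ⟨⟨i, h.2.1⟩, i, j, h⟩
    · rintro (h | h)
      · exact Or.inl h
      · exact Or.inr h.2
  have hdisj : Disjoint I.toLeft D := by
    rw [Finset.disjoint_left]
    intro x hx hxD
    obtain ⟨i, hi⟩ := (hmemS x).1 (Finset.mem_filter.1 hxD).1
    exact hlr x i (Finset.mem_toLeft.1 hx) hi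
  rw [hS', hD', ncard_coe_finset, ncard_coe_finset, Finset.card_union_of_disjoint hdisj,
    ← Finset.card_toLeft_add_card_toRight, hsum, Finset.sum_congr rfl hone,
    Finset.sum_add_distrib, Finset.sum_const, ← Finset.card_filter]
  simp only [smul_eq_mul, mul_one, hD]
  omega

theorem u24_aug (N : Matroid α) (L : Set α) {I J : Set (α ⊕ α × Fin 3)} (hIf : I.Finite)
    (hJf : J.Finite) (hI : U24Indep N L I) (hJ : U24Indep N L J) (hlt : I.ncard < J.ncard) :
    ∃ e ∈ J, e ∉ I ∧ U24Indep N L (insert e I) := by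
  classical
  by_cases hS : ∃ x i, Sum.inr (x, i) ∈ J ∧ ∀ j, Sum.inr (x, j) ∉ I
  · obtain ⟨x, i, hxJ, hxI⟩ := hS
    refine ⟨_, hxJ, hxI i, ?_, ?_, ?_, ?_⟩
    · intro y hy
      exact hI.1 y (by simpa using hy)
    · intro y j hy
      obtain h | h := mem_insert_iff.1 hy
      · obtain ⟨rfl, rfl⟩ : y = x ∧ j = i := by simpa using h
        exact hJ.2.1 _ _ hxJ
      · exact hI.2.1 y j h
    · intro y
      by_cases hyx : y = x
      · subst hyx
        refine ⟨i + 1, ?_⟩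
        simp [hxI]
      · obtain ⟨j, hj⟩ := hI.2.2.1 y
        exact ⟨j, by simp [hyx, hj]⟩
    · refine hI.2.2.2.subset ?_
      rintro y (h | ⟨j, k, hjk, hj, hk⟩)
      · exact Or.inl (by simpa using h)
      · by_cases hyx : y = x
        · subst hyx
          simp only [mem_insert_iff, Sum.inr.injEq, Prod.mk.injEq, true_and, hxI, or_false] at hj hk
          exact absurd (hj.trans hk.symm) hjk
        · exact Or.inr ⟨j, k, hjk, by simpa [hyx] using hj, by simpa [hyx] using hk⟩
  push Not at hS
  have hcI := u24_card hIf.toFinset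
    (fun x i h h' ↦ (hI.1 x (by simpa using h)).2 (hI.2.1 x i (by simpa using h')).2)
    (fun x ↦ by simpa using hI.2.2.1 x)
  have hcJ := u24_card hJf.toFinset
    (fun x i h h' ↦ (hJ.1 x (by simpa using h)).2 (hJ.2.1 x i (by simpa using h')).2)
    (fun x ↦ by simpa using hJ.2.2.1 x)
  simp only [Finite.coe_toFinset, Finite.mem_toFinset] at hcI hcJ
  rw [← ncard_eq_toFinset_card I hIf] at hcI
  rw [← ncard_eq_toFinset_card J hJf] at hcJ
  have hfin : ∀ K : Set (α ⊕ α × Fin 3), K.Finite →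
      {x | ∃ i, Sum.inr (x, i) ∈ K}.Finite ∧ (u24Trace K).Finite := by
    intro K hK
    have h1 : {x | ∃ i, Sum.inr (x, i) ∈ K}.Finite := by
      refine (hK.image (Sum.elim id Prod.fst)).subset ?_
      rintro x ⟨i, hi⟩
      exact ⟨_, hi, rfl⟩
    refine ⟨h1, ?_⟩
    refine (hK.image (Sum.elim id Prod.fst)).subset ?_
    rintro x (hx | ⟨i, j, -, hi, -⟩)
    · exact ⟨_, hx, rfl⟩
    · exact ⟨_, hi, rfl⟩
  have hle : {x | ∃ i, Sum.inr (x, i) ∈ J}.ncard ≤ {x | ∃ i, Sum.inr (x, i) ∈ I}.ncard :=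
    ncard_le_ncard (fun x ⟨i, hi⟩ ↦ hS x i hi) (hfin I hIf).1
  have hltD : (u24Trace I).encard < (u24Trace J).encard := by
    rw [← (hfin I hIf).2.cast_ncard_eq, ← (hfin J hJf).2.cast_ncard_eq]
    exact_mod_cast (by omega : (u24Trace I).ncard < (u24Trace J).ncard)
  obtain ⟨d, ⟨hdJ, hdI⟩, hind⟩ := hI.2.2.2.augment hJ.2.2.2 hltD
  rcases hdJ with hdJ | ⟨j, k, hjk, hj, hk⟩
  · refine ⟨_, hdJ, fun h ↦ hdI (Or.inl h), ?_, ?_, ?_, ?_⟩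
    · intro y hy
      obtain h | h := mem_insert_iff.1 hy
      · obtain rfl : y = d := by simpa using h
        exact hJ.1 _ hdJ
      · exact hI.1 y h
    · intro y i hy
      exact hI.2.1 y i (by simpa using hy)
    · intro y
      obtain ⟨i, hi⟩ := hI.2.2.1 y
      exact ⟨i, by simpa using hi⟩
    · refine hind.subset ?_
      rintro y (h | ⟨i, i', hne, hi, hi'⟩)
      · obtain h | h := mem_insert_iff.1 h
        · exact Or.inl (by simpa using h)
        · exact Or.inr (Or.inl h)
      · exact Or.inr (Or.inr ⟨i, i', hne, by simpa using hi, by simpa using hi'⟩)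
  · obtain ⟨i, hiJ, hiI⟩ : ∃ i, Sum.inr (d, i) ∈ J ∧ Sum.inr (d, i) ∉ I := by
      by_contra! hcon
      exact hdI (Or.inr ⟨j, k, hjk, hcon _ hj, hcon _ hk⟩)
    refine ⟨_, hiJ, hiI, ?_, ?_, ?_, ?_⟩
    · intro y hy
      exact hI.1 y (by simpa using hy)
    · intro y i' hy
      obtain h | h := mem_insert_iff.1 hy
      · obtain ⟨rfl, rfl⟩ : y = d ∧ i' = i := by simpa using h
        exact hJ.2.1 _ _ hiJ
      · exact hI.2.1 y i' h
    · intro y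
      by_cases hyd : y = d
      · subst hyd
        by_contra! hcon
        simp only [mem_insert_iff, Sum.inr.injEq, Prod.mk.injEq, true_and] at hcon
        refine hdI (Or.inr ⟨i + 1, i + 2, ?_, (hcon _).resolve_left ?_, (hcon _).resolve_left ?_⟩)
          <;> revert i <;> simp
      · obtain ⟨i', hi'⟩ := hI.2.2.1 y
        exact ⟨i', by simp [hyd, hi']⟩
    · refine hind.subset ?_
      rintro y (h | ⟨i₁, i₂, hne, h₁, h₂⟩)
      · exact Or.inr (Or.inl (by simpa using h))
      · by_cases hyd : y = d
        · exact Or.inl hyd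
        · exact Or.inr (Or.inr ⟨i₁, i₂, hne, by simpa [hyd] using h₁, by simpa [hyd] using h₂⟩)

/-- `N ⊕₂ U_{2,4}^L`, the matroid obtained from `N` by taking a 2-sum with a copy of `U_{2,4}` on
each element `e` of `L`. It lives on `α ⊕ α × Fin 3`: an element `x ∉ L` of `N` appears as `inl x`,
and the three elements other than `e` of the copy of `U_{2,4}` at `e` are `inr (e, 0)`,
`inr (e, 1)`, `inr (e, 2)`. The theorems `u24Sum_empty` and `u24Sum_insert` below show that it is
obtained from `N` by a sequence of 2-sums. -/
def u24Sum (N : Matroid α) [hN : N.Finite] (L : Set α) : Matroid (α ⊕ α × Fin 3) :=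
  (IndepMatroid.ofFinite
    (E := Sum.inl '' (N.E \ L) ∪ Sum.inr '' ((N.E ∩ L) ×ˢ (univ : Set (Fin 3))))
    ((hN.ground_finite.sdiff.image _).union
      (((hN.ground_finite.inter_of_left L).prod finite_univ).image _))
    (U24Indep N L)
    (by
      refine ⟨by simp, by simp, by simp, ?_⟩
      have : u24Trace (∅ : Set (α ⊕ α × Fin 3)) = ∅ := by ext; simp [u24Trace]
      rw [this]
      exact N.empty_indep)
    (by
      intro I J hJ hIJ
      refine ⟨fun x hx ↦ hJ.1 x (hIJ hx), fun x i hx ↦ hJ.2.1 x i (hIJ hx), fun x ↦ ?_, ?_⟩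
      · obtain ⟨i, hi⟩ := hJ.2.2.1 x
        exact ⟨i, fun h ↦ hi (hIJ h)⟩
      · refine hJ.2.2.2.subset ?_
        rintro x (h | ⟨i, j, hne, hi, hj⟩)
        · exact Or.inl (hIJ h)
        · exact Or.inr ⟨i, j, hne, hIJ hi, hIJ hj⟩)
    (by
      intro I J hI hJ hlt
      have hf : ∀ K, U24Indep N L K → K.Finite := by
        intro K hK
        refine ((hN.ground_finite.image Sum.inl).union
          ((hN.ground_finite.prod (finite_univ (α := Fin 3))).image Sum.inr)).subset ?_
        rintro (x | ⟨x, i⟩) hx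
        · exact Or.inl ⟨x, (hK.1 x hx).1, rfl⟩
        · exact Or.inr ⟨(x, i), ⟨(hK.2.1 x i hx).1, mem_univ _⟩, rfl⟩
      exact u24_aug N L (hf I hI) (hf J hJ) hI hJ hlt)
    (by
      rintro I hI (x | ⟨x, i⟩) hx
      · exact Or.inl ⟨x, hI.1 x hx, rfl⟩
      · exact Or.inr ⟨(x, i), ⟨hI.2.1 x i hx, mem_univ _⟩, rfl⟩)).matroid

theorem u24Sum_ground (N : Matroid α) [N.Finite] (L : Set α) : (N.u24Sum L).E =
    Sum.inl '' (N.E \ L) ∪ Sum.inr '' ((N.E ∩ L) ×ˢ (univ : Set (Fin 3))) := rfl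

theorem u24Sum_indep_iff (N : Matroid α) [N.Finite] (L : Set α) (I : Set (α ⊕ α × Fin 3)) :
    (N.u24Sum L).Indep I ↔ U24Indep N L I := Iff.rfl

theorem uniformTwo_indep_iff (S : Set α) (hS : S.Finite) (I : Set α) :
    (uniformTwo S hS).Indep I ↔ I ⊆ S ∧ I.encard ≤ 2 := Iff.rfl

theorem u24Sum_empty (N : Matroid α) [N.Finite] :
    N.u24Sum ∅ = N.map Sum.inl Sum.inl_injective.injOn := by
  refine ext_indep (by simp [u24Sum_ground]) fun I hI ↦ ?_
  rw [u24Sum_indep_iff, map_indep_iff]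
  have hI' : ∀ x i, Sum.inr (x, i) ∉ I := by
    intro x i h
    simpa [u24Sum_ground] using hI h
  have htr : u24Trace I = Sum.inl ⁻¹' I := by
    ext x; simp [u24Trace, hI']
  have hIe : I = Sum.inl '' (Sum.inl ⁻¹' I : Set α) := by
    ext (x | ⟨x, i⟩)
    · simp
    · simp [hI']
  constructor
  · rintro ⟨-, -, -, h⟩
    exact ⟨_, htr ▸ h, hIe⟩
  · rintro ⟨I₀, h₀, rfl⟩
    refine ⟨fun x hx ↦ ?_, fun x i h ↦ (hI' x i h).elim, fun x ↦ ⟨0, hI' x 0⟩, ?_⟩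
    · simpa using h₀.subset_ground (by simpa using hx)
    · rwa [htr, preimage_image_eq _ Sum.inl_injective]

theorem uniformTwo_isCircuit_iff (S : Set α) (hS : S.Finite) (C : Set α) :
    (uniformTwo S hS).IsCircuit C ↔ C ⊆ S ∧ C.encard = 3 := by
  rw [isCircuit_iff_forall_ssubset, dep_iff]
  change (¬ (C ⊆ S ∧ C.encard ≤ 2) ∧ C ⊆ S) ∧ (∀ I, I ⊂ C → I ⊆ S ∧ I.encard ≤ 2) ↔ _
  constructor
  · rintro ⟨⟨h, hCS⟩, hss⟩
    refine ⟨hCS, le_antisymm ?_ ?_⟩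
    · obtain rfl | ⟨x, hx⟩ := C.eq_empty_or_nonempty
      · simp
      · rw [← encard_sdiff_singleton_add_one hx]
        calc _ ≤ (2 : ℕ∞) + 1 := by
              gcongr
              exact (hss _ (sdiff_singleton_ssubset.2 hx)).2
          _ = 3 := by norm_num
    · have h2 : 2 < C.encard := not_le.1 fun h' ↦ h ⟨hCS, h'⟩
      have := Order.add_one_le_of_lt h2
      norm_num at this
      exact this
  · rintro ⟨hCS, h3⟩
    refine ⟨⟨fun h ↦ ?_, hCS⟩, fun I hI ↦ ⟨hI.subset.trans hCS, ?_⟩⟩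
    · rw [h3] at h
      exact absurd h.2 (by norm_num)
    · have hlt := ((hS.subset hCS).subset hI.subset).encard_lt_encard hI
      rw [h3] at hlt
      exact Order.le_of_lt_add_one (by norm_num; exact hlt)

/-- The four-element set on which the copy of `U_{2,4}` at `f` lives, `f` itself being `inl f`. -/
def u24Set (f : α) : Set (α ⊕ α × Fin 3) := insert (Sum.inl f) (range fun i ↦ Sum.inr (f, i))

theorem u24Set_finite (f : α) : (u24Set f).Finite := (finite_range _).insert _

theorem u24Set_encard (f : α) : (u24Set f).encard = 4 := by
  rw [u24Set, encard_insert_of_notMem (by simp), ← image_univ,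
    Function.Injective.encard_image (fun i j h ↦ by simpa using h), encard_univ]
  simp
  norm_num

theorem u24_insert_indep_iff (N : Matroid α) [N.Finite] (L : Set α) {f : α} (hf : f ∈ N.E \ L)
    (I : Set (α ⊕ α × Fin 3)) (hfI : Sum.inl f ∉ I) :
    U24Indep N (insert f L) I ↔ U24Indep N L (I \ u24Set f) ∧ (∃ i, Sum.inr (f, i) ∉ I) ∧
      ((∃ i j : Fin 3, i ≠ j ∧ Sum.inr (f, i) ∈ I ∧ Sum.inr (f, j) ∈ I) →
        U24Indep N L (insert (Sum.inl f) (I \ u24Set f))) := by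
  have hl : ∀ x, Sum.inl x ∈ I \ u24Set f ↔ Sum.inl x ∈ I := by
    intro x
    simp only [u24Set, mem_sdiff, mem_insert_iff, Sum.inl.injEq, mem_range, reduceCtorEq,
      exists_false, or_false, and_iff_left_iff_imp]
    rintro h rfl
    exact hfI h
  have hr : ∀ x i, Sum.inr (x, i) ∈ I \ u24Set f ↔ Sum.inr (x, i) ∈ I ∧ x ≠ f := by
    intro x i
    simp [u24Set, eq_comm]
  have htr : u24Trace (insert (Sum.inl f) (I \ u24Set f)) = insert f (u24Trace (I \ u24Set f)) := by
    ext x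
    simp only [u24Trace, mem_insert_iff, Sum.inl.injEq, reduceCtorEq, false_or, mem_ofPred_eq,
      or_assoc]
  have htr' : u24Trace I = u24Trace (I \ u24Set f) ∪
      {x | x = f ∧ ∃ i j : Fin 3, i ≠ j ∧ Sum.inr (f, i) ∈ I ∧ Sum.inr (f, j) ∈ I} := by
    ext x
    simp only [u24Trace, hl, hr, mem_union, mem_ofPred_eq]
    by_cases hxf : x = f
    · subst hxf
      simp [hfI]
    · simp [hxf]
  simp only [U24Indep, htr, htr', hl, hr, mem_insert_iff, Sum.inl.injEq, reduceCtorEq, false_or]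
  by_cases h2 : ∃ i j : Fin 3, i ≠ j ∧ Sum.inr (f, i) ∈ I ∧ Sum.inr (f, j) ∈ I
  · have hs : {x | x = f ∧ ∃ i j : Fin 3, i ≠ j ∧ Sum.inr (f, i) ∈ I ∧ Sum.inr (f, j) ∈ I} = {f} := by
      ext x; simp [h2]
    rw [hs, union_singleton]
    constructor
    · rintro ⟨a, b, c, d⟩
      have a' : ∀ x, Sum.inl x ∈ I → x ∈ N.E \ L :=
        fun x hx ↦ ⟨(a x hx).1, fun h ↦ (a x hx).2 (Or.inr h)⟩
      have b' : ∀ x i, Sum.inr (x, i) ∈ I ∧ x ≠ f → x ∈ N.E ∩ L :=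
        fun x i hx ↦ ⟨(b x i hx.1).1, (b x i hx.1).2.resolve_left hx.2⟩
      have c' : ∀ x, ∃ i, ¬ (Sum.inr (x, i) ∈ I ∧ x ≠ f) :=
        fun x ↦ (c x).imp fun i hi h ↦ hi h.1
      refine ⟨⟨a', b', c', d.subset (subset_insert _ _)⟩, c f, fun _ ↦ ⟨?_, b', c', d⟩⟩
      rintro x (rfl | hx)
      · exact hf
      · exact a' x hx
    · rintro ⟨⟨a, b, c, -⟩, e, h⟩
      refine ⟨fun x hx ↦ ⟨(a x hx).1, ?_⟩, fun x i hx ↦ ?_, fun x ↦ ?_, (h h2).2.2.2⟩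
      · rintro (rfl | h)
        · exact hfI hx
        · exact (a x hx).2 h
      · by_cases hxf : x = f
        · rw [hxf]; exact ⟨hf.1, Or.inl rfl⟩
        · exact ⟨(b x i ⟨hx, hxf⟩).1, Or.inr (b x i ⟨hx, hxf⟩).2⟩
      · by_cases hxf : x = f
        · exact hxf ▸ e
        · exact (c x).imp fun i hi h ↦ hi ⟨h, hxf⟩
  · have hs : {x | x = f ∧ ∃ i j : Fin 3, i ≠ j ∧ Sum.inr (f, i) ∈ I ∧ Sum.inr (f, j) ∈ I} = ∅ := by
      ext x; simp only [h2, and_false]; simp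
    rw [hs, union_empty]
    constructor
    · rintro ⟨a, b, c, d⟩
      refine ⟨⟨fun x hx ↦ ⟨(a x hx).1, fun h ↦ (a x hx).2 (Or.inr h)⟩,
        fun x i hx ↦ ⟨(b x i hx.1).1, (b x i hx.1).2.resolve_left hx.2⟩,
        fun x ↦ (c x).imp fun i hi h ↦ hi h.1, d⟩, c f, fun h ↦ (h2 h).elim⟩
    · rintro ⟨⟨a, b, c, d⟩, e, -⟩
      refine ⟨fun x hx ↦ ⟨(a x hx).1, ?_⟩, fun x i hx ↦ ?_, fun x ↦ ?_, d⟩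
      · rintro (rfl | h)
        · exact hfI hx
        · exact (a x hx).2 h
      · by_cases hxf : x = f
        · rw [hxf]; exact ⟨hf.1, Or.inl rfl⟩
        · exact ⟨(b x i ⟨hx, hxf⟩).1, Or.inr (b x i ⟨hx, hxf⟩).2⟩
      · by_cases hxf : x = f
        · exact hxf ▸ e
        · exact (c x).imp fun i hi h ↦ hi ⟨h, hxf⟩

/-- If `f ∉ L` is not a loop, then `N ⊕₂ U_{2,4}^(L ∪ {f})` is the 2-sum of `N ⊕₂ U_{2,4}^L` and a
copy of `U_{2,4}` on the element `f`. -/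
theorem u24Sum_insert (N : Matroid α) [N.Finite] (L : Set α) {f : α} (hf : N.IsNonloop f)
    (hfL : f ∉ L) :
    IsTwoSum (N.u24Sum (insert f L)) (N.u24Sum L) (Sum.inl f)
      (uniformTwo (u24Set f) (u24Set_finite f)) (Sum.inl f) := by
  set M := N.u24Sum (insert f L) with hM
  set M₁ := N.u24Sum L with hM₁
  have hfE : f ∈ N.E := hf.mem_ground
  have hfM₁ : Sum.inl f ∈ M₁.E := by
    rw [hM₁, u24Sum_ground]; exact Or.inl ⟨f, ⟨hfE, hfL⟩, rfl⟩
  have hfS : Sum.inl f ∈ u24Set f := Or.inl rfl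
  have hdisj : Disjoint (M₁.E \ {Sum.inl f}) (u24Set f \ {Sum.inl f}) := by
    rw [disjoint_left]
    rintro z ⟨hz, hzf⟩ ⟨hz', -⟩
    obtain rfl | ⟨i, rfl⟩ := hz'
    · exact hzf rfl
    · rw [hM₁, u24Sum_ground] at hz
      simp [hfL] at hz
  have hground : M.E = (M₁.E \ {Sum.inl f}) ∪ (u24Set f \ {Sum.inl f}) := by
    rw [hM, hM₁, u24Sum_ground, u24Sum_ground]
    ext (x | ⟨x, i⟩)
    · simp [u24Set]
      tauto
    · by_cases hxf : x = f
      · subst hxf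
        simp [u24Set, hfE]
      · simp [u24Set, hxf, Ne.symm hxf]
  have hfM : Sum.inl f ∉ M.E := by
    rw [hground]; simp
  set F : Set (α ⊕ α × Fin 3) := range fun i ↦ Sum.inr (f, i) with hF
  have hSF : u24Set f = insert (Sum.inl f) F := rfl
  have hfF : Sum.inl f ∉ F := by simp [hF]
  have hSF' : u24Set f \ {Sum.inl f} = F := by
    rw [hSF, insert_sdiff_self_of_notMem hfF]
  rw [hSF'] at hdisj hground
  have hF3 : F.encard = 3 := by
    have := u24Set_encard f
    rw [hSF, encard_insert_of_notMem hfF] at this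
    have h4 : (4 : ℕ∞) = 3 + 1 := by norm_num
    rw [h4] at this
    exact ENat.add_left_injective_of_ne_top (by simp) this
  have hFM₁ : Disjoint M₁.E F := by
    rw [disjoint_left] at hdisj ⊢
    intro z hz hzF
    exact hdisj ⟨hz, fun h ↦ hfF (h ▸ hzF)⟩ hzF
  have hpair : ∀ I : Set (α ⊕ α × Fin 3), 2 ≤ (I ∩ F).encard ↔
      ∃ i j : Fin 3, i ≠ j ∧ Sum.inr (f, i) ∈ I ∧ Sum.inr (f, j) ∈ I := by
    intro I
    have h12 : 2 ≤ (I ∩ F).encard ↔ 1 < (I ∩ F).encard := by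
      rw [← one_add_one_eq_two]
      exact ENat.add_one_le_iff (by simp)
    rw [h12, one_lt_encard_iff]
    constructor
    · rintro ⟨_, _, ⟨ha, i, rfl⟩, ⟨hb, j, rfl⟩, hne⟩
      exact ⟨i, j, fun h ↦ hne (by rw [h]), ha, hb⟩
    · rintro ⟨i, j, hne, hi, hj⟩
      exact ⟨_, _, ⟨hi, i, rfl⟩, ⟨hj, j, rfl⟩, by simpa using hne⟩
  have hsd : ∀ I : Set (α ⊕ α × Fin 3), Sum.inl f ∉ I → I \ u24Set f = I \ F := by
    intro I hI
    rw [hSF]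
    ext z
    simp only [mem_sdiff, mem_insert_iff, not_or]
    exact ⟨fun h ↦ ⟨h.1, h.2.2⟩, fun h ↦ ⟨h.1, fun hz ↦ hI (hz ▸ h.1), h.2⟩⟩
  have hind : ∀ I : Set (α ⊕ α × Fin 3), Sum.inl f ∉ I → (M.Indep I ↔ M₁.Indep (I \ F) ∧
      ¬ F ⊆ I ∧ (2 ≤ (I ∩ F).encard → M₁.Indep (insert (Sum.inl f) (I \ F)))) := by
    intro I hI
    rw [hM, u24Sum_indep_iff, u24_insert_indep_iff N L ⟨hfE, hfL⟩ I hI, hpair, hsd I hI]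
    have : (∃ i, Sum.inr (f, i) ∉ I) ↔ ¬ F ⊆ I := by
      rw [hF, range_subset_iff, not_forall]
    rw [this]
    rfl
  have hfind : M₁.Indep {Sum.inl f} := by
    rw [hM₁, u24Sum_indep_iff]
    refine ⟨fun x hx ↦ ?_, fun x i hx ↦ by simp at hx, fun x ↦ ⟨0, by simp⟩, ?_⟩
    · obtain rfl : x = f := by simpa using hx
      exact ⟨hfE, hfL⟩
    · have : u24Trace {(Sum.inl f : α ⊕ α × Fin 3)} = {f} := by ext; simp [u24Trace]
      rw [this]
      exact hf.indep
  have hcirc : ∀ C, ((M₁.IsCircuit C ∧ Sum.inl f ∉ C) ∨ C = F ∨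
      ∃ C₁ P, M₁.IsCircuit C₁ ∧ Sum.inl f ∈ C₁ ∧ P ⊆ F ∧ P.encard = 2 ∧
        C = (C₁ \ {Sum.inl f}) ∪ P) → M.IsCircuit C := by
    intro C hC
    rw [isCircuit_iff_forall_ssubset, dep_iff]
    rcases hC with ⟨hC, hfC⟩ | rfl | ⟨C₁, P, hC₁, hfC₁, hPF, hP, rfl⟩
    · have hCF : C \ F = C := sdiff_eq_left.2 (hFM₁.mono_left hC.subset_ground)
      refine ⟨⟨fun h ↦ ?_, ?_⟩, fun I hI ↦ ?_⟩
      · have := ((hind C hfC).1 h).1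
        rw [hCF] at this
        exact hC.not_indep this
      · rw [hground]
        exact subset_union_of_subset_left (subset_sdiff_singleton hC.subset_ground hfC) _
      · have hIF : Disjoint I F := hFM₁.mono_left (hI.subset.trans hC.subset_ground)
        rw [hind I (fun h ↦ hfC (hI.subset h)), sdiff_eq_left.2 hIF, hIF.inter_eq]
        refine ⟨hC.ssubset_indep hI, fun h ↦ ?_, fun h ↦ by simp at h⟩
        exact hIF.le_bot ⟨h ⟨0, rfl⟩, ⟨0, rfl⟩⟩
    · refine ⟨⟨fun h ↦ ((hind F hfF).1 h).2.1 Subset.rfl, ?_⟩, fun I hI ↦ ?_⟩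
      · rw [hground]; exact subset_union_right
      · rw [hind I (fun h ↦ hfF (hI.subset h)), sdiff_eq_empty.2 hI.subset]
        exact ⟨M₁.empty_indep, fun h ↦ hI.not_subset h, fun _ ↦ by simpa using hfind⟩
    · have hC₁F : Disjoint (C₁ \ {Sum.inl f}) F :=
        hFM₁.mono_left (sdiff_subset.trans hC₁.subset_ground)
      have hfC : Sum.inl f ∉ (C₁ \ {Sum.inl f}) ∪ P := by
        rintro (h | h)
        · exact h.2 rfl
        · exact hfF (hPF h)
      have e1 : ((C₁ \ {Sum.inl f}) ∪ P) \ F = C₁ \ {Sum.inl f} := by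
        rw [union_sdiff_distrib, sdiff_eq_empty.2 hPF, union_empty, sdiff_eq_left.2 hC₁F]
      have e2 : ((C₁ \ {Sum.inl f}) ∪ P) ∩ F = P := by
        rw [union_inter_distrib_right, hC₁F.inter_eq, empty_union, inter_eq_left.2 hPF]
      have hnF : ∀ Q : Set (α ⊕ α × Fin 3), Q ⊆ P → ¬ F ⊆ Q := by
        intro Q hQ h
        have := encard_le_encard (h.trans hQ)
        rw [hF3, hP] at this
        exact absurd this (by norm_num)
      refine ⟨⟨fun h ↦ ?_, ?_⟩, fun I hI ↦ ?_⟩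
      · have := ((hind _ hfC).1 h).2.2
        rw [e1, e2, hP, insert_sdiff_singleton, insert_eq_of_mem hfC₁] at this
        exact hC₁.not_indep (this le_rfl)
      · rw [hground]
        exact union_subset_union (sdiff_subset_sdiff_left hC₁.subset_ground) hPF
      · rw [hind I (fun h ↦ hfC (hI.subset h))]
        have hIF : I \ F ⊆ C₁ \ {Sum.inl f} := e1 ▸ sdiff_subset_sdiff_left hI.subset
        have hIP : I ∩ F ⊆ P := (inter_subset_inter_left F hI.subset).trans e2.subset
        refine ⟨hC₁.ssubset_indep (hIF.trans_ssubset (sdiff_singleton_ssubset.2 hfC₁)),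
          fun h ↦ hnF _ hIP (subset_inter h Subset.rfl), fun h2 ↦ ?_⟩
        have hPfin : P.Finite := finite_of_encard_le_coe (k := 2) (by rw [hP]; rfl)
        have hPI : I ∩ F = P := (hPfin.subset hIP).eq_of_subset_of_encard_le hIP (by rwa [hP])
        refine hC₁.ssubset_indep (ssubset_of_subset_of_ne ?_ ?_)
        · exact insert_subset hfC₁ (hIF.trans sdiff_subset)
        · intro heq
          have h3 : C₁ \ {Sum.inl f} = I \ F := by
            rw [← heq, insert_sdiff_self_of_notMem fun h ↦ hfC (hI.subset h.1)]
          apply hI.ne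
          rw [h3, ← hPI, sdiff_union_inter]
  refine ⟨hfM₁, hfS, ?_, ?_, fun C ↦ ?_⟩
  · change Disjoint (M₁.E \ {Sum.inl f}) (u24Set f \ {Sum.inl f})
    rwa [hSF']
  · change M.E = (M₁.E \ {Sum.inl f}) ∪ (u24Set f \ {Sum.inl f})
    rwa [hSF']
  have hcirc' : M.IsCircuit C ↔ ((M₁.IsCircuit C ∧ Sum.inl f ∉ C) ∨ C = F ∨
      ∃ C₁ P, M₁.IsCircuit C₁ ∧ Sum.inl f ∈ C₁ ∧ P ⊆ F ∧ P.encard = 2 ∧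
        C = (C₁ \ {Sum.inl f}) ∪ P) := by
    refine ⟨fun hC ↦ ?_, hcirc C⟩
    have hfC : Sum.inl f ∉ C := fun h ↦ hfM (hC.subset_ground h)
    suffices h : ∃ D, D ⊆ C ∧ ((M₁.IsCircuit D ∧ Sum.inl f ∉ D) ∨ D = F ∨
      ∃ C₁ P, M₁.IsCircuit C₁ ∧ Sum.inl f ∈ C₁ ∧ P ⊆ F ∧ P.encard = 2 ∧
        D = (C₁ \ {Sum.inl f}) ∪ P) by
      obtain ⟨D, hDC, hD⟩ := h
      exact (hcirc D hD).eq_of_subset_isCircuit hC hDC ▸ hD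
    have hCM₁ : C \ F ⊆ M₁.E := by
      rw [sdiff_subset_iff, union_comm]
      refine hC.subset_ground.trans (hground.subset.trans ?_)
      exact union_subset_union_left _ sdiff_subset
    have hnind := hC.not_indep
    rw [hind C hfC] at hnind
    by_cases h1 : M₁.Indep (C \ F)
    · by_cases h2 : F ⊆ C
      · exact ⟨F, h2, Or.inr (Or.inl rfl)⟩
      · have h3 : 2 ≤ (C ∩ F).encard ∧ ¬ M₁.Indep (insert (Sum.inl f) (C \ F)) := by tauto
        have hdep : M₁.Dep (insert (Sum.inl f) (C \ F)) := ⟨h3.2, insert_subset hfM₁ hCM₁⟩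
        obtain ⟨C₁, hC₁s, hC₁⟩ := hdep.exists_isCircuit_subset
        obtain ⟨P, hP, hP2⟩ := exists_subset_encard_eq h3.1
        have hfC₁ : Sum.inl f ∈ C₁ := by
          by_contra hcon
          exact hC₁.not_indep (h1.subset ((subset_insert_iff_of_notMem hcon).1 hC₁s))
        refine ⟨_, ?_, Or.inr (Or.inr ⟨C₁, P, hC₁, hfC₁, hP.trans inter_subset_right, hP2, rfl⟩)⟩
        refine union_subset ?_ (hP.trans inter_subset_left)
        rw [sdiff_singleton_subset_iff]
        exact hC₁s.trans (insert_subset_insert sdiff_subset)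
    · obtain ⟨D, hDs, hD⟩ := Dep.exists_isCircuit_subset ⟨h1, hCM₁⟩
      exact ⟨D, hDs.trans sdiff_subset, Or.inl ⟨hD, fun h ↦ hfC (hDs h).1⟩⟩
  rw [hcirc']
  simp only [uniformTwo_isCircuit_iff]
  have hA : C = F ↔ (C ⊆ u24Set f ∧ C.encard = 3) ∧ Sum.inl f ∉ C := by
    constructor
    · rintro rfl
      exact ⟨⟨subset_insert _ _, hF3⟩, hfF⟩
    · rintro ⟨⟨h1, h2⟩, h3⟩
      have hCF : C ⊆ F := (subset_insert_iff_of_notMem h3).1 h1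
      exact ((finite_range _).subset hCF).eq_of_subset_of_encard_le hCF (by rw [hF3, h2])
  have hB : ∀ P : Set (α ⊕ α × Fin 3), (P ⊆ F ∧ P.encard = 2) ↔
      ∃ C₂, (C₂ ⊆ u24Set f ∧ C₂.encard = 3) ∧ Sum.inl f ∈ C₂ ∧ P = C₂ \ {Sum.inl f} := by
    intro P
    constructor
    · rintro ⟨h1, h2⟩
      have hfP : Sum.inl f ∉ P := fun h ↦ hfF (h1 h)
      refine ⟨insert (Sum.inl f) P, ⟨insert_subset_insert h1, ?_⟩, mem_insert _ _, ?_⟩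
      · rw [encard_insert_of_notMem hfP, h2]; norm_num
      · rw [insert_sdiff_self_of_notMem hfP]
    · rintro ⟨C₂, ⟨h1, h2⟩, h3, rfl⟩
      refine ⟨by rwa [sdiff_singleton_subset_iff], ?_⟩
      have := encard_sdiff_singleton_add_one h3
      rw [h2] at this
      have h4 : (3 : ℕ∞) = 2 + 1 := by norm_num
      rw [h4] at this
      exact ENat.add_left_injective_of_ne_top (by simp) this
  rw [hA]
  refine or_congr Iff.rfl (or_congr Iff.rfl ?_)
  constructor
  · rintro ⟨C₁, P, h1, h2, h3, h4, rfl⟩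
    obtain ⟨C₂, h5, h6, rfl⟩ := (hB P).1 ⟨h3, h4⟩
    exact ⟨C₁, C₂, h1, h2, h5, h6, rfl⟩
  · rintro ⟨C₁, C₂, h1, h2, h5, h6, rfl⟩
    obtain ⟨h3, h4⟩ := (hB _).2 ⟨C₂, h5, h6, rfl⟩
    exact ⟨C₁, _, h1, h2, h3, h4, rfl⟩

end Matroid

/-! ## Frame maps -/

namespace Matroid

universe w
variable {α : Type u} {β : Type v} {V : Type w}

/-! The proof rests on one equivalence: `N ⊕₂ U_{2,4}^L` is frame if and only if `(N, L)` is frame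
(`u24Sum_isFramed_iff`). The statement about excluded minors follows by matching one-element
operations on the two sides.

Both notions of frame are translated into frame maps, `IsFrameMap`: each element receives at most
two vertices, an independent set has at least as many vertices as elements, and each circuit is
connected and has no vertex used by only one of its elements. No balanced cycles are recorded,
because they can be recovered as the cycles that are circuits. `IsFramed M K` asks in addition that
the elements of `K` be joints, with at most one vertex. A frame matroid is the case `K = ∅`
(`isFrame_iff_isFramed`): a frame extension gives a map by taking supports of fundamental circuits,
and conversely a free joint can be added at every vertex (`jointIndep_aug`). A frame matroidal is
the case `K = L` (`Matroidal.isFrame_iff_isFramed`): the link with biased graphs is that a connected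
edge set without leaves is a cycle or contains a theta or a handcuff, and thetas and handcuffs have
more edges than vertices.

For the equivalence, the 2-sums are undone one at a time. If `e` is a joint at `w`, the three
elements that replace it can be drawn with a new vertex: one loop there and two links to `w`
(`IsLineSum.isFramed_of_joint`). Conversely, let the 2-sum have a frame extension and let `X` be the
set of elements of the first summand other than `e` (`IsLineSum.isFramed_insert`). The three line
elements have rank two. If two of them use only vertices `u` and `v`, one of these vertices is not
spanned by `X`, and contracting it makes `e` parallel to the other. Otherwise the line is a
triangle; a corner `w` is not spanned by `X`, and identifying the other two corners leaves a frame
map in which `e` is a joint at `w`.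

For minors, deleting or contracting an element of `N` outside `L` commutes with the 2-sums. Deleting
one of the three elements at `e ∈ L` leaves a series extension of `N ⊕₂ U_{2,4}^(L \ {e})`, and
contracting one leaves a parallel extension; both are frame exactly when removing `e` from `L` gives
a frame matroidal. The remaining case is contracting an element `y` of `N` parallel to some `e ∈ L`,
which is not allowed for matroidals: then the three elements at `e` become parallel, and the result
is again controlled by the removal of `e` from `L`. -/

/-- The vertices used by the elements of `X`. -/
def supp (S : α → Set V) (X : Set α) : Set V := ⋃ e ∈ X, S e

theorem mem_supp {S : α → Set V} {X : Set α} {x : V} : x ∈ supp S X ↔ ∃ e ∈ X, x ∈ S e := by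
  simp [supp]

theorem supp_mono {S : α → Set V} {X Y : Set α} (h : X ⊆ Y) : supp S X ⊆ supp S Y :=
  biUnion_subset_biUnion_left h

theorem subset_supp {S : α → Set V} {X : Set α} {e : α} (he : e ∈ X) : S e ⊆ supp S X :=
  fun _ hx ↦ mem_supp.2 ⟨e, he, hx⟩

theorem supp_insert (S : α → Set V) (e : α) (X : Set α) :
    supp S (insert e X) = S e ∪ supp S X := biUnion_insert e X S

theorem supp_singleton (S : α → Set V) (e : α) : supp S {e} = S e := biUnion_singleton e S

/-- `S` assigns to each element of `M` a set of at most two vertices, as the edge-vertex incidence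
of a biased graph representing `M` does; matroid loops are assigned no vertex. -/
structure IsFrameMap (M : Matroid α) (S : α → Set V) : Prop where
  encard_le : ∀ e ∈ M.E, (S e).encard ≤ 2
  encard_le_of_indep : ∀ I, M.Indep I → I.encard ≤ (supp S I).encard
  exists_ne : ∀ C, M.IsCircuit C → ∀ e ∈ C, ∀ v ∈ S e, ∃ f ∈ C, f ≠ e ∧ v ∈ S f
  connected : ∀ C, M.IsCircuit C → ∀ X ⊆ C, X.Nonempty → X ≠ C →
    ∃ e ∈ X, ∃ f ∈ C \ X, (S e ∩ S f).Nonempty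

/-- `M` has a frame map for which the elements of `K` use at most one vertex. -/
def IsFramed (M : Matroid α) (K : Set α) : Prop :=
  ∃ (V : Type) (S : α → Set V), M.IsFrameMap S ∧ ∀ k ∈ K, (S k).Subsingleton

theorem IsFramed.mono {M : Matroid α} {K K' : Set α} (h : M.IsFramed K) (hK : K' ⊆ K) :
    M.IsFramed K' := by
  obtain ⟨V, S, hS, h⟩ := h
  exact ⟨V, S, hS, fun k hk ↦ h k (hK hk)⟩

/-- Renaming vertices serves two purposes: passing to `Option V` makes room for a new vertex, and an
injection into `ℕ` brings the vertices into `Type`. -/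
theorem IsFrameMap.comp {W : Type*} {M : Matroid α} {S : α → Set V} (hS : M.IsFrameMap S)
    (g : V → W) (hg : InjOn g (supp S M.E)) : M.IsFrameMap fun e ↦ g '' S e := by
  have hsupp : ∀ X, supp (fun e ↦ g '' S e) X = g '' supp S X := by
    intro X; simp [supp, image_iUnion]
  refine ⟨fun e he ↦ (encard_image_le _ _).trans (hS.encard_le e he), fun I hI ↦ ?_, ?_, ?_⟩
  · rw [hsupp, InjOn.encard_image (hg.mono (supp_mono hI.subset_ground))]
    exact hS.encard_le_of_indep I hI
  · rintro C hC e he _ ⟨x, hx, rfl⟩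
    obtain ⟨f, hf, hfe, hxf⟩ := hS.exists_ne C hC e he x hx
    exact ⟨f, hf, hfe, x, hxf, rfl⟩
  · intro C hC X hX hne hXC
    obtain ⟨e, he, f, hf, x, hx⟩ := hS.connected C hC X hX hne hXC
    exact ⟨e, he, f, hf, g x, ⟨x, hx.1, rfl⟩, ⟨x, hx.2, rfl⟩⟩

theorem IsFrameMap.supp_finite {M : Matroid α} [M.Finite] {S : α → Set V} (hS : M.IsFrameMap S) :
    (supp S M.E).Finite :=
  M.ground_finite.biUnion fun e he ↦
    finite_of_encard_le_coe (k := 2) (by exact_mod_cast hS.encard_le e he)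

/-- `IsFramed` wants vertices in `Type`; a finite matroid uses only finitely many vertices, so
natural numbers suffice. -/
theorem IsFrameMap.isFramed {M : Matroid α} [M.Finite] {S : α → Set V} (hS : M.IsFrameMap S)
    {K : Set α} (hK : ∀ k ∈ K, (S k).Subsingleton) : M.IsFramed K := by
  classical
  have := hS.supp_finite.countable
  obtain ⟨g, hg⟩ := countable_iff_exists_injOn.1 this
  exact ⟨ℕ, _, hS.comp g hg, fun k hk ↦ (hK k hk).image g⟩

/-! ## Pullbacks -/

/-- The closure in `M` of subsets of `A` is the preimage under `f` of a closure in `P`. -/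
def IsPullbackOn (M : Matroid α) (P : Matroid β) (f : α → β) (A : Set α) : Prop :=
  ∀ x ∈ A, ∀ Y ⊆ A, x ∈ M.closure Y ↔ f x ∈ P.closure (f '' Y)

/-- Independence says that no element is spanned by the others, a condition on closures. Two
elements of `I` with the same image would span each other, so `f` is injective on `I` although it
may identify parallel elements elsewhere. -/
theorem IsPullbackOn.indep {M : Matroid α} {P : Matroid β} {f : α → β}
    (h : IsPullbackOn M P f M.E) {I : Set α} (hI : M.Indep I) :
    InjOn f I ∧ P.Indep (f '' I) := by
  have key : ∀ e ∈ I, f e ∉ P.closure (f '' (I \ {e})) := by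
    intro e he
    rw [← h e (hI.subset_ground he) _ (sdiff_subset.trans hI.subset_ground)]
    exact hI.notMem_closure_sdiff_of_mem he
  have hE : ∀ e ∈ M.E, f e ∈ P.E := by
    intro e he
    exact P.closure_subset_ground _ ((h e he {e} (by simpa)).1 (M.mem_closure_self e he))
  refine ⟨fun e he e' he' heq ↦ ?_, ?_⟩
  · by_contra hne
    refine key e he (heq ▸ P.mem_closure_of_mem' ?_ (hE e' (hI.subset_ground he')))
    exact ⟨e', ⟨he', fun h ↦ hne h.symm⟩, rfl⟩
  · have hIE : f '' I ⊆ P.E := by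
      rintro _ ⟨e, he, rfl⟩
      exact hE e (hI.subset_ground he)
    rw [indep_iff_forall_notMem_closure_sdiff hIE]
    rintro _ ⟨e, he, rfl⟩ hcon
    refine key e he (P.closure_subset_closure ?_ hcon)
    rintro _ ⟨⟨x, hx, rfl⟩, hne⟩
    exact ⟨x, ⟨hx, fun h ↦ hne (by rw [h]; rfl)⟩, rfl⟩

theorem IsPullbackOn.comp {γ : Type*} {M : Matroid α} {N : Matroid β} {P : Matroid γ} {g : α → β}
    {f : β → γ} {A : Set α} {A' : Set β} (hg : IsPullbackOn M N g A) (hf : IsPullbackOn N P f A')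
    (hA : MapsTo g A A') : IsPullbackOn M P (f ∘ g) A := by
  intro x hx Y hY
  rw [hg x hx Y hY, hf (g x) (hA hx) _ (hA.mono_left hY).image_subset, ← image_comp]
  rfl

/-- By exchange, `x` enters the closure when `e` is added to `Y` exactly when `e` enters it when `x`
is added. So closures of sets containing `e` are determined by which subsets of `A` span `e`. -/
theorem isPullbackOn_insert {M : Matroid α} {P : Matroid β} {f : α → β} {A : Set α} {e : α}
    (h : IsPullbackOn M P f A) (he : ∀ Y ⊆ A, e ∈ M.closure Y ↔ f e ∈ P.closure (f '' Y))
    (heM : e ∈ M.E) (heP : f e ∈ P.E) : IsPullbackOn M P f (insert e A) := by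
  have key : ∀ x ∈ A, ∀ Y ⊆ A,
      x ∈ M.closure (insert e Y) ↔ f x ∈ P.closure (insert (f e) (f '' Y)) := by
    intro x hx Y hY
    by_cases hxY : x ∈ M.closure Y
    · exact iff_of_true (M.closure_subset_closure (subset_insert _ _) hxY)
        (P.closure_subset_closure (subset_insert _ _) ((h x hx Y hY).1 hxY))
    have hxY' : f x ∉ P.closure (f '' Y) := fun h' ↦ hxY ((h x hx Y hY).2 h')
    have h1 := he (insert x Y) (insert_subset hx hY)
    have h2 := he Y hY
    rw [image_insert_eq] at h1
    constructor
    · intro h3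
      have := closure_exchange ⟨h3, hxY⟩
      exact (closure_exchange ⟨h1.1 this.1, fun h' ↦ this.2 (h2.2 h')⟩).1
    · intro h3
      have := closure_exchange ⟨h3, hxY'⟩
      exact (closure_exchange ⟨h1.2 this.1, fun h' ↦ this.2 (h2.1 h')⟩).1
  intro x hx Y hY
  by_cases heY : e ∈ Y
  · have hY' : Y \ {e} ⊆ A := by rwa [sdiff_singleton_subset_iff]
    have hYe : Y = insert e (Y \ {e}) := by rw [insert_sdiff_singleton, insert_eq_of_mem heY]
    rw [hYe, image_insert_eq]
    obtain rfl | hx := hx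
    · exact iff_of_true (M.mem_closure_of_mem' (mem_insert _ _) heM)
        (P.mem_closure_of_mem' (mem_insert _ _) heP)
    · exact key x hx _ hY'
  · have hY' : Y ⊆ A := (subset_insert_iff_of_notMem heY).1 hY
    obtain rfl | hx := hx
    · exact he Y hY'
    · exact h x hx Y hY'

/-! ## Extensions with a frame -/

/-- The elements of the base `B` in the fundamental circuit of `x`. -/
def coords (P : Matroid β) (B : Set β) (x : β) : Set β := {b ∈ B | x ∉ P.closure (B \ {b})}

/-- Closures of subsets of an independent set commute with intersections, and `D` is the
intersection of the sets `B \ {b}` with `b ∈ B \ D`. Thus the coordinates of `x` are the least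
subset of `B` spanning `x`. -/
theorem Indep.mem_closure_iff_coords_subset {P : Matroid β} {B D : Set β} (hB : P.Indep B)
    (hD : D ⊆ B) {x : β} (hx : x ∈ P.closure B) : x ∈ P.closure D ↔ P.coords B x ⊆ D := by
  constructor
  · rintro h b ⟨hb, hxb⟩
    by_contra hbD
    exact hxb (P.closure_subset_closure (subset_sdiff_singleton hD hbD) h)
  · intro h
    obtain hBD | hne := (B \ D).eq_empty_or_nonempty
    · rwa [hD.antisymm (sdiff_eq_empty.1 hBD)]
    have hDeq : D = ⋂₀ ((fun b ↦ B \ {b}) '' (B \ D)) := by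
      ext y
      simp only [sInter_image, mem_iInter, mem_sdiff, mem_singleton_iff]
      constructor
      · rintro hy b ⟨-, hbD⟩
        exact ⟨hD hy, fun h ↦ hbD (h ▸ hy)⟩
      · intro hy
        by_contra hyD
        obtain ⟨b, hb⟩ := hne
        exact (hy y ⟨(hy b hb).1, hyD⟩).2 rfl
    rw [hDeq, hB.closure_sInter_eq_biInter_closure_of_forall_subset (hne.image _) (by
      rintro _ ⟨b, -, rfl⟩; exact sdiff_subset)]
    simp only [mem_image, iInter_exists, biInter_and', iInter_iInter_eq_right, mem_iInter]
    intro b hb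
    by_contra hcon
    exact hb.2 (h ⟨hb.1, hcon⟩)

/-- The flat spanned by `D₁` is skew to `D₂`: a circuit through `x` in `Y ∪ D₂ ∪ {x}` that used some
`d ∈ D₂` would put `d` in the closure of `D₁ ∪ (D₂ \ {d})`. -/
theorem Indep.mem_closure_of_mem_closure_union {P : Matroid β} {D₁ D₂ Y : Set β}
    (hD : P.Indep (D₁ ∪ D₂)) (hdisj : Disjoint D₁ D₂) (hY : Y ⊆ P.closure D₁) {x : β}
    (hx : x ∈ P.closure D₁) (hxY : x ∈ P.closure (Y ∪ D₂)) : x ∈ P.closure Y := by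
  have key : ∀ d ∈ D₂, d ∉ P.closure (D₁ ∪ (D₂ \ {d})) := by
    intro d hd hcon
    refine hD.notMem_closure_sdiff_of_mem (Or.inr hd) (P.closure_subset_closure ?_ hcon)
    rw [union_sdiff_distrib, sdiff_singleton_eq_self (fun h ↦ hdisj.le_bot ⟨h, hd⟩)]
  have hYE : Y ⊆ P.E := hY.trans (P.closure_subset_ground _)
  by_cases hxY' : x ∈ Y
  · exact P.mem_closure_of_mem' hxY' (hYE hxY')
  have hxD : x ∉ D₂ := fun h ↦ key x h (P.closure_subset_closure subset_union_left hx)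
  obtain ⟨C, hC, hCc, hxC⟩ := (mem_closure_iff_exists_isCircuit (by simp [hxY', hxD])).1 hxY
  by_cases hCD : ∃ d ∈ C, d ∈ D₂
  · obtain ⟨d, hdC, hd⟩ := hCD
    refine absurd ?_ (key d hd)
    refine P.closure_subset_closure_of_subset_closure ?_ (hCc.mem_closure_sdiff_singleton_of_mem hdC)
    rintro y ⟨hyC, hyd⟩
    obtain rfl | hy | hy := hC hyC
    · exact P.closure_subset_closure subset_union_left hx
    · exact P.closure_subset_closure subset_union_left (hY hy)
    · exact P.mem_closure_of_mem' (Or.inr ⟨hy, hyd⟩) (hD.subset_ground (Or.inr hy))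
  · rw [mem_closure_iff_exists_isCircuit hxY']
    push Not at hCD
    refine ⟨C, fun y hy ↦ ?_, hCc, hxC⟩
    obtain h | h | h := hC hy
    · exact Or.inl h
    · exact Or.inr h
    · exact (hCD y hy h).elim

/-- `M` embeds through `f` in `P` (up to parallel elements), and each element of `M` is spanned in
`P` by at most two elements of the base `B`. -/
structure IsFrameExtension (M : Matroid α) (P : Matroid β) (f : α → β) (B : Set β) : Prop where
  isBase : P.IsBase B
  isPullbackOn : IsPullbackOn M P f M.E
  exists_subset : ∀ e ∈ M.E, ∃ D ⊆ B, D.encard ≤ 2 ∧ f e ∈ P.closure D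

namespace IsFrameExtension

variable {M : Matroid α} {P : Matroid β} {f : α → β} {B D : Set β}

theorem mem_ground (h : IsFrameExtension M P f B) {e : α} (he : e ∈ M.E) : f e ∈ P.E := by
  obtain ⟨D, -, -, hD⟩ := h.exists_subset e he
  exact P.closure_subset_ground _ hD

theorem mem_closure_iff (h : IsFrameExtension M P f B) {e : α} (he : e ∈ M.E) (hD : D ⊆ B) :
    f e ∈ P.closure D ↔ P.coords B (f e) ⊆ D :=
  h.isBase.indep.mem_closure_iff_coords_subset hD (h.isBase.closure_eq.symm ▸ h.mem_ground he)

theorem image_subset_closure_iff (h : IsFrameExtension M P f B) {X : Set α} (hX : X ⊆ M.E)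
    (hD : D ⊆ B) : f '' X ⊆ P.closure D ↔ supp (fun e ↦ P.coords B (f e)) X ⊆ D := by
  rw [image_subset_iff, supp, iUnion₂_subset_iff]
  exact forall₂_congr fun e he ↦ h.mem_closure_iff (hX he) hD

theorem supp_subset (P : Matroid β) (f : α → β) (B : Set β) (X : Set α) :
    supp (fun e ↦ P.coords B (f e)) X ⊆ B :=
  iUnion₂_subset fun _ _ ↦ sep_subset _ _

theorem image_subset_closure_supp (h : IsFrameExtension M P f B) {X : Set α} (hX : X ⊆ M.E) :
    f '' X ⊆ P.closure (supp (fun e ↦ P.coords B (f e)) X) :=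
  (h.image_subset_closure_iff hX (supp_subset _ _ _ _)).2 Subset.rfl

/-- The vertices are the elements of `B`, and the vertices of `e` are the coordinates of `f e`. -/
theorem isFrameMap (h : IsFrameExtension M P f B) :
    M.IsFrameMap fun e ↦ P.coords B (f e) := by
  have hB := h.isBase.indep
  refine ⟨fun e he ↦ ?_, fun I hI ↦ ?_, fun C hC e he b hb ↦ ?_, fun C hC X hXC hne hX ↦ ?_⟩
  · obtain ⟨D, hD, hD2, heD⟩ := h.exists_subset e he
    exact (encard_le_encard ((h.mem_closure_iff he hD).1 heD)).trans hD2
  · have h1 := h.isPullbackOn.indep hI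
    rw [← h1.1.encard_image, ← (hB.subset (supp_subset P f B I)).eRk_eq_encard, ← eRk_closure_eq]
    exact h1.2.encard_le_eRk_of_subset (h.image_subset_closure_supp hI.subset_ground)
  -- If `e` alone uses `b`, the rest of the circuit lies in the hyperplane spanned by `B \ {b}`, and
  -- hence so does `f e`.
  · by_contra! hcon
    refine hb.2 ?_
    have h1 := (h.isPullbackOn e (hC.subset_ground he) (C \ {e})
      (sdiff_subset.trans hC.subset_ground)).1 (hC.mem_closure_sdiff_singleton_of_mem he)
    refine P.closure_subset_closure_of_subset_closure ?_ h1
    rw [h.image_subset_closure_iff (sdiff_subset.trans hC.subset_ground) sdiff_subset]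
    rintro c hc
    obtain ⟨g, hg, hcg⟩ := mem_supp.1 hc
    exact ⟨hcg.1, fun hcb ↦ hcon g hg.1 hg.2 (hcb ▸ hcg)⟩
  -- If `X` and `C \ X` had no common vertex, they would be spanned by disjoint parts of `B`, hence
  -- be skew; then an element of `X` would already be spanned by the rest of `X`.
  · by_contra! hcon
    obtain ⟨e, he⟩ := hne
    set S : α → Set β := fun e ↦ P.coords B (f e)
    have hXE := hXC.trans hC.subset_ground
    have hCE : C \ X ⊆ M.E := sdiff_subset.trans hC.subset_ground
    have hdisj : Disjoint (supp S X) (supp S (C \ X)) := by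
      rw [disjoint_left]
      intro b hb hb'
      obtain ⟨e, he, hbe⟩ := mem_supp.1 hb
      obtain ⟨g, hg, hbg⟩ := mem_supp.1 hb'
      exact (hcon e he g hg).subset ⟨hbe, hbg⟩
    have h1 := (h.isPullbackOn e (hXE he) (C \ {e})
      (sdiff_subset.trans hC.subset_ground)).1 (hC.mem_closure_sdiff_singleton_of_mem (hXC he))
    have h2 : f e ∈ P.closure (f '' (X \ {e})) := by
      refine Indep.mem_closure_of_mem_closure_union (hB.subset ?_) hdisj ?_ ?_ ?_
      · exact union_subset (supp_subset _ _ _ _) (supp_subset _ _ _ _)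
      · exact (image_mono sdiff_subset).trans (h.image_subset_closure_supp hXE)
      · exact h.image_subset_closure_supp hXE ⟨e, he, rfl⟩
      · refine P.closure_subset_closure_of_subset_closure ?_ h1
        rintro _ ⟨x, ⟨hxC, hxe⟩, rfl⟩
        by_cases hxX : x ∈ X
        · exact P.mem_closure_of_mem' (Or.inl ⟨x, ⟨hxX, hxe⟩, rfl⟩) (h.mem_ground (hXE hxX))
        · exact P.closure_subset_closure subset_union_right
            (h.image_subset_closure_supp hCE ⟨x, ⟨hxC, hxX⟩, rfl⟩)
    rw [← h.isPullbackOn e (hXE he) _ (sdiff_subset.trans hXE)] at h2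
    refine (hC.ssubset_indep (hXC.ssubset_of_ne hX)).notMem_closure_sdiff_of_mem he h2

theorem comp {γ : Type*} {N : Matroid γ} {g : γ → α} (h : IsFrameExtension M P f B)
    (hg : IsPullbackOn N M g N.E) (hgE : MapsTo g N.E M.E) :
    IsFrameExtension N P (f ∘ g) B :=
  ⟨h.isBase, hg.comp h.isPullbackOn hgE, fun e he ↦ h.exists_subset (g e) (hgE he)⟩

end IsFrameExtension

end Matroid

/-! ## Adjoining joints -/

namespace Matroid

universe w
variable {α : Type u} {β : Type v} {V : Type w}

/-- Double counting of incidences: there are at most `2 * X.ncard` of them, while every vertex lies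
on two elements except possibly `v`, which lies on one. So `2 * (supp S X).ncard - 1 ≤ 2 * X.ncard`,
and parity gives the bound. -/
theorem ncard_supp_le {S : α → Set V} {X : Set α} (hX : X.Finite) (hS : ∀ x ∈ X, (S x).encard ≤ 2)
    {v : V} (hv : v ∈ supp S X)
    (h : ∀ w ∈ supp S X, w ≠ v → ∃ x ∈ X, ∃ y ∈ X, x ≠ y ∧ w ∈ S x ∧ w ∈ S y) :
    (supp S X).ncard ≤ X.ncard := by
  classical
  have hSf : ∀ x ∈ X, (S x).Finite := fun x hx ↦
    finite_of_encard_le_coe (k := 2) (by exact_mod_cast hS x hx)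
  have hWf : (supp S X).Finite := hX.biUnion hSf
  rw [ncard_eq_toFinset_card _ hWf, ncard_eq_toFinset_card _ hX]
  set W := hWf.toFinset
  set Y := hX.toFinset
  have hcount := Finset.sum_card_bipartiteAbove_eq_sum_card_bipartiteBelow
    (s := Y) (t := W) (fun x w ↦ w ∈ S x)
  have h1 : ∑ x ∈ Y, (Finset.bipartiteAbove (fun x w ↦ w ∈ S x) W x).card ≤ ∑ x ∈ Y, 2 := by
    refine Finset.sum_le_sum fun x hx ↦ ?_
    have hx' : x ∈ X := by simpa [Y] using hx
    have := hS x hx'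
    have h3 : ((Finset.bipartiteAbove (fun x w ↦ w ∈ S x) W x : Finset V) : Set V).encard ≤ 2 := by
      refine le_trans (encard_le_encard ?_) this
      intro w hw
      exact (by simpa [Finset.mem_bipartiteAbove] using hw : _ ∧ _).2
    rw [encard_coe_eq_coe_finsetCard] at h3
    exact_mod_cast h3
  have hvW : v ∈ W := by simpa [W] using hv
  have h2 : ∑ w ∈ W, 2 ≤ ∑ w ∈ W, (Finset.bipartiteBelow (fun x w ↦ w ∈ S x) Y w).card + 1 := by
    rw [← Finset.add_sum_erase _ _ hvW, ← Finset.add_sum_erase _ _ hvW]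
    have h3 : 1 ≤ (Finset.bipartiteBelow (fun x w ↦ w ∈ S x) Y v).card := by
      obtain ⟨x, hx, hvx⟩ := mem_supp.1 hv
      exact Finset.card_pos.2 ⟨x, by simp [Finset.mem_bipartiteBelow, Y, hx, hvx]⟩
    have h4 : ∑ w ∈ W.erase v, 2 ≤
        ∑ w ∈ W.erase v, (Finset.bipartiteBelow (fun x w ↦ w ∈ S x) Y w).card := by
      refine Finset.sum_le_sum fun w hw ↦ ?_
      have hw' := Finset.mem_erase.1 hw
      obtain ⟨x, hx, y, hy, hxy, hwx, hwy⟩ := h w (by simpa [W] using hw'.2) hw'.1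
      refine Finset.one_lt_card.2 ⟨x, ?_, y, ?_, hxy⟩ <;>
        simp [Finset.mem_bipartiteBelow, Y, *]
    omega
  rw [Finset.sum_const, smul_eq_mul] at h1 h2
  omega

/-- The elements of `I` all of whose vertices are in `W`. -/
def inside (S : α → Set V) (I : Set α) (W : Set V) : Set α := {z ∈ I | S z ⊆ W}

theorem inside_subset (S : α → Set V) (I : Set α) (W : Set V) : inside S I W ⊆ I := sep_subset _ _

/-- The vertices of the elements of `M` and of the joints. -/
abbrev jointMap (S : α → Set V) : α ⊕ V → Set V := Sum.elim S fun v ↦ {v}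

/-- Independence in the extension of `M` by a joint at each vertex in `V₀`. -/
def JointIndep (M : Matroid α) (S : α → Set V) (V₀ : Set V) (I : Set (α ⊕ V)) : Prop :=
  M.Indep (Sum.inl ⁻¹' I) ∧ (∀ v, Sum.inr v ∈ I → v ∈ V₀) ∧
    ∀ W ⊆ V₀, (inside (jointMap S) I W).ncard ≤ W.ncard

variable {M : Matroid α} {S : α → Set V} {V₀ : Set V}

theorem JointIndep.subset_ground {I : Set (α ⊕ V)} (hI : JointIndep M S V₀ I) :
    I ⊆ Sum.inl '' M.E ∪ Sum.inr '' V₀ := by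
  rintro (e | v) h
  · exact Or.inl ⟨e, hI.1.subset_ground h, rfl⟩
  · exact Or.inr ⟨v, hI.2.1 v h, rfl⟩

theorem JointIndep.finite [M.Finite] (hV : V₀.Finite) {I : Set (α ⊕ V)}
    (hI : JointIndep M S V₀ I) : I.Finite :=
  ((M.ground_finite.image _).union (hV.image _)).subset hI.subset_ground

/-- Call `W` tight if `I` has at least `W.ncard` elements inside it. The number of elements inside
`W` is supermodular in `W` and is bounded by `W.ncard`, so tight sets are closed under union. -/
theorem JointIndep.tight_union (hV : V₀.Finite) {I : Set (α ⊕ V)} (hIf : I.Finite)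
    (hI : JointIndep M S V₀ I) {W W' : Set V} (hW : W ⊆ V₀) (hW' : W' ⊆ V₀)
    (h : W.ncard ≤ (inside (jointMap S) I W).ncard)
    (h' : W'.ncard ≤ (inside (jointMap S) I W').ncard) :
    (W ∪ W').ncard ≤ (inside (jointMap S) I (W ∪ W')).ncard := by
  have hf : ∀ W, (inside (jointMap S) I W).Finite := fun W ↦ hIf.subset (inside_subset _ _ _)
  have h1 := ncard_union_add_ncard_inter (inside (jointMap S) I W) (inside (jointMap S) I W')
    (hf _) (hf _)
  have h2 := ncard_union_add_ncard_inter W W' (hV.subset hW) (hV.subset hW')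
  have h3 : inside (jointMap S) I W ∩ inside (jointMap S) I W' ⊆
      inside (jointMap S) I (W ∩ W') := fun z hz ↦ ⟨hz.1.1, subset_inter hz.1.2 hz.2.2⟩
  have h4 : inside (jointMap S) I W ∪ inside (jointMap S) I W' ⊆
      inside (jointMap S) I (W ∪ W') := by
    rintro z (hz | hz)
    · exact ⟨hz.1, hz.2.trans subset_union_left⟩
    · exact ⟨hz.1, hz.2.trans subset_union_right⟩
  have h5 := ncard_le_ncard h3 (hf _)
  have h6 := ncard_le_ncard h4 (hf _)
  have h7 := hI.2.2 (W ∩ W') (inter_subset_left.trans hW)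
  omega

theorem subset_pair_of_encard_le_two {A : Set V} (h : A.encard ≤ 2) {x y : V} (hx : x ∈ A)
    (hy : y ∈ A) (hxy : x ≠ y) : A = {x, y} := by
  refine ((toFinite _).eq_of_subset_of_encard_le (pair_subset hx hy) ?_).symm
  rw [encard_pair hxy]
  exact h

theorem ncard_inside_add (S : α → Set V) {I : Set α} (hI : I.Finite) (W : Set V) :
    (inside S I W).ncard + {z ∈ I | ¬ S z ⊆ W}.ncard = I.ncard := by
  rw [← ncard_union_eq _ (hI.subset (inside_subset S I W)) (hI.subset (sep_subset _ _))]
  · congr 1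
    ext z
    simp only [inside, mem_union, mem_ofPred_eq]
    tauto
  · rw [disjoint_left]
    exact fun z hz hz' ↦ hz'.2 hz.2

/-- When `z` keeps independence in `M`, it can be rejected only by a set of vertices that is already
full and that contains every vertex of `z`. -/
theorem exists_tight_of_not {I : Set (α ⊕ V)} (hIf : I.Finite) (hI : JointIndep M S V₀ I)
    {z : α ⊕ V} (hz : z ∉ I) (hzi : M.Indep (Sum.inl ⁻¹' insert z I))
    (hzV : ∀ v, z = Sum.inr v → v ∈ V₀) (h : ¬ JointIndep M S V₀ (insert z I)) :
    ∃ W ⊆ V₀, W.ncard ≤ (inside (jointMap S) I W).ncard ∧ jointMap S z ⊆ W := by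
  simp only [JointIndep, hzi, true_and, not_and, not_forall, not_le] at h
  obtain ⟨W, hW, hlt⟩ := h (by
    intro v hv
    obtain hv | hv := mem_insert_iff.1 hv
    · exact hzV v hv.symm
    · exact hI.2.1 v hv)
  have hle := hI.2.2 W hW
  refine ⟨W, hW, ?_, ?_⟩
  · have h1 : inside (jointMap S) (insert z I) W ⊆ insert z (inside (jointMap S) I W) := by
      rintro y ⟨rfl | hy, hyW⟩
      · exact mem_insert _ _
      · exact Or.inr ⟨hy, hyW⟩
    have h2 := ncard_le_ncard h1 ((hIf.subset (inside_subset _ _ _)).insert z)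
    have h3 := ncard_insert_le z (inside (jointMap S) I W)
    omega
  · by_contra hcon
    have h1 : inside (jointMap S) (insert z I) W = inside (jointMap S) I W := by
      ext y
      simp only [inside, mem_ofPred_eq, mem_insert_iff]
      constructor
      · rintro ⟨rfl | hy, hyW⟩
        · exact (hcon hyW).elim
        · exact ⟨hy, hyW⟩
      · exact fun hy ↦ ⟨Or.inr hy.1, hy.2⟩
    rw [h1] at hlt
    omega

/-- Let `U` be the largest tight set of `I`. It contains every tight set, so it holds all joints of
`I` and all joints of `J` that cannot be added. As `J` has at most `U.ncard` elements inside `U`, it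
has more elements than `I` outside, and augmentation in `M` supplies a candidate `e` there. The
candidate can fail only because of a circuit of `M`; the part of that circuit away from `U` then
produces a tight set not contained in `U`. -/
theorem jointIndep_aug [M.Finite] (hS : M.IsFrameMap S) (hV : V₀.Finite) (hSV : supp S M.E ⊆ V₀)
    {I J : Set (α ⊕ V)} (hI : JointIndep M S V₀ I) (hJ : JointIndep M S V₀ J)
    (hlt : I.ncard < J.ncard) : ∃ e ∈ J, e ∉ I ∧ JointIndep M S V₀ (insert e I) := by
  by_contra! hcon
  have hIf := hI.finite hV
  have hJf := hJ.finite hV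
  have hfin : {W | W ⊆ V₀ ∧ W.ncard ≤ (inside (jointMap S) I W).ncard}.Finite :=
    hV.finite_subsets.subset fun W hW ↦ hW.1
  obtain ⟨U, hU⟩ := hfin.exists_maximal ⟨∅, by simp⟩
  obtain ⟨hUV, hUt⟩ := hU.prop
  have hmax : ∀ W ⊆ V₀, W.ncard ≤ (inside (jointMap S) I W).ncard → W ⊆ U := by
    intro W hW hWt
    have := hU.le_of_ge ⟨union_subset hUV hW, hI.tight_union hV hIf hUV hW hUt hWt⟩
      subset_union_left
    exact subset_union_right.trans this
  have hIr : ∀ v, Sum.inr v ∈ I → v ∈ U := by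
    intro v hv
    refine hmax {v} (by simpa using hI.2.1 v hv) ?_ rfl
    rw [ncard_singleton, Nat.one_le_iff_ne_zero, Ne, ncard_eq_zero (hIf.subset (inside_subset _ _ _))]
    exact Nonempty.ne_empty ⟨Sum.inr v, hv, Subset.rfl⟩
  have hJr : ∀ v, Sum.inr v ∈ J → v ∈ U := by
    intro v hv
    by_cases hvI : Sum.inr v ∈ I
    · exact hIr v hvI
    have hpre : (Sum.inl ⁻¹' insert (Sum.inr v) I : Set α) = Sum.inl ⁻¹' I := by ext; simp
    obtain ⟨W, hW, hWt, hvW⟩ := exists_tight_of_not hIf hI hvI (by rw [hpre]; exact hI.1)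
      (by rintro _ ⟨rfl⟩; exact hJ.2.1 v hv) (hcon _ hv hvI)
    exact hmax W hW hWt (hvW rfl)
  -- No element of `I` crosses the boundary of `U`: otherwise `U` with its other vertex would be a
  -- larger tight set.
  have hcross : ∀ e, Sum.inl e ∈ I → ∀ x ∈ S e, x ∈ U → S e ⊆ U := by
    intro e he x hx hxU
    by_contra hSU
    obtain ⟨y, hy, hyU⟩ := not_subset.1 hSU
    have heE := hI.1.subset_ground he
    have hSe : S e = {x, y} :=
      subset_pair_of_encard_le_two (hS.encard_le e heE) hx hy fun h ↦ hyU (h ▸ hxU)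
    refine hyU (hmax (insert y U) (insert_subset (hSV (subset_supp heE hy)) hUV) ?_ (mem_insert _ _))
    have h1 : insert (Sum.inl e) (inside (jointMap S) I U) ⊆
        inside (jointMap S) I (insert y U) := by
      refine insert_subset ⟨he, ?_⟩ fun z hz ↦ ⟨hz.1, hz.2.trans (subset_insert _ _)⟩
      simp only [jointMap, Sum.elim_inl, hSe]
      exact pair_subset (Or.inr hxU) (Or.inl rfl)
    have h2 := ncard_le_ncard h1 (hIf.subset (inside_subset _ _ _))
    rw [ncard_insert_of_notMem (fun h ↦ hSU h.2) (hIf.subset (inside_subset _ _ _))] at h2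
    rw [ncard_insert_of_notMem hyU (hV.subset hUV)]
    omega
  have hIc := ncard_inside_add (jointMap S) hIf U
  have hJc := ncard_inside_add (jointMap S) hJf U
  have hJU := hJ.2.2 U hUV
  set A : Set α := {e | Sum.inl e ∈ I ∧ ¬ S e ⊆ U} with hA
  set A' : Set α := {e | Sum.inl e ∈ J ∧ ¬ S e ⊆ U} with hA'
  have hAI : {z ∈ I | ¬ jointMap S z ⊆ U} = Sum.inl '' A := by
    ext (e | v)
    · simp [hA]
    · simpa using hIr v
  have hAJ : {z ∈ J | ¬ jointMap S z ⊆ U} = Sum.inl '' A' := by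
    ext (e | v)
    · simp [hA']
    · simpa using hJr v
  rw [hAI, ncard_image_of_injective _ Sum.inl_injective] at hIc
  rw [hAJ, ncard_image_of_injective _ Sum.inl_injective] at hJc
  have hAind : M.Indep A := hI.1.subset fun e he ↦ he.1
  have hAind' : M.Indep A' := hJ.1.subset fun e he ↦ he.1
  have hAlt : A.encard < A'.encard := by
    rw [← (M.set_finite A hAind.subset_ground).cast_ncard_eq,
      ← (M.set_finite A' hAind'.subset_ground).cast_ncard_eq]
    exact_mod_cast (by omega : A.ncard < A'.ncard)
  obtain ⟨e, ⟨⟨heJ, heU⟩, heA⟩, hei⟩ := hAind.augment hAind' hAlt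
  have heI : Sum.inl e ∉ I := fun h ↦ heA ⟨h, heU⟩
  have hpre : (Sum.inl ⁻¹' insert (Sum.inl e) I : Set α) = insert e (Sum.inl ⁻¹' I) := by
    ext; simp
  have heE : e ∈ M.E := hei.subset_ground (mem_insert _ _)
  -- If `e` kept independence in `M`, it would be rejected by a tight set, and its vertices would
  -- lie in `U`.
  have hdep : ¬ M.Indep (insert e (Sum.inl ⁻¹' I)) := by
    intro h
    rw [← hpre] at h
    obtain ⟨W, hW, hWt, heW⟩ := exists_tight_of_not hIf hI heI h (by simp) (hcon _ heJ heI)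
    exact heU (heW.trans (hmax W hW hWt))
  obtain ⟨C, hCs, hC⟩ := Dep.exists_isCircuit_subset (M := M) (X := insert e (Sum.inl ⁻¹' I))
    ⟨hdep, insert_subset heE hI.1.subset_ground⟩
  have hCI : ∀ x ∈ C, x ≠ e → Sum.inl x ∈ I := fun x hx hne ↦ (hCs hx).resolve_left hne
  -- Otherwise `C` would be contained in `insert e A`, which is independent by the choice of `e`.
  have hXne : {x ∈ C | S x ⊆ U}.Nonempty := by
    by_contra hemp
    rw [not_nonempty_iff_eq_empty] at hemp
    refine hC.not_indep (hei.subset fun x hx ↦ ?_)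
    by_cases hxe : x = e
    · exact Or.inl hxe
    · exact Or.inr ⟨hCI x hx hxe, fun h ↦ (hemp.subset (⟨hx, h⟩ : x ∈ {x ∈ C | S x ⊆ U}))⟩
  have heC : e ∈ C := by
    by_contra h
    exact hC.not_indep (hI.1.subset ((subset_insert_iff_of_notMem h).1 hCs))
  -- The circuit is connected, so some element of it crosses the boundary of `U`; by `hcross` only
  -- `e` can. So `e` has one vertex `p` in `U` and one vertex `v` outside.
  obtain ⟨x, ⟨hxC, hxU⟩, y, ⟨hyC, hyU⟩, p, hpx, hpy⟩ := hS.connected C hC {x ∈ C | S x ⊆ U}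
    (sep_subset _ _) hXne (fun h ↦ heU ((h.symm.subset heC).2))
  have hye : y = e := by
    by_contra hye
    exact hyU ⟨hyC, hcross y (hCI y hyC hye) p hpy (hxU hpx)⟩
  subst hye
  have hpU : p ∈ U := hxU hpx
  obtain ⟨v, hv, hvU⟩ := not_subset.1 heU
  have hSy : S y = {p, v} :=
    subset_pair_of_encard_le_two (hS.encard_le y heE) hpy hv fun h ↦ hvU (h ▸ hpU)
  set X : Set α := {x ∈ C | x ≠ y ∧ ¬ S x ⊆ U} with hX
  have hXI : ∀ x ∈ X, Sum.inl x ∈ I := fun x hx ↦ hCI x hx.1 hx.2.1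
  have hXU : ∀ x ∈ X, ∀ w ∈ S x, w ∉ U := fun x hx w hw hwU ↦ hx.2.2 (hcross x (hXI x hx) w hw hwU)
  obtain ⟨g, hgC, hgy, hvg⟩ := hS.exists_ne C hC y hyC v hv
  have hgX : g ∈ X := ⟨hgC, hgy, fun h ↦ hvU (h hvg)⟩
  have hXE : X ⊆ M.E := (sep_subset _ _).trans hC.subset_ground
  have hXf : X.Finite := M.set_finite X hXE
  have hle : (supp S X).ncard ≤ X.ncard := by
    -- A vertex of `X` other than `v` lies on a second element of the circuit. This element is again
    -- in `X`, since it is not inside `U` and `e` has only `v` outside `U`.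
    refine ncard_supp_le hXf (fun x hx ↦ hS.encard_le x (hXE hx)) (subset_supp hgX hvg) ?_
    intro w hw hwv
    obtain ⟨x, hx, hwx⟩ := mem_supp.1 hw
    obtain ⟨x', hx', hne, hwx'⟩ := hS.exists_ne C hC x hx.1 w hwx
    have hwU := hXU x hx w hwx
    refine ⟨x, hx, x', ⟨hx', ?_, fun h ↦ hwU (h hwx')⟩, hne.symm, hwx, hwx'⟩
    rintro rfl
    rw [hSy] at hwx'
    obtain rfl | rfl := hwx'
    · exact hwU hpU
    · exact hwv rfl
  refine hvU (hmax (supp S X) ((supp_mono hXE).trans hSV) (hle.trans ?_) (subset_supp hgX hvg))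
  rw [← ncard_image_of_injective X Sum.inl_injective]
  refine ncard_le_ncard ?_ (hIf.subset (inside_subset _ _ _))
  rintro _ ⟨x, hx, rfl⟩
  exact ⟨hXI x hx, subset_supp hx⟩

/-- For sets without joints the counting condition is automatic: the elements inside `W` form an
independent set, so there are at most as many of them as vertices they use. Hence the extension
restricts to `M`. -/
theorem jointIndep_inl_iff [M.Finite] (hS : M.IsFrameMap S) (hV : V₀.Finite) (I : Set α) :
    JointIndep M S V₀ (Sum.inl '' I) ↔ M.Indep I := by
  have hpre : (Sum.inl ⁻¹' (Sum.inl '' I : Set (α ⊕ V)) : Set α) = I :=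
    preimage_image_eq _ Sum.inl_injective
  rw [JointIndep, hpre]
  refine ⟨fun h ↦ h.1, fun h ↦ ⟨h, by simp, fun W hW ↦ ?_⟩⟩
  have h1 : inside (jointMap S) (Sum.inl '' I) W = Sum.inl '' inside S I W := by
    ext (x | x) <;> simp [inside]
  rw [h1, ncard_image_of_injective _ Sum.inl_injective]
  have h2 := hS.encard_le_of_indep _ (h.subset (inside_subset S I W))
  have h3 : supp S (inside S I W) ⊆ W := iUnion₂_subset fun x hx ↦ hx.2
  have h4 := h2.trans (encard_le_encard h3)
  rw [← (hV.subset hW).cast_ncard_eq, ← (M.set_finite _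
    ((inside_subset S I W).trans h.subset_ground)).cast_ncard_eq] at h4
  exact_mod_cast h4

/-- The extension of `M` by a joint at each vertex in `V₀`. -/
def jointExtension (M : Matroid α) [M.Finite] (S : α → Set V) (V₀ : Set V) (hS : M.IsFrameMap S)
    (hV : V₀.Finite) (hSV : supp S M.E ⊆ V₀) : Matroid (α ⊕ V) :=
  (IndepMatroid.ofFinite (E := Sum.inl '' M.E ∪ Sum.inr '' V₀)
    ((M.ground_finite.image _).union (hV.image _)) (JointIndep M S V₀)
    (by
      have := (jointIndep_inl_iff hS hV ∅).2 M.empty_indep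
      rwa [image_empty] at this)
    (fun I J hJ hIJ ↦ ⟨hJ.1.subset (preimage_mono hIJ), fun v hv ↦ hJ.2.1 v (hIJ hv),
      fun W hW ↦ (ncard_le_ncard (t := inside (jointMap S) J W) (fun z hz ↦ ⟨hIJ hz.1, hz.2⟩)
        ((hJ.finite hV).subset (inside_subset _ _ _))).trans (hJ.2.2 W hW)⟩)
    (fun I J hI hJ hlt ↦ jointIndep_aug hS hV hSV hI hJ hlt)
    (fun I hI ↦ hI.subset_ground)).matroid

section

variable [M.Finite] (hS : M.IsFrameMap S) (hV : V₀.Finite) (hSV : supp S M.E ⊆ V₀)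

theorem jointExtension_indep_iff (I : Set (α ⊕ V)) :
    (M.jointExtension S V₀ hS hV hSV).Indep I ↔ JointIndep M S V₀ I := Iff.rfl

theorem jointExtension_ground :
    (M.jointExtension S V₀ hS hV hSV).E = Sum.inl '' M.E ∪ Sum.inr '' V₀ := rfl

theorem jointExtension_finite : (M.jointExtension S V₀ hS hV hSV).Finite :=
  ⟨(M.ground_finite.image _).union (hV.image _)⟩

theorem jointExtension_comap : (M.jointExtension S V₀ hS hV hSV).comap Sum.inl = M := by
  refine ext_indep ?_ fun I hI ↦ ?_
  · rw [comap_ground_eq, jointExtension_ground]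
    ext; simp
  · rw [comap_indep_iff, jointExtension_indep_iff, jointIndep_inl_iff hS hV]
    exact and_iff_left Sum.inl_injective.injOn

theorem jointExtension_indep_inr {D : Set V} (hD : D ⊆ V₀) :
    (M.jointExtension S V₀ hS hV hSV).Indep (Sum.inr '' D) := by
  refine ⟨?_, ?_, fun W hW ↦ ?_⟩
  · have : (Sum.inl ⁻¹' (Sum.inr '' D : Set (α ⊕ V)) : Set α) = ∅ := by ext; simp
    rw [this]
    exact M.empty_indep
  · rintro v ⟨_, h, ⟨rfl⟩⟩
    exact hD h
  · have h1 : inside (jointMap S) (Sum.inr '' D) W ⊆ Sum.inr '' W := by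
      rintro _ ⟨⟨v, hv, rfl⟩, h⟩
      exact ⟨v, h rfl, rfl⟩
    have h2 := ncard_le_ncard h1 ((hV.subset hW).image _)
    rwa [ncard_image_of_injective _ Sum.inr_injective] at h2

/-- Together with the joints at its vertices, `e` would give `(S e).ncard + 1` elements inside `S
e`. -/
theorem jointExtension_mem_closure {e : α} (he : e ∈ M.E) :
    Sum.inl e ∈ (M.jointExtension S V₀ hS hV hSV).closure (Sum.inr '' S e) := by
  have hSe : S e ⊆ V₀ := (subset_supp he).trans hSV
  by_contra hcon
  rw [(jointExtension_indep_inr hS hV hSV hSe).notMem_closure_iff (Or.inl ⟨e, he, rfl⟩)] at hcon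
  have h1 := hcon.1.2.2 (S e) hSe
  have h2 : insert (Sum.inl e) (Sum.inr '' S e) ⊆
      inside (jointMap S) (insert (Sum.inl e) (Sum.inr '' S e)) (S e) := by
    refine fun z hz ↦ ⟨hz, ?_⟩
    obtain rfl | ⟨v, hv, rfl⟩ := hz
    · exact Subset.rfl
    · simpa using hv
  have hfin := hV.subset hSe
  have h3 := ncard_le_ncard h2 (((hfin.image _).insert _).subset (inside_subset _ _ _))
  rw [ncard_insert_of_notMem (by simp) (hfin.image _),
    ncard_image_of_injective _ Sum.inr_injective] at h3
  omega

theorem jointExtension_isBase :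
    (M.jointExtension S V₀ hS hV hSV).IsBase (Sum.inr '' V₀) := by
  rw [(jointExtension_indep_inr hS hV hSV Subset.rfl).isBase_iff_ground_subset_closure]
  rintro _ (⟨e, he, rfl⟩ | hv)
  · exact Matroid.closure_subset_closure _ (image_mono ((subset_supp he).trans hSV))
      (jointExtension_mem_closure hS hV hSV he)
  · exact Matroid.mem_closure_of_mem' _ hv (Or.inr hv)

theorem isPullbackOn_of_comap_eq {P : Matroid β} {f : α → β} {M : Matroid α} (h : P.comap f = M)
    (A : Set α) : IsPullbackOn M P f A := by
  subst h
  intro x hx Y hY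
  rw [comap_closure_eq, mem_preimage]

theorem jointExtension_isFrameExtension :
    IsFrameExtension M (M.jointExtension S V₀ hS hV hSV) Sum.inl (Sum.inr '' V₀) :=
  ⟨jointExtension_isBase hS hV hSV, isPullbackOn_of_comap_eq (jointExtension_comap hS hV hSV) _,
    fun e he ↦ ⟨_, image_mono ((subset_supp he).trans hSV), (encard_image_le _ _).trans
      (hS.encard_le e he), jointExtension_mem_closure hS hV hSV he⟩⟩

end

/-! ### Frame matroids as matroids with a frame map -/

theorem IsFrameExtension.isFramed [M.Finite] {P : Matroid β} {f : α → β} {B : Set β}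
    (h : IsFrameExtension M P f B) {K : Set α} (hKE : K ⊆ M.E)
    (hK : ∀ k ∈ K, ∃ D ⊆ B, D.Subsingleton ∧ f k ∈ P.closure D) : M.IsFramed K := by
  refine h.isFrameMap.isFramed fun k hk ↦ ?_
  obtain ⟨D, hD, hD1, hkD⟩ := hK k hk
  exact hD1.anti ((h.mem_closure_iff (hKE hk) hD).1 hkD)

theorem isFrame_iff_isFramed (M : Matroid α) [M.Finite] : M.IsFrame ↔ M.IsFramed ∅ := by
  constructor
  · rintro ⟨ι, P, hP, hPM, B, hB, hBs⟩
    refine IsFrameExtension.isFramed (P := P) (f := Sum.inl) (B := B)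
      ⟨hB, isPullbackOn_of_comap_eq hPM _, fun e he ↦ ?_⟩ (by simp) (by simp)
    have heP : Sum.inl e ∈ P.E := by rw [← hPM] at he; exact he
    obtain ⟨b, hb, b', hb', h⟩ := hBs _ heP
    exact ⟨{b, b'}, pair_subset hb hb', (encard_insert_le _ _).trans (by rw [encard_singleton]; rfl), h⟩
  · rintro ⟨V, S, hS, -⟩
    have hV : (supp (fun e ↦ some '' S e) M.E).Finite :=
      (hS.comp some (Option.some_injective V).injOn).supp_finite
    -- The extra joint `none` keeps the base nonempty even when `M` uses no vertex, as the
    -- definition of a frame matroid needs elements of the base to span each loop.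
    set V₀ : Set (Option V) := insert none (supp (fun e ↦ some '' S e) M.E)
    have hS' := hS.comp some (Option.some_injective V).injOn
    have hSV : supp (fun e ↦ some '' S e) M.E ⊆ V₀ := subset_insert _ _
    refine ⟨Option V, M.jointExtension _ V₀ hS' (hV.insert _) hSV, jointExtension_finite _ _ _,
      jointExtension_comap _ _ _, Sum.inr '' V₀, jointExtension_isBase _ _ _, ?_⟩
    have key : ∀ A : Set (Option V), A ⊆ V₀ → A.encard ≤ 2 → ∃ b ∈ V₀, ∃ b' ∈ V₀, A ⊆ {b, b'} := by
      intro A hA hA2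
      obtain rfl | ⟨x, hx⟩ := A.eq_empty_or_nonempty
      · exact ⟨none, mem_insert _ _, none, mem_insert _ _, empty_subset _⟩
      by_cases hy : ∃ y ∈ A, x ≠ y
      · obtain ⟨y, hy, hxy⟩ := hy
        exact ⟨x, hA hx, y, hA hy, (subset_pair_of_encard_le_two hA2 hx hy hxy).subset⟩
      · push Not at hy
        exact ⟨x, hA hx, x, hA hx, fun y h ↦ Or.inl (hy y h).symm⟩
    rintro _ (⟨e, he, rfl⟩ | ⟨v, hv, rfl⟩)
    · obtain ⟨b, hb, b', hb', h⟩ := key _ ((subset_supp he).trans hSV) (hS'.encard_le e he)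
      refine ⟨_, ⟨b, hb, rfl⟩, _, ⟨b', hb', rfl⟩, ?_⟩
      rw [← image_pair]
      exact Matroid.closure_subset_closure _ (image_mono h) (jointExtension_mem_closure _ _ _ he)
    · exact ⟨_, ⟨v, hv, rfl⟩, _, ⟨v, hv, rfl⟩,
        Matroid.mem_closure_of_mem' _ (by simp) (Or.inr ⟨v, hv, rfl⟩)⟩

theorem IsFramed.exists_isFrameExtension [M.Finite] {K : Set α} (hK : M.IsFramed K)
    (hKE : K ⊆ M.E) : ∃ (V : Type) (P : Matroid (α ⊕ V)) (B : Set V),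
      IsFrameExtension M P Sum.inl (Sum.inr '' B) ∧
      ∀ k ∈ K, ∃ D ⊆ Sum.inr '' B, D.Subsingleton ∧ Sum.inl k ∈ P.closure D := by
  obtain ⟨V, S, hS, hKS⟩ := hK
  exact ⟨V, M.jointExtension S _ hS hS.supp_finite Subset.rfl, supp S M.E,
    jointExtension_isFrameExtension _ _ _, fun k hk ↦ ⟨_, image_mono (subset_supp (hKE hk)),
      (hKS k hk).image _, jointExtension_mem_closure _ _ _ (hKE hk)⟩⟩

end Matroid

/-! ## Paths and cycles -/

namespace Graph

variable {V : Type v} {α : Type u}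

/-- `P` and `W` are the edge set and the vertex set of a path from `x` to `y`. -/
inductive IsPathOn (G : Graph V α) : Set α → Set V → V → V → Prop
  | nil (x : V) : IsPathOn G ∅ {x} x x
  | cons {P : Set α} {W : Set V} {x y z : V} {e : α} (he : G.IsLink e x y)
      (h : IsPathOn G P W y z) (hx : x ∉ W) : IsPathOn G (insert e P) (insert x W) x z

variable {G : Graph V α} {P P₁ P₂ Z C D : Set α} {W W₁ W₂ : Set V} {x y z w a b c d : V} {e f : α}

namespace IsPathOn

theorem left_mem (h : G.IsPathOn P W x y) : x ∈ W := by
  cases h <;> simp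

theorem right_mem (h : G.IsPathOn P W x y) : y ∈ W := by
  induction h with
  | nil x => rfl
  | cons he h hx ih => exact Or.inr ih

theorem finite (h : G.IsPathOn P W x y) : P.Finite ∧ W.Finite := by
  induction h with
  | nil x => exact ⟨finite_empty, finite_singleton x⟩
  | cons he h hx ih => exact ⟨ih.1.insert _, ih.2.insert _⟩

theorem mem_of_inc (h : G.IsPathOn P W x y) (he : e ∈ P) (hw : G.Inc e w) : w ∈ W := by
  induction h with
  | nil x => exact he.elim
  | cons hf h hx ih =>
    obtain rfl | he := he
    · obtain rfl | rfl := hw.eq_or_eq_of_isLink hf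
      · exact Or.inl rfl
      · exact Or.inr h.left_mem
    · exact Or.inr (ih he)

theorem notMem_of_inc (h : G.IsPathOn P W x y) (hw : G.Inc e w) (hwW : w ∉ W) : e ∉ P :=
  fun he ↦ hwW (h.mem_of_inc he hw)

theorem eq_of_eq_empty (h : G.IsPathOn ∅ W x y) : x = y := by
  generalize hP : (∅ : Set α) = P at h
  cases h with
  | nil => rfl
  | cons he h hx => exact ((insert_nonempty _ _).ne_empty hP.symm).elim

theorem eq_empty (h : G.IsPathOn P W x x) : P = ∅ := by
  cases h with
  | nil => rfl
  | cons he h hx => exact (hx h.right_mem).elim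

theorem eq_singleton (h : G.IsPathOn P W x x) : W = {x} := by
  cases h with
  | nil => rfl
  | cons he h hx => exact (hx h.right_mem).elim

theorem nonempty (h : G.IsPathOn P W x y) (hxy : x ≠ y) : P.Nonempty := by
  rw [nonempty_iff_ne_empty]
  rintro rfl
  exact hxy h.eq_of_eq_empty

theorem subset_ground (h : G.IsPathOn P W x y) : P ⊆ G.edgeSet := by
  induction h with
  | nil x => exact empty_subset _
  | cons he h hx ih => exact insert_subset he.edge_mem ih

theorem exists_inc_left (h : G.IsPathOn P W x y) (hP : P.Nonempty) : ∃ e ∈ P, G.Inc e x := by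
  cases h with
  | nil => simp at hP
  | cons he h hx => exact ⟨_, mem_insert _ _, he.inc_left⟩

theorem exists_inc (h : G.IsPathOn P W x y) (hP : P.Nonempty) (hw : w ∈ W) :
    ∃ e ∈ P, G.Inc e w := by
  induction h with
  | nil => simp at hP
  | @cons P W x y z e he h hx ih =>
    obtain rfl | hw := hw
    · exact ⟨_, mem_insert _ _, he.inc_left⟩
    obtain rfl | hP := P.eq_empty_or_nonempty
    · obtain rfl := h.eq_of_eq_empty
      rw [h.eq_singleton] at hw
      obtain rfl := hw
      exact ⟨_, mem_insert _ _, he.inc_right⟩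
    · obtain ⟨f, hf, hfw⟩ := ih hP hw
      exact ⟨f, Or.inr hf, hfw⟩

theorem vertsOf_eq (h : G.IsPathOn P W x y) (hP : P.Nonempty) : G.vertsOf P = W := by
  ext w
  exact ⟨fun ⟨e, he, hw⟩ ↦ h.mem_of_inc he hw, fun hw ↦ h.exists_inc hP hw⟩

theorem ncard_eq (h : G.IsPathOn P W x y) : P.ncard + 1 = W.ncard := by
  induction h with
  | nil => simp
  | cons he h hx ih =>
    rw [ncard_insert_of_notMem hx h.finite.2, ncard_insert_of_notMem
      (h.notMem_of_inc he.inc_left hx) h.finite.1, ih]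

theorem ne_of_isLink (h : G.IsPathOn P W x y) (he : e ∈ P) (hab : G.IsLink e a b) : a ≠ b := by
  induction h with
  | nil => exact he.elim
  | cons hf h hx ih =>
    obtain rfl | he := he
    · rintro rfl
      obtain ⟨rfl, rfl⟩ | ⟨rfl, rfl⟩ := hab.eq_and_eq_or_eq_and_eq hf
      · exact hx h.left_mem
      · exact hx h.left_mem
    · exact ih he

theorem joinEdge (h₁ : G.IsPathOn P₁ W₁ a b) (he : G.IsLink e b c) (h₂ : G.IsPathOn P₂ W₂ c d)
    (hW : Disjoint W₁ W₂) : G.IsPathOn (P₁ ∪ insert e P₂) (W₁ ∪ W₂) a d := by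
  induction h₁ with
  | nil x =>
    rw [empty_union, singleton_union]
    exact cons he h₂ (by simpa using hW)
  | cons hf h hx ih =>
    rw [insert_union, insert_union]
    rw [disjoint_insert_left] at hW
    exact cons hf (ih he hW.2) (by simp [hx, hW.1])

theorem append (h₁ : G.IsPathOn P₁ W₁ a b) (h₂ : G.IsPathOn P₂ W₂ b c)
    (hW : W₁ ∩ W₂ ⊆ {b}) : G.IsPathOn (P₁ ∪ P₂) (W₁ ∪ W₂) a c := by
  induction h₁ with
  | nil x =>
    rwa [empty_union, singleton_union, insert_eq_of_mem h₂.left_mem]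
  | cons hf h hx ih =>
    rw [insert_union, insert_union]
    refine cons hf (ih h₂ ((inter_subset_inter_left _ (subset_insert _ _)).trans hW)) ?_
    rintro (h' | h')
    · exact hx h'
    · obtain rfl := hW ⟨mem_insert _ _, h'⟩
      exact hx h.right_mem

theorem reverse (h : G.IsPathOn P W x y) : G.IsPathOn P W y x := by
  induction h with
  | nil x => exact nil x
  | @cons P W x y z e he h hx ih =>
    have := ih.joinEdge he.symm (nil x) (by simpa using hx)
    rwa [insert_empty_eq, union_singleton, union_singleton] at this

theorem exists_inc_right (h : G.IsPathOn P W x y) (hP : P.Nonempty) : ∃ e ∈ P, G.Inc e y :=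
  h.reverse.exists_inc_left hP

theorem eq_of_inc_left (h : G.IsPathOn P W x y) (he : e ∈ P) (hf : f ∈ P) (hex : G.Inc e x)
    (hfx : G.Inc f x) : e = f := by
  cases h with
  | nil => exact he.elim
  | cons hg h hx =>
    obtain rfl | he := he
    · obtain rfl | hf := hf
      · rfl
      · exact (hx (h.mem_of_inc hf hfx)).elim
    · exact (hx (h.mem_of_inc he hex)).elim

theorem eq_of_inc_right (h : G.IsPathOn P W x y) (he : e ∈ P) (hf : f ∈ P) (hex : G.Inc e y)
    (hfx : G.Inc f y) : e = f := h.reverse.eq_of_inc_left he hf hex hfx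

theorem split (h : G.IsPathOn P W x y) (hw : w ∈ W) : ∃ P₁ P₂ W₁ W₂,
    G.IsPathOn P₁ W₁ x w ∧ G.IsPathOn P₂ W₂ w y ∧ P = P₁ ∪ P₂ ∧ W = W₁ ∪ W₂ ∧
      W₁ ∩ W₂ = {w} ∧ Disjoint P₁ P₂ := by
  induction h with
  | nil x =>
    obtain rfl := hw
    exact ⟨∅, ∅, {w}, {w}, nil w, nil w, by simp, by simp, by simp, by simp⟩
  | @cons P W x y z e he h hx ih =>
    by_cases hwx : w = x
    · subst hwx
      exact ⟨∅, _, {w}, _, nil w, cons he h hx, by simp, by simp, by simp, by simp⟩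
    · obtain ⟨P₁, P₂, W₁, W₂, h₁, h₂, rfl, rfl, hW, hP⟩ := ih (hw.resolve_left hwx)
      refine ⟨insert e P₁, P₂, insert x W₁, W₂, cons he h₁ fun hx' ↦ hx (Or.inl hx'), h₂,
        (insert_union ..).symm, (insert_union ..).symm, ?_, ?_⟩
      · rw [insert_inter_of_notMem fun hx' ↦ hx (Or.inr hx'), hW]
      · rw [disjoint_insert_left]
        exact ⟨h₂.notMem_of_inc he.inc_left fun hx' ↦ hx (Or.inr hx'), hP⟩

theorem exists_ne (h : G.IsPathOn P W x y) (he : e ∈ P) (hw : G.Inc e w) (hwx : w ≠ x)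
    (hwy : w ≠ y) : ∃ f ∈ P, f ≠ e ∧ G.Inc f w := by
  obtain ⟨P₁, P₂, W₁, W₂, h₁, h₂, rfl, rfl, -, hP⟩ := h.split (h.mem_of_inc he hw)
  obtain ⟨f₁, hf₁, hw₁⟩ := h₁.exists_inc_right (h₁.nonempty hwx.symm)
  obtain ⟨f₂, hf₂, hw₂⟩ := h₂.exists_inc_left (h₂.nonempty hwy)
  by_cases h1 : f₁ = e
  · exact ⟨f₂, Or.inr hf₂, fun h ↦ hP.le_bot ⟨hf₁, h1.trans h.symm ▸ hf₂⟩, hw₂⟩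
  · exact ⟨f₁, Or.inl hf₁, h1, hw₁⟩

end IsPathOn

theorem isPathOn_range {n : ℕ} {v : Fin (n + 1) → V} {e : Fin n → α} (hv : Function.Injective v)
    (he : ∀ i, G.IsLink (e i) (v i.castSucc) (v i.succ)) :
    G.IsPathOn (range e) (range v) (v 0) (v (Fin.last n)) := by
  induction n with
  | zero =>
    have h1 : range e = ∅ := range_eq_empty e
    have h2 : range v = {v 0} := by
      ext x
      simp [Fin.exists_fin_one, eq_comm]
    rw [h1, h2]
    exact IsPathOn.nil _
  | succ n ih =>
    have h := ih (v := fun i ↦ v i.succ) (e := fun i ↦ e i.succ)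
      (hv.comp (Fin.succ_injective _)) fun i ↦ by simpa using he i.succ
    have h1 : range e = insert (e 0) (range fun i : Fin n ↦ e i.succ) := by
      ext x
      simp [Fin.exists_fin_succ, eq_comm]
    have h2 : range v = insert (v 0) (range fun i : Fin (n + 1) ↦ v i.succ) := by
      ext x
      rw [mem_range, Fin.exists_fin_succ]
      simp [eq_comm]
    rw [h1, h2]
    refine IsPathOn.cons (he 0) h ?_
    rintro ⟨i, hi⟩
    exact Fin.succ_ne_zero i (hv hi)

theorem IsPathOn.exists_fin (h : G.IsPathOn P W x y) :
    ∃ (n : ℕ) (v : Fin (n + 1) → V) (e : Fin n → α),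
      Function.Injective v ∧ Function.Injective e ∧
      (∀ i, G.IsLink (e i) (v i.castSucc) (v i.succ)) ∧
      v 0 = x ∧ v (Fin.last n) = y ∧ P = range e ∧ W = range v := by
  induction h with
  | nil x =>
    refine ⟨0, fun _ ↦ x, Fin.elim0, fun i j _ ↦ Subsingleton.elim (α := Fin 1) i j, fun i ↦ i.elim0,
      fun i ↦ i.elim0, rfl, rfl, (range_eq_empty _).symm, ?_⟩
    simp
  | @cons P W x y z e he h hx ih =>
    obtain ⟨n, v, g, hv, hg, hl, rfl, rfl, rfl, rfl⟩ := ih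
    refine ⟨n + 1, Fin.cons x v, Fin.cons e g, Fin.cons_injective_iff.2 ⟨hx, hv⟩,
      Fin.cons_injective_iff.2 ⟨h.notMem_of_inc he.inc_left hx, hg⟩, ?_, rfl, ?_, ?_, ?_⟩
    · refine Fin.cases he fun i ↦ ?_
      simpa using hl i
    · rw [← Fin.succ_last, Fin.cons_succ]
    · exact (Fin.range_cons ..).symm
    · exact (Fin.range_cons ..).symm

/-- Replaces sequences indexed by `Fin` by the inductive predicate, which records the vertex set and
allows induction along the path. -/
theorem isPathSet_iff : G.IsPathSet P x y ↔ ∃ W, G.IsPathOn P W x y := by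
  constructor
  · rintro ⟨n, v, e, hv, he, rfl, rfl, rfl⟩
    exact ⟨_, isPathOn_range hv he⟩
  · rintro ⟨W, h⟩
    obtain ⟨n, v, g, hv, hg, hl, rfl, rfl, rfl, rfl⟩ := h.exists_fin
    exact ⟨n, v, g, hv, hl, rfl, rfl, rfl⟩

/-! ### Cycles as closed paths -/

/-- `C` and `W` are the edge set and the vertex set of a cycle through `x`, which starts
at `x` with the edge `e`. -/
def IsCycleAt (G : Graph V α) (C : Set α) (W : Set V) (x : V) : Prop :=
  ∃ e P y, G.IsLink e x y ∧ G.IsPathOn P W y x ∧ e ∉ P ∧ C = insert e P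

theorem isCycleSet_iff : G.IsCycleSet C ↔ ∃ W x, G.IsCycleAt C W x := by
  constructor
  · rintro ⟨n, v, e, hv, he, hl, rfl⟩
    have h := isPathOn_range (G := G) (e := fun i : Fin n ↦ e i.castSucc) hv fun i ↦ by
      have := hl i.castSucc
      rwa [Fin.coeSucc_eq_succ] at this
    have h2 := hl (Fin.last n)
    rw [Fin.last_add_one] at h2
    refine ⟨_, _, _, _, _, h2, h, ?_, ?_⟩
    · rintro ⟨i, hi⟩
      exact (Fin.castSucc_lt_last i).ne (he hi)
    · ext x
      rw [mem_range, Fin.exists_fin_succ']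
      simp [eq_comm, or_comm]
  · rintro ⟨W, x, e, P, y, he, h, heP, rfl⟩
    obtain ⟨n, v, g, hv, hg, hl, rfl, rfl, rfl, rfl⟩ := h.exists_fin
    refine ⟨n, v, Fin.snoc g e, hv, Fin.snoc_injective_iff.2 ⟨hg, heP⟩, ?_, ?_⟩
    · refine Fin.lastCases ?_ fun i ↦ ?_
      · rw [Fin.last_add_one, Fin.snoc_last]
        exact he
      · rw [Fin.coeSucc_eq_succ, Fin.snoc_castSucc]
        exact hl i
    · exact (Fin.range_snoc ..).symm

namespace IsCycleAt

theorem isCycleSet (h : G.IsCycleAt C W x) : G.IsCycleSet C := isCycleSet_iff.2 ⟨W, x, h⟩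

theorem rotate (h : G.IsCycleAt C W x) (hw : w ∈ W) : G.IsCycleAt C W w := by
  obtain ⟨e, P, y, he, hP, heP, rfl⟩ := h
  obtain ⟨P₁, P₂, W₁, W₂, h₁, h₂, rfl, rfl, hW, hdisj⟩ := hP.split hw
  cases h₂ with
  | nil => exact ⟨e, _, y, he, by simpa using hP, heP, rfl⟩
  | @cons P W _ z _ g hg h₂ hx =>
    -- The rotated cycle leaves `w` by the edge `g`, follows the rest of the path to `x`, crosses
    -- `e`, and returns along `P₁`.
    have hWd : Disjoint W W₁ := by
      rw [disjoint_left]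
      intro t ht ht'
      exact hx (hW.subset ⟨ht', Or.inr ht⟩ ▸ ht)
    refine ⟨g, _, z, hg, (by
      have := h₂.joinEdge he h₁ hWd
      rwa [union_comm W, ← insert_eq_of_mem h₁.right_mem, insert_union, ← union_insert] at this),
      ?_, ?_⟩
    · rintro (h | rfl | h)
      · exact hx (h₂.mem_of_inc h hg.inc_left)
      · exact heP (Or.inr (mem_insert _ _))
      · exact hdisj.le_bot ⟨h, mem_insert _ _⟩
    · ext t
      simp only [mem_insert_iff, mem_union]
      tauto

theorem finite (h : G.IsCycleAt C W x) : C.Finite ∧ W.Finite := by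
  obtain ⟨e, P, y, he, hP, heP, rfl⟩ := h
  exact ⟨hP.finite.1.insert e, hP.finite.2⟩

theorem ncard_eq (h : G.IsCycleAt C W x) : C.ncard = W.ncard := by
  obtain ⟨e, P, y, he, hP, heP, rfl⟩ := h
  rw [ncard_insert_of_notMem heP hP.finite.1, hP.ncard_eq]

theorem vertsOf_eq (h : G.IsCycleAt C W x) : G.vertsOf C = W := by
  ext w
  constructor
  · rintro ⟨f, hf, hw⟩
    obtain ⟨e, P, y, he, hP, heP, rfl⟩ := h
    obtain rfl | hf := hf
    · obtain rfl | rfl := hw.eq_or_eq_of_isLink he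
      · exact hP.right_mem
      · exact hP.left_mem
    · exact hP.mem_of_inc hf hw
  · intro hw
    obtain ⟨e, P, y, he, hP, heP, rfl⟩ := h.rotate hw
    exact ⟨e, mem_insert _ _, he.inc_left⟩

theorem subset_ground (h : G.IsCycleAt C W x) : C ⊆ G.edgeSet := by
  obtain ⟨e, P, y, he, hP, heP, rfl⟩ := h
  exact insert_subset he.edge_mem hP.subset_ground

theorem nonempty (h : G.IsCycleAt C W x) : C.Nonempty := by
  obtain ⟨e, P, y, he, hP, heP, rfl⟩ := h
  exact insert_nonempty _ _

theorem exists_ne (h : G.IsCycleAt C W x) (he : e ∈ C) (hw : G.Inc e w) :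
    C = {e} ∨ ∃ f ∈ C, f ≠ e ∧ G.Inc f w := by
  obtain ⟨g, P, y, hg, hP, hgP, rfl⟩ := h.rotate (h.vertsOf_eq.subset ⟨e, he, hw⟩)
  obtain rfl | hne := P.eq_empty_or_nonempty
  · left
    obtain rfl : e = g := by simpa using he
    simp
  · right
    by_cases heg : e = g
    · obtain ⟨f, hf, hfw⟩ := hP.exists_inc_right hne
      exact ⟨f, Or.inr hf, fun h ↦ hgP (heg ▸ h ▸ hf), hfw⟩
    · exact ⟨g, mem_insert _ _, fun h ↦ heg h.symm, hg.inc_left⟩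

/-- A loop in a cycle is the whole cycle. -/
theorem eq_singleton_of_isLoopAt (h : G.IsCycleAt C W x) (he : e ∈ C) (hw : G.IsLoopAt e w) :
    C = {e} := by
  obtain ⟨g, P, y, hg, hP, hgP, rfl⟩ := h
  obtain rfl | he := he
  · obtain ⟨rfl, rfl⟩ | ⟨rfl, rfl⟩ := hg.eq_and_eq_or_eq_and_eq hw
    · rw [hP.eq_empty, insert_empty_eq]
    · rw [hP.eq_empty, insert_empty_eq]
  · exact (hP.ne_of_isLink he hw rfl).elim

end IsCycleAt

/-! ### Ears -/

/-- An edge set `D` that enters an ear must follow it to the end, because at each inner vertex it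
continues with another edge of the ear. This is the inductive step for a path (`x ∉ W`) and also
closes up a cycle (`x = z`). -/
theorem ear_cons (he : G.IsLink e x y) (h : G.IsPathOn P W y z) (hx : x ∉ W ∨ x = z)
    (heP : e ∉ P) (hD : ∀ w ∈ W, w ≠ x → w ≠ z → ∀ f ∈ insert e P, f ∈ D → G.Inc f w →
      ∃ g ∈ insert e P, g ∈ D ∧ g ≠ f ∧ G.Inc g w)
    (ih : (P ∩ D).Nonempty → P ⊆ D) (hne : (insert e P ∩ D).Nonempty) : insert e P ⊆ D := by
  by_cases hyz : y = z
  · subst hyz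
    obtain rfl := h.eq_empty
    obtain ⟨f, hf, hfD⟩ := hne
    rw [insert_empty_eq] at hf ⊢
    obtain rfl := hf
    simpa using hfD
  have hyx : y ≠ x := by
    rintro rfl
    obtain hx | hx := hx
    · exact hx h.left_mem
    · exact hyz hx
  by_cases heD : e ∈ D
  · obtain ⟨g, rfl | hg, hgD, hge, -⟩ := hD y h.left_mem hyx hyz e (mem_insert _ _) heD he.inc_right
    · exact (hge rfl).elim
    · exact insert_subset heD (ih ⟨g, hg, hgD⟩)
  · obtain ⟨f, rfl | hf, hfD⟩ := hne
    · exact (heD hfD).elim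
    have hPD := ih ⟨f, hf, hfD⟩
    obtain ⟨f₀, hf₀, hf₀y⟩ := h.exists_inc_left (h.nonempty hyz)
    obtain ⟨g, rfl | hg, hgD, hge, hgy⟩ := hD y h.left_mem hyx hyz f₀ (Or.inr hf₀) (hPD hf₀) hf₀y
    · exact (heD hgD).elim
    · exact (hge (h.eq_of_inc_left hg hf₀ hgy hf₀y)).elim

theorem IsPathOn.subset_of_inter_nonempty (h : G.IsPathOn P W x y)
    (hD : ∀ w ∈ W, w ≠ x → w ≠ y → ∀ f ∈ P, f ∈ D → G.Inc f w →
      ∃ g ∈ P, g ∈ D ∧ g ≠ f ∧ G.Inc g w) (hne : (P ∩ D).Nonempty) : P ⊆ D := by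
  induction h with
  | nil => exact empty_subset _
  | @cons P W x y z e he h hx ih =>
    refine ear_cons he h (Or.inl hx) (h.notMem_of_inc he.inc_left hx)
      (fun w hw ↦ hD w (Or.inr hw)) (ih ?_) hne
    intro w hw hwy hwz f hf hfD hfw
    have hwx : w ≠ x := fun h' ↦ hx (h' ▸ hw)
    obtain ⟨g, rfl | hg, hgD, hgf, hgw⟩ := hD w (Or.inr hw) hwx hwz f (Or.inr hf) hfD hfw
    · obtain rfl | rfl := hgw.eq_or_eq_of_isLink he
      · exact (hwx rfl).elim
      · exact (hwy rfl).elim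
    · exact ⟨g, hg, hgD, hgf, hgw⟩

theorem IsCycleAt.subset_of_inter_nonempty (h : G.IsCycleAt C W x)
    (hD : ∀ w ∈ W, w ≠ x → ∀ f ∈ C, f ∈ D → G.Inc f w →
      ∃ g ∈ C, g ∈ D ∧ g ≠ f ∧ G.Inc g w) (hne : (C ∩ D).Nonempty) : C ⊆ D := by
  obtain ⟨e, P, y, he, hP, heP, rfl⟩ := h
  refine ear_cons he hP (Or.inr rfl) heP (fun w hw hwx _ ↦ hD w hw hwx) ?_ hne
  refine hP.subset_of_inter_nonempty ?_
  intro w hw hwy hwz f hf hfD hfw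
  obtain ⟨g, rfl | hg, hgD, hgf, hgw⟩ := hD w hw hwz f (Or.inr hf) hfD hfw
  · obtain rfl | rfl := hgw.eq_or_eq_of_isLink he
    · exact (hwz rfl).elim
    · exact (hwy rfl).elim
  · exact ⟨g, hg, hgD, hgf, hgw⟩

/-! ### Connected edge sets -/

/-- The subgraph formed by the edges in `C` is connected. -/
def EdgeConnected (G : Graph V α) (C : Set α) : Prop :=
  ∀ X ⊆ C, X.Nonempty → X ≠ C → ∃ e ∈ X, ∃ f ∈ C \ X, ∃ w, G.Inc e w ∧ G.Inc f w

theorem edgeConnected_singleton (G : Graph V α) (e : α) : G.EdgeConnected {e} := by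
  intro X hX hne hXe
  obtain h | h := subset_singleton_iff_eq.1 hX
  · exact (hne.ne_empty h).elim
  · exact (hXe h).elim

/-- A set `X` that cuts `A` or `B` properly is handled by that part. Otherwise `X` is one of the two
parts, and the common vertex `w` links it to the other. -/
theorem EdgeConnected.union {A B : Set α} (hA : G.EdgeConnected A) (hB : G.EdgeConnected B)
    (he : e ∈ A) (hf : f ∈ B) (hew : G.Inc e w) (hfw : G.Inc f w) : G.EdgeConnected (A ∪ B) := by
  intro X hX hne hXC
  by_cases h1 : (X ∩ A).Nonempty ∧ X ∩ A ≠ A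
  · obtain ⟨g, hg, g', hg', h⟩ := hA _ inter_subset_right h1.1 h1.2
    exact ⟨g, hg.1, g', ⟨Or.inl hg'.1, fun h ↦ hg'.2 ⟨h, hg'.1⟩⟩, h⟩
  by_cases h2 : (X ∩ B).Nonempty ∧ X ∩ B ≠ B
  · obtain ⟨g, hg, g', hg', h⟩ := hB _ inter_subset_right h2.1 h2.2
    exact ⟨g, hg.1, g', ⟨Or.inr hg'.1, fun h ↦ hg'.2 ⟨h, hg'.1⟩⟩, h⟩
  rw [not_and_not_right] at h1 h2
  by_cases h3 : (X ∩ A).Nonempty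
  · have hAX : A ⊆ X := inter_eq_right.1 (h1 h3)
    by_cases h4 : (X ∩ B).Nonempty
    · exact (hXC (hX.antisymm (union_subset hAX (inter_eq_right.1 (h2 h4))))).elim
    · exact ⟨e, hAX he, f, ⟨Or.inr hf, fun h ↦ h4 ⟨f, h, hf⟩⟩, w, hew, hfw⟩
  · have h4 : (X ∩ B).Nonempty := by
      obtain ⟨g, hg⟩ := hne
      exact ⟨g, hg, (hX hg).resolve_left fun h ↦ h3 ⟨g, hg, h⟩⟩
    have hBX : B ⊆ X := inter_eq_right.1 (h2 h4)
    exact ⟨f, hBX hf, e, ⟨Or.inl he, fun h ↦ h3 ⟨e, h, he⟩⟩, w, hfw, hew⟩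

theorem IsPathOn.edgeConnected (h : G.IsPathOn P W x y) : G.EdgeConnected P := by
  induction h with
  | nil => exact fun X hX hne _ ↦ (hne.ne_empty (subset_empty_iff.1 hX)).elim
  | @cons P W x y z e he h hx ih =>
    obtain rfl | hP := P.eq_empty_or_nonempty
    · rw [insert_empty_eq]
      exact edgeConnected_singleton G e
    · obtain ⟨f, hf, hfy⟩ := h.exists_inc_left hP
      rw [← singleton_union]
      exact (edgeConnected_singleton G e).union ih rfl hf he.inc_right hfy

theorem IsCycleAt.edgeConnected (h : G.IsCycleAt C W x) : G.EdgeConnected C := by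
  obtain ⟨e, P, y, he, hP, heP, rfl⟩ := h
  obtain rfl | hne := P.eq_empty_or_nonempty
  · rw [insert_empty_eq]
    exact edgeConnected_singleton G e
  · obtain ⟨f, hf, hfy⟩ := hP.exists_inc_left hne
    rw [← singleton_union]
    exact (edgeConnected_singleton G e).union hP.edgeConnected rfl hf he.inc_right hfy

end Graph

/-! ## Thetas and handcuffs -/

namespace Graph

variable {V : Type v} {α : Type u}
variable {G : Graph V α} {P P₁ P₂ P₃ Z Z₁ Z₂ C D : Set α} {W W₁ W₂ : Set V} {x y z w : V} {e f : α}

/-- No vertex is incident with exactly one edge in `C`; here a loop counts as one edge. -/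
def Leafless (G : Graph V α) (C : Set α) : Prop :=
  ∀ e ∈ C, ∀ w, G.Inc e w → ∃ f ∈ C, f ≠ e ∧ G.Inc f w

theorem vertsOf_union (G : Graph V α) (A B : Set α) :
    G.vertsOf (A ∪ B) = G.vertsOf A ∪ G.vertsOf B := by
  ext w
  simp only [vertsOf, mem_union, mem_ofPred_eq]
  constructor
  · rintro ⟨e, h | h, hw⟩
    · exact Or.inl ⟨e, h, hw⟩
    · exact Or.inr ⟨e, h, hw⟩
  · rintro (⟨e, h, hw⟩ | ⟨e, h, hw⟩)
    · exact ⟨e, Or.inl h, hw⟩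
    · exact ⟨e, Or.inr h, hw⟩

/-- Two cycles with one common vertex, and `P = ∅`, or two vertex-disjoint cycles connected by the
path `P`. -/
def IsHandcuff (G : Graph V α) (Z₁ Z₂ P : Set α) : Prop :=
  G.IsCycleSet Z₁ ∧ G.IsCycleSet Z₂ ∧
    ((P = ∅ ∧ Disjoint Z₁ Z₂ ∧ ∃ x, G.vertsOf Z₁ ∩ G.vertsOf Z₂ = {x}) ∨
      (Disjoint (G.vertsOf Z₁) (G.vertsOf Z₂) ∧ ∃ x y, G.IsPathSet P x y ∧
        G.vertsOf P ∩ G.vertsOf Z₁ = {x} ∧ G.vertsOf P ∩ G.vertsOf Z₂ = {y}))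

theorem isCycleSet_union_of_isPathOn (h₁ : G.IsPathOn P₁ W₁ x y) (h₂ : G.IsPathOn P₂ W₂ x y)
    (hxy : x ≠ y) (hW : W₁ ∩ W₂ = {x, y}) (hP : Disjoint P₁ P₂) : G.IsCycleSet (P₁ ∪ P₂) := by
  have h₂' := h₂.reverse
  cases h₂' with
  | nil => exact (hxy rfl).elim
  | @cons P W _ z _ g hg h hx =>
    refine isCycleSet_iff.2 ⟨_, y, g, _, z, hg, h.append h₁ ?_, ?_, ?_⟩
    · rintro w ⟨hw, hw'⟩
      obtain rfl | rfl := hW.subset ⟨hw', Or.inr hw⟩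
      · rfl
      · exact (hx hw).elim
    · rintro (h' | h')
      · exact hx (h.mem_of_inc h' hg.inc_left)
      · exact hP.le_bot ⟨h', mem_insert _ _⟩
    · ext t
      simp only [mem_insert_iff, mem_union]
      tauto

namespace IsTheta

theorem swap₁₂ (h : G.IsTheta P₁ P₂ P₃) : G.IsTheta P₂ P₁ P₃ := by
  obtain ⟨x, y, hxy, h1, h2, h3, d12, d13, d23, e12, e13, e23⟩ := h
  exact ⟨x, y, hxy, h2, h1, h3, d12.symm, d23, d13, by rwa [inter_comm], e23, e13⟩

theorem swap₂₃ (h : G.IsTheta P₁ P₂ P₃) : G.IsTheta P₁ P₃ P₂ := by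
  obtain ⟨x, y, hxy, h1, h2, h3, d12, d13, d23, e12, e13, e23⟩ := h
  exact ⟨x, y, hxy, h1, h3, h2, d13, d12, d23.symm, e13, e12, by rwa [inter_comm]⟩

theorem isCycleSet (h : G.IsTheta P₁ P₂ P₃) : G.IsCycleSet (P₁ ∪ P₂) := by
  obtain ⟨x, y, hxy, h1, h2, h3, d12, d13, d23, e12, e13, e23⟩ := h
  obtain ⟨W₁, h1⟩ := isPathSet_iff.1 h1
  obtain ⟨W₂, h2⟩ := isPathSet_iff.1 h2
  rw [h1.vertsOf_eq (h1.nonempty hxy), h2.vertsOf_eq (h2.nonempty hxy)] at e12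
  exact isCycleSet_union_of_isPathOn h1 h2 hxy e12 d12

theorem nonempty (h : G.IsTheta P₁ P₂ P₃) : P₁.Nonempty := by
  obtain ⟨x, y, hxy, h1, -⟩ := h
  obtain ⟨W₁, h1⟩ := isPathSet_iff.1 h1
  exact h1.nonempty hxy

theorem ne_of_isLink (h : G.IsTheta P₁ P₂ P₃) (he : e ∈ P₁ ∪ P₂ ∪ P₃) (hl : G.IsLink e z w) :
    z ≠ w := by
  obtain ⟨x, y, hxy, h1, h2, h3, -⟩ := h
  obtain ⟨W₁, h1⟩ := isPathSet_iff.1 h1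
  obtain ⟨W₂, h2⟩ := isPathSet_iff.1 h2
  obtain ⟨W₃, h3⟩ := isPathSet_iff.1 h3
  obtain (he | he) | he := he
  · exact h1.ne_of_isLink he hl
  · exact h2.ne_of_isLink he hl
  · exact h3.ne_of_isLink he hl

/-- Each path has one more vertex than edges, and the two ends are counted three times: the theta
has exactly one more edge than vertices. -/
theorem ncard_lt (h : G.IsTheta P₁ P₂ P₃) :
    (G.vertsOf (P₁ ∪ P₂ ∪ P₃)).ncard < (P₁ ∪ P₂ ∪ P₃).ncard := by
  obtain ⟨x, y, hxy, h1, h2, h3, d12, d13, d23, e12, e13, e23⟩ := h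
  obtain ⟨W₁, h1⟩ := isPathSet_iff.1 h1
  obtain ⟨W₂, h2⟩ := isPathSet_iff.1 h2
  obtain ⟨W₃, h3⟩ := isPathSet_iff.1 h3
  rw [vertsOf_union, vertsOf_union]
  rw [h1.vertsOf_eq (h1.nonempty hxy), h2.vertsOf_eq (h2.nonempty hxy)] at *
  rw [h3.vertsOf_eq (h3.nonempty hxy)] at *
  have c1 := ncard_union_add_ncard_inter W₁ W₂ h1.finite.2 h2.finite.2
  have c2 := ncard_union_add_ncard_inter (W₁ ∪ W₂) W₃ (h1.finite.2.union h2.finite.2) h3.finite.2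
  have e : (W₁ ∪ W₂) ∩ W₃ = {x, y} := by rw [union_inter_distrib_right, e13, e23, union_self]
  rw [e12, ncard_pair hxy] at c1
  rw [e, ncard_pair hxy] at c2
  rw [ncard_union_eq (disjoint_union_left.2 ⟨d13, d23⟩) (h1.finite.1.union h2.finite.1) h3.finite.1,
    ncard_union_eq d12 h1.finite.1 h2.finite.1]
  have := h1.ncard_eq
  have := h2.ncard_eq
  have := h3.ncard_eq
  omega

theorem leafless (h : G.IsTheta P₁ P₂ P₃) : G.Leafless (P₁ ∪ P₂ ∪ P₃) := by
  have key : ∀ P₁ P₂ P₃, G.IsTheta P₁ P₂ P₃ → ∀ e ∈ P₁, ∀ w, G.Inc e w →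
      ∃ f ∈ P₁ ∪ P₂, f ≠ e ∧ G.Inc f w := by
    rintro P₁ P₂ P₃ ⟨x, y, hxy, h1, h2, h3, d12, d13, d23, e12, e13, e23⟩ e he w hw
    obtain ⟨W₁, h1⟩ := isPathSet_iff.1 h1
    obtain ⟨W₂, h2⟩ := isPathSet_iff.1 h2
    by_cases hwx : w = x
    · subst hwx
      obtain ⟨f, hf, hfw⟩ := h2.exists_inc_left (h2.nonempty hxy)
      exact ⟨f, Or.inr hf, fun h ↦ d12.le_bot ⟨he, h ▸ hf⟩, hfw⟩
    by_cases hwy : w = y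
    · subst hwy
      obtain ⟨f, hf, hfw⟩ := h2.exists_inc_right (h2.nonempty hxy)
      exact ⟨f, Or.inr hf, fun h ↦ d12.le_bot ⟨he, h ▸ hf⟩, hfw⟩
    obtain ⟨f, hf, h⟩ := h1.exists_ne he hw hwx hwy
    exact ⟨f, Or.inl hf, h⟩
  rintro e ((he | he) | he) w hw
  · obtain ⟨f, hf, h'⟩ := key _ _ _ h e he w hw
    exact ⟨f, Or.inl hf, h'⟩
  · obtain ⟨f, hf, h'⟩ := key _ _ _ h.swap₁₂ e he w hw
    exact ⟨f, Or.inl hf.symm, h'⟩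
  · obtain ⟨f, hf | hf, h'⟩ := key _ _ _ h.swap₂₃.swap₁₂ e he w hw
    · exact ⟨f, Or.inr hf, h'⟩
    · exact ⟨f, Or.inl (Or.inl hf), h'⟩

theorem edgeConnected (h : G.IsTheta P₁ P₂ P₃) : G.EdgeConnected (P₁ ∪ P₂ ∪ P₃) := by
  obtain ⟨x, y, hxy, h1, h2, h3, -⟩ := h
  obtain ⟨W₁, h1⟩ := isPathSet_iff.1 h1
  obtain ⟨W₂, h2⟩ := isPathSet_iff.1 h2
  obtain ⟨W₃, h3⟩ := isPathSet_iff.1 h3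
  obtain ⟨e₁, he₁, hx₁⟩ := h1.exists_inc_left (h1.nonempty hxy)
  obtain ⟨e₂, he₂, hx₂⟩ := h2.exists_inc_left (h2.nonempty hxy)
  obtain ⟨e₃, he₃, hx₃⟩ := h3.exists_inc_left (h3.nonempty hxy)
  exact (h1.edgeConnected.union h2.edgeConnected he₁ he₂ hx₁ hx₂).union h3.edgeConnected
    (Or.inl he₁) he₃ hx₁ hx₃

/-- An inner vertex of `P₁` is on no edge of the other paths, so `D` has to continue along `P₁`
there. -/
theorem subset_of_leafless (h : G.IsTheta P₁ P₂ P₃) (hD : D ⊆ P₁ ∪ P₂ ∪ P₃) (hl : G.Leafless D)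
    (hne : (P₁ ∩ D).Nonempty) : P₁ ⊆ D := by
  obtain ⟨x, y, hxy, h1, h2, h3, d12, d13, d23, e12, e13, e23⟩ := h
  obtain ⟨W₁, h1⟩ := isPathSet_iff.1 h1
  rw [h1.vertsOf_eq (h1.nonempty hxy)] at *
  refine h1.subset_of_inter_nonempty (fun w hw hwx hwy f hf hfD hfw ↦ ?_) hne
  obtain ⟨g, hg, hgf, hgw⟩ := hl f hfD w hfw
  obtain (h | h) | h := hD hg
  · exact ⟨g, h, hg, hgf, hgw⟩
  · have : w ∈ ({x, y} : Set V) := e12.subset ⟨hw, g, h, hgw⟩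
    simp [hwx, hwy] at this
  · have : w ∈ ({x, y} : Set V) := e13.subset ⟨hw, g, h, hgw⟩
    simp [hwx, hwy] at this

theorem not_leafless_subset (h : G.IsTheta P₁ P₂ P₃) (hD : D ⊆ P₁) (hl : G.Leafless D) :
    D = ∅ := by
  by_contra hne
  obtain ⟨e, he⟩ := nonempty_iff_ne_empty.2 hne
  have hP := h.subset_of_leafless (fun z hz ↦ Or.inl (Or.inl (hD hz))) hl ⟨e, hD he, he⟩
  obtain ⟨x, y, hxy, h1, -⟩ := h
  obtain ⟨W₁, h1⟩ := isPathSet_iff.1 h1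
  obtain ⟨g, hg, hgx⟩ := h1.exists_inc_left ⟨e, hD he⟩
  obtain ⟨f, hf, hfg, hfx⟩ := hl g (hP hg) x hgx
  exact hfg (h1.eq_of_inc_left (hD hf) hg hfx hgx)

/-- Such a `D` is a union of some of the three paths, and a single path has leaves at its ends. This
makes the circuits contained in a theta explicit. -/
theorem eq_of_leafless (h : G.IsTheta P₁ P₂ P₃) (hD : D ⊆ P₁ ∪ P₂ ∪ P₃) (hl : G.Leafless D)
    (hne : D.Nonempty) : D = P₁ ∪ P₂ ∨ D = P₁ ∪ P₃ ∨ D = P₂ ∪ P₃ ∨ D = P₁ ∪ P₂ ∪ P₃ := by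
  have s1 := h.subset_of_leafless hD hl
  have s2 := h.swap₁₂.subset_of_leafless (D := D) (by rwa [union_comm P₂]) hl
  have s3 := h.swap₂₃.swap₁₂.subset_of_leafless (D := D)
    (by rwa [union_assoc, union_comm]) hl
  have n1 : D ⊆ P₁ → False := fun h' ↦ hne.ne_empty (h.not_leafless_subset h' hl)
  have n2 : D ⊆ P₂ → False := fun h' ↦ hne.ne_empty (h.swap₁₂.not_leafless_subset h' hl)
  have n3 : D ⊆ P₃ → False :=
    fun h' ↦ hne.ne_empty (h.swap₂₃.swap₁₂.not_leafless_subset h' hl)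
  have hsub : ∀ A B, D ⊆ A ∪ B → ¬ (A ∩ D).Nonempty → D ⊆ B := fun A B hAB hA z hz ↦
    (hAB hz).resolve_left fun h ↦ hA ⟨z, h, hz⟩
  by_cases m1 : (P₁ ∩ D).Nonempty <;> by_cases m2 : (P₂ ∩ D).Nonempty <;>
    by_cases m3 : (P₃ ∩ D).Nonempty
  · exact Or.inr (Or.inr (Or.inr (hD.antisymm (union_subset (union_subset (s1 m1) (s2 m2))
      (s3 m3)))))
  · exact Or.inl (Subset.antisymm (hsub P₃ _ (by rwa [union_comm P₃]) m3)
      (union_subset (s1 m1) (s2 m2)))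
  · refine Or.inr (Or.inl (Subset.antisymm (hsub P₂ _ ?_ m2) (union_subset (s1 m1) (s3 m3))))
    rwa [← union_assoc, union_comm P₂]
  · refine (n1 (hsub P₂ _ (hsub P₃ _ ?_ m3) m2)).elim
    rwa [union_comm P₃, union_comm P₂]
  · refine Or.inr (Or.inr (Or.inl (Subset.antisymm (hsub P₁ _ ?_ m1)
      (union_subset (s2 m2) (s3 m3)))))
    rwa [← union_assoc]
  · refine (n2 (hsub P₁ _ (hsub P₃ _ ?_ m3) m1)).elim
    rwa [union_comm P₃]
  · refine (n3 (hsub P₂ _ (hsub P₁ _ ?_ m1) m2)).elim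
    rwa [← union_assoc]
  · refine (n3 (hsub P₂ _ (hsub P₁ _ ?_ m1) m2)).elim
    rwa [← union_assoc]

end IsTheta

theorem IsCycleSet.ncard_vertsOf (h : G.IsCycleSet Z) : (G.vertsOf Z).ncard = Z.ncard := by
  obtain ⟨W, x, h⟩ := isCycleSet_iff.1 h
  rw [h.vertsOf_eq, h.ncard_eq]

theorem IsCycleSet.nonempty (h : G.IsCycleSet Z) : Z.Nonempty := by
  obtain ⟨W, x, h⟩ := isCycleSet_iff.1 h
  exact h.nonempty

theorem IsCycleSet.finite (h : G.IsCycleSet Z) : Z.Finite ∧ (G.vertsOf Z).Finite := by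
  obtain ⟨W, x, h⟩ := isCycleSet_iff.1 h
  rw [h.vertsOf_eq]
  exact h.finite

theorem IsCycleSet.edgeConnected (h : G.IsCycleSet Z) : G.EdgeConnected Z := by
  obtain ⟨W, x, h⟩ := isCycleSet_iff.1 h
  exact h.edgeConnected

theorem IsCycleSet.subset_of_inter_nonempty (h : G.IsCycleSet Z) (hx : x ∈ G.vertsOf Z)
    (hD : ∀ w ∈ G.vertsOf Z, w ≠ x → ∀ g ∈ D, G.Inc g w → g ∈ Z) (hl : G.Leafless D)
    (hne : (Z ∩ D).Nonempty) : Z ⊆ D := by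
  obtain ⟨W, y, h⟩ := isCycleSet_iff.1 h
  rw [h.vertsOf_eq] at hx hD
  refine (h.rotate hx).subset_of_inter_nonempty (fun w hw hwx f hf hfD hfw ↦ ?_) hne
  obtain ⟨g, hg, hgf, hgw⟩ := hl f hfD w hfw
  exact ⟨g, hD w hw hwx g hg hgw, hg, hgf, hgw⟩

/-! ### Handcuffs -/

namespace IsHandcuff

theorem swap (h : G.IsHandcuff Z₁ Z₂ P) : G.IsHandcuff Z₂ Z₁ P := by
  obtain ⟨h1, h2, ⟨hP, hd, x, hx⟩ | ⟨hd, x, y, hP, hx, hy⟩⟩ := h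
  · exact ⟨h2, h1, Or.inl ⟨hP, hd.symm, x, by rwa [inter_comm]⟩⟩
  · obtain ⟨W, hP⟩ := isPathSet_iff.1 hP
    exact ⟨h2, h1, Or.inr ⟨hd.symm, y, x, isPathSet_iff.2 ⟨W, hP.reverse⟩, hy, hx⟩⟩

theorem disjoint (h : G.IsHandcuff Z₁ Z₂ P) : Disjoint Z₁ Z₂ := by
  obtain ⟨h1, h2, ⟨hP, hd, x, hx⟩ | ⟨hd, -⟩⟩ := h
  · exact hd
  · rw [disjoint_left]
    intro e he he'
    obtain ⟨W, x, h1⟩ := isCycleSet_iff.1 h1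
    obtain ⟨x, y, hxy⟩ := exists_isLink_of_mem_edgeSet (h1.subset_ground he)
    exact hd.le_bot ⟨⟨e, he, hxy.inc_left⟩, ⟨e, he', hxy.inc_left⟩⟩

theorem isLoopAt (h : G.IsHandcuff Z₁ Z₂ P) (he : e ∈ Z₁ ∪ Z₂ ∪ P) (hl : G.IsLoopAt e w) :
    Z₁ = {e} ∨ Z₂ = {e} := by
  obtain ⟨h1, h2, h⟩ := h
  obtain ⟨W₁, x₁, h1⟩ := isCycleSet_iff.1 h1
  obtain ⟨W₂, x₂, h2⟩ := isCycleSet_iff.1 h2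
  obtain (he | he) | he := he
  · exact Or.inl (h1.eq_singleton_of_isLoopAt he hl)
  · exact Or.inr (h2.eq_singleton_of_isLoopAt he hl)
  · obtain ⟨rfl, -⟩ | ⟨hd, x, y, hP, hx, hy⟩ := h
    · exact he.elim
    · obtain ⟨W, hP⟩ := isPathSet_iff.1 hP
      exact (hP.ne_of_isLink he hl rfl).elim

/-- Cycles have as many edges as vertices. A common vertex lowers the number of vertices by one; a
connecting path adds one vertex fewer than it adds edges. -/
theorem ncard_lt (h : G.IsHandcuff Z₁ Z₂ P) :
    (G.vertsOf (Z₁ ∪ Z₂ ∪ P)).ncard < (Z₁ ∪ Z₂ ∪ P).ncard := by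
  have hZ := h.disjoint
  obtain ⟨h1, h2, h⟩ := h
  have c1 := ncard_union_add_ncard_inter (G.vertsOf Z₁) (G.vertsOf Z₂) h1.finite.2 h2.finite.2
  have n1 := h1.ncard_vertsOf
  have n2 := h2.ncard_vertsOf
  have n3 := ncard_union_eq hZ h1.finite.1 h2.finite.1
  obtain ⟨rfl, hd, x, hx⟩ | ⟨hd, x, y, hP, hx, hy⟩ := h
  · rw [union_empty, vertsOf_union]
    rw [hx, ncard_singleton] at c1
    omega
  · have hxy : x ≠ y := by
      rintro rfl
      exact hd.le_bot ⟨(hx.symm.subset rfl).2, (hy.symm.subset rfl).2⟩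
    obtain ⟨W, hP⟩ := isPathSet_iff.1 hP
    rw [vertsOf_union, vertsOf_union]
    have hPd : Disjoint (Z₁ ∪ Z₂) P := by
      rw [disjoint_left]
      intro e he heP
      obtain ⟨a, b, hab⟩ := exists_isLink_of_mem_edgeSet (hP.subset_ground heP)
      have hne := hP.ne_of_isLink heP hab
      obtain he | he := he
      · have ha : a ∈ ({x} : Set V) := hx.subset ⟨⟨e, heP, hab.inc_left⟩, ⟨e, he, hab.inc_left⟩⟩
        have hb : b ∈ ({x} : Set V) := hx.subset ⟨⟨e, heP, hab.inc_right⟩, ⟨e, he, hab.inc_right⟩⟩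
        exact hne (ha.trans hb.symm)
      · have ha : a ∈ ({y} : Set V) := hy.subset ⟨⟨e, heP, hab.inc_left⟩, ⟨e, he, hab.inc_left⟩⟩
        have hb : b ∈ ({y} : Set V) := hy.subset ⟨⟨e, heP, hab.inc_right⟩, ⟨e, he, hab.inc_right⟩⟩
        exact hne (ha.trans hb.symm)
    rw [hP.vertsOf_eq (hP.nonempty hxy)] at *
    have c2 := ncard_union_add_ncard_inter (G.vertsOf Z₁ ∪ G.vertsOf Z₂) W
      (h1.finite.2.union h2.finite.2) hP.finite.2
    have e : (G.vertsOf Z₁ ∪ G.vertsOf Z₂) ∩ W = {x, y} := by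
      rw [inter_comm, inter_union_distrib_left, hx, hy]; rfl
    rw [e, ncard_pair hxy] at c2
    rw [hd.inter_eq, ncard_empty] at c1
    rw [ncard_union_eq hPd (h1.finite.1.union h2.finite.1) hP.finite.1]
    have := hP.ncard_eq
    omega

theorem leafless (h : G.IsHandcuff Z₁ Z₂ P) : G.Leafless (Z₁ ∪ Z₂ ∪ P) := by
  have key : ∀ Z₁ Z₂, G.IsHandcuff Z₁ Z₂ P → ∀ e ∈ Z₁, ∀ w, G.Inc e w →
      ∃ f ∈ Z₁ ∪ Z₂ ∪ P, f ≠ e ∧ G.Inc f w := by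
    intro Z₁ Z₂ h e he w hw
    have hZ := h.disjoint
    obtain ⟨h1, h2, h⟩ := h
    obtain ⟨W₁, x₁, h1'⟩ := isCycleSet_iff.1 h1
    -- Only a cycle consisting of a loop lacks a second edge at `w`. Its unique vertex is then the
    -- point of attachment, where the other cycle or the path provides an edge.
    obtain h' | ⟨f, hf, hfe, hfw⟩ := h1'.exists_ne he hw
    · subst h'
      have hv : ∀ z ∈ G.vertsOf {e}, z = w := by
        obtain ⟨g, P', y, hg, hP', hgP, heq⟩ := h1'
        have hge : g = e := by
          have := heq.symm.subset (mem_insert g P'); simpa using this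
        have hP0 : P' = ∅ := by
          refine eq_empty_of_forall_notMem fun t ht ↦ hgP ?_
          have : t = e := by simpa using heq.symm.subset (mem_insert_of_mem g ht)
          rwa [hge, ← this]
        subst hP0 hge
        obtain rfl := hP'.eq_of_eq_empty
        have hwx := hw.eq_or_eq_of_isLink hg
        rintro z ⟨t, rfl, ht⟩
        have hzx := ht.eq_or_eq_of_isLink hg
        grind
      obtain ⟨rfl, hd, x, hx⟩ | ⟨hd, x, y, hP, hx, hy⟩ := h
      · have hx' := hx.symm.subset rfl
        obtain rfl := hv x hx'.1
        obtain ⟨f, hf, hfx⟩ := hx'.2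
        exact ⟨f, Or.inl (Or.inr hf), fun h ↦ hZ.le_bot ⟨he, h ▸ hf⟩, hfx⟩
      · have hx' := hx.symm.subset rfl
        obtain rfl := hv x hx'.2
        obtain ⟨f, hf, hfx⟩ := hx'.1
        refine ⟨f, Or.inr hf, ?_, hfx⟩
        rintro rfl
        obtain ⟨W, hP⟩ := isPathSet_iff.1 hP
        obtain ⟨a, b, hab⟩ := exists_isLink_of_mem_edgeSet (hP.subset_ground hf)
        exact hP.ne_of_isLink hf hab ((hv a ⟨_, rfl, hab.inc_left⟩).trans
          (hv b ⟨_, rfl, hab.inc_right⟩).symm)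
    · exact ⟨f, Or.inl (Or.inl hf), hfe, hfw⟩
  rintro e ((he | he) | he) w hw
  · exact key _ _ h e he w hw
  · obtain ⟨f, hf, h'⟩ := key _ _ h.swap e he w hw
    rw [union_comm Z₂] at hf
    exact ⟨f, hf, h'⟩
  · obtain ⟨h1, h2, ⟨rfl, hd, x, hx⟩ | ⟨hd, x, y, hP, hx, hy⟩⟩ := h
    · exact he.elim
    obtain ⟨W, hP⟩ := isPathSet_iff.1 hP
    have aux : ∀ Z z, G.vertsOf P ∩ G.vertsOf Z = {z} → w = z → ∃ f ∈ Z, f ≠ e ∧ G.Inc f w := by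
      rintro Z z hz rfl
      obtain ⟨f, hf, hfw⟩ := (hz.symm.subset rfl).2
      refine ⟨f, hf, ?_, hfw⟩
      rintro rfl
      obtain ⟨b, hab⟩ := id hfw
      have hb : b ∈ ({w} : Set V) := hz.subset ⟨⟨_, he, hab.inc_right⟩, ⟨_, hf, hab.inc_right⟩⟩
      exact hP.ne_of_isLink he hab hb.symm
    by_cases hwx : w = x
    · obtain ⟨f, hf, h'⟩ := aux _ _ hx hwx
      exact ⟨f, Or.inl (Or.inl hf), h'⟩
    by_cases hwy : w = y
    · obtain ⟨f, hf, h'⟩ := aux _ _ hy hwy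
      exact ⟨f, Or.inl (Or.inr hf), h'⟩
    obtain ⟨f, hf, h'⟩ := hP.exists_ne he hw hwx hwy
    exact ⟨f, Or.inr hf, h'⟩

theorem edgeConnected (h : G.IsHandcuff Z₁ Z₂ P) : G.EdgeConnected (Z₁ ∪ Z₂ ∪ P) := by
  obtain ⟨h1, h2, ⟨rfl, hd, x, hx⟩ | ⟨hd, x, y, hP, hx, hy⟩⟩ := h
  · obtain ⟨⟨e, he, hex⟩, f, hf, hfx⟩ := hx.symm.subset rfl
    rw [union_empty]
    exact h1.edgeConnected.union h2.edgeConnected he hf hex hfx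
  · obtain ⟨W, hP⟩ := isPathSet_iff.1 hP
    obtain ⟨⟨e, he, hex⟩, f, hf, hfx⟩ := hx.symm.subset rfl
    obtain ⟨⟨e', he', hey⟩, f', hf', hfy⟩ := hy.symm.subset rfl
    rw [union_right_comm]
    exact (h1.edgeConnected.union hP.edgeConnected hf he hfx hex).union h2.edgeConnected
      (Or.inr he') hf' hey hfy

/-- Each of the three pieces is contained in `D` or disjoint from it. If `D` uses the path, it has
to go on around both cycles; connectedness rules out two disjoint cycles without the path. -/
theorem eq_of_leafless (h : G.IsHandcuff Z₁ Z₂ P) (hD : D ⊆ Z₁ ∪ Z₂ ∪ P) (hl : G.Leafless D)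
    (hc : G.EdgeConnected D) (hne : D.Nonempty) : D = Z₁ ∨ D = Z₂ ∨ D = Z₁ ∪ Z₂ ∪ P := by
  obtain ⟨h1, h2, ⟨rfl, hd, x, hx⟩ | ⟨hd, x, y, hP, hx, hy⟩⟩ := h
  · rw [union_empty] at hD ⊢
    have hx' := hx.symm.subset rfl
    have s1 := h1.subset_of_inter_nonempty (D := D) hx'.1 (fun w hw hwx g hg hgw ↦
      (hD hg).resolve_right fun h ↦ hwx (hx.subset ⟨hw, g, h, hgw⟩)) hl
    have s2 := h2.subset_of_inter_nonempty (D := D) hx'.2 (fun w hw hwx g hg hgw ↦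
      (hD hg).resolve_left fun h ↦ hwx (hx.subset ⟨⟨g, h, hgw⟩, hw⟩)) hl
    by_cases m1 : (Z₁ ∩ D).Nonempty <;> by_cases m2 : (Z₂ ∩ D).Nonempty
    · exact Or.inr (Or.inr (hD.antisymm (union_subset (s1 m1) (s2 m2))))
    · refine Or.inl (Subset.antisymm (fun z hz ↦ ?_) (s1 m1))
      exact (hD hz).resolve_right fun h ↦ m2 ⟨z, h, hz⟩
    · refine Or.inr (Or.inl (Subset.antisymm (fun z hz ↦ ?_) (s2 m2)))
      exact (hD hz).resolve_left fun h ↦ m1 ⟨z, h, hz⟩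
    · obtain ⟨z, hz⟩ := hne
      obtain h | h := hD hz
      · exact (m1 ⟨z, h, hz⟩).elim
      · exact (m2 ⟨z, h, hz⟩).elim
  · obtain ⟨W, hP⟩ := isPathSet_iff.1 hP
    have hx' := hx.symm.subset rfl
    have hy' := hy.symm.subset rfl
    have hxy : x ≠ y := by
      rintro rfl
      exact hd.le_bot ⟨hx'.2, hy'.2⟩
    have s1 := h1.subset_of_inter_nonempty (D := D) hx'.2 (fun w hw hwx g hg hgw ↦ by
      obtain (h | h) | h := hD hg
      · exact h
      · exact (hd.le_bot ⟨hw, g, h, hgw⟩).elim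
      · exact (hwx (hx.subset ⟨⟨g, h, hgw⟩, hw⟩)).elim) hl
    have s2 := h2.subset_of_inter_nonempty (D := D) hy'.2 (fun w hw hwx g hg hgw ↦ by
      obtain (h | h) | h := hD hg
      · exact (hd.le_bot ⟨⟨g, h, hgw⟩, hw⟩).elim
      · exact h
      · exact (hwx (hy.subset ⟨⟨g, h, hgw⟩, hw⟩)).elim) hl
    have s3 : (P ∩ D).Nonempty → P ⊆ D := by
      refine hP.subset_of_inter_nonempty fun w hw hwx hwy f hf hfD hfw ↦ ?_
      obtain ⟨g, hg, hgf, hgw⟩ := hl f hfD w hfw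
      obtain (h | h) | h := hD hg
      · exact (hwx (hx.subset ⟨⟨f, hf, hfw⟩, g, h, hgw⟩)).elim
      · exact (hwy (hy.subset ⟨⟨f, hf, hfw⟩, g, h, hgw⟩)).elim
      · exact ⟨g, h, hg, hgf, hgw⟩
    by_cases m3 : (P ∩ D).Nonempty
    · right; right
      have hPD := s3 m3
      obtain ⟨e, he, hex⟩ := hx'.1
      obtain ⟨f, hf, hfe, hfx⟩ := hl e (hPD he) x hex
      obtain ⟨e', he', hey⟩ := hy'.1
      obtain ⟨f', hf', hfe', hfy⟩ := hl e' (hPD he') y hey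
      have m1 : f ∈ Z₁ := by
        obtain (h | h) | h := hD hf
        · exact h
        · exact (hd.le_bot ⟨hx'.2, f, h, hfx⟩).elim
        · exact (hfe (hP.eq_of_inc_left h he hfx hex)).elim
      have m2 : f' ∈ Z₂ := by
        obtain (h | h) | h := hD hf'
        · exact (hd.le_bot ⟨⟨f', h, hfy⟩, hy'.2⟩).elim
        · exact h
        · exact (hfe' (hP.eq_of_inc_right h he' hfy hey)).elim
      exact hD.antisymm (union_subset (union_subset (s1 ⟨f, m1, hf⟩) (s2 ⟨f', m2, hf'⟩)) hPD)
    · have hDZ : D ⊆ Z₁ ∪ Z₂ := fun z hz ↦ (hD hz).resolve_right fun h ↦ m3 ⟨z, h, hz⟩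
      by_cases m1 : (Z₁ ∩ D).Nonempty <;> by_cases m2 : (Z₂ ∩ D).Nonempty
      -- Both cycles without the path: connectedness would give an edge of `Z₁` and an edge of `Z₂`
      -- with a common vertex.
      · exfalso
        obtain ⟨f', hf', hfD'⟩ := m2
        have hZd : ∀ g ∈ Z₁, ∀ w, G.Inc g w → g ∉ Z₂ :=
          fun g hg w hgw h ↦ hd.le_bot ⟨⟨g, hg, hgw⟩, g, h, hgw⟩
        obtain ⟨e, he, f, hf, w, hew, hfw⟩ := hc Z₁ (s1 m1) h1.nonempty (by
          rintro rfl
          obtain ⟨W₁, x₁, h1⟩ := isCycleSet_iff.1 h1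
          obtain ⟨a, b, hab⟩ := exists_isLink_of_mem_edgeSet (h1.subset_ground hfD')
          exact hZd f' hfD' a hab.inc_left hf')
        exact hd.le_bot ⟨⟨e, he, hew⟩, f, (hDZ hf.1).resolve_left hf.2, hfw⟩
      · refine Or.inl (Subset.antisymm (fun z hz ↦ ?_) (s1 m1))
        exact (hDZ hz).resolve_right fun h ↦ m2 ⟨z, h, hz⟩
      · refine Or.inr (Or.inl (Subset.antisymm (fun z hz ↦ ?_) (s2 m2)))
        exact (hDZ hz).resolve_left fun h ↦ m1 ⟨z, h, hz⟩
      · obtain ⟨z, hz⟩ := hne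
        obtain h | h := hDZ hz
        · exact (m1 ⟨z, h, hz⟩).elim
        · exact (m2 ⟨z, h, hz⟩).elim

end IsHandcuff

/-! ### Cycles, thetas and handcuffs in leafless edge sets -/

/-- A path that avoids `A` apart from its end `x`, together with an edge from its other end back to
the path or to `A`. -/
theorem exists_lasso (hC : C.Finite) (hl : G.Leafless C) {A : Set V}
    (hZ : ∀ e ∈ Z, ∀ w, G.Inc e w → w ∈ A) (hf : f ∈ C \ Z) (hfx : G.Inc f x) :
    ∃ P W z g t, G.IsPathOn P W z x ∧ P ⊆ C \ Z ∧ g ∈ C \ Z ∧ g ∉ P ∧ G.IsLink g z t ∧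
      W ∩ A ⊆ {x} ∧ (t ∈ W ∨ t ∈ A) := by
  have key : ∀ n P W z g t, (C \ P).ncard = n → G.IsPathOn P W z x → P ⊆ C \ Z → g ∈ C \ Z →
      g ∉ P → G.IsLink g z t → W ∩ A ⊆ {x} → ∃ P W z g t, G.IsPathOn P W z x ∧ P ⊆ C \ Z ∧
        g ∈ C \ Z ∧ g ∉ P ∧ G.IsLink g z t ∧ W ∩ A ⊆ {x} ∧ (t ∈ W ∨ t ∈ A) := by
    -- The path is extended at its free end `z`, which is possible as long as the next vertex is
    -- new; the induction is on the number of edges of `C` not yet on the path.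
    intro n
    induction n using Nat.strong_induction_on with
    | _ n ih =>
      intro P W z g t hn hP hPC hg hgP hzt hW
      by_cases ht : t ∈ W ∨ t ∈ A
      · exact ⟨P, W, z, g, t, hP, hPC, hg, hgP, hzt, hW, ht⟩
      push Not at ht
      obtain ⟨g', hg', hgg', hg't⟩ := hl g hg.1 t hzt.inc_right
      obtain ⟨t', ht'⟩ := id hg't
      refine ih (C \ insert g P).ncard ?_ (insert g P) (insert t W) t g' t' rfl
        (hP.cons hzt.symm ht.1) (insert_subset hg hPC) ⟨hg', fun h ↦ ht.2 (hZ g' h t hg't)⟩ ?_ ht' ?_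
      · rw [← hn]
        refine ncard_lt_ncard ⟨sdiff_subset_sdiff_right (subset_insert _ _), fun h ↦ ?_⟩
          (hC.subset sdiff_subset)
        exact (h ⟨hg.1, hgP⟩).2 (mem_insert _ _)
      · rintro (h | h)
        · exact hgg' h
        · exact ht.1 (hP.mem_of_inc h hg't)
      · rintro w ⟨rfl | hw, hwA⟩
        · exact (ht.2 hwA).elim
        · exact hW ⟨hw, hwA⟩
  obtain ⟨t, ht⟩ := hfx
  exact key _ ∅ {x} x f t rfl (IsPathOn.nil x) (empty_subset _) hf (notMem_empty _) ht
    inter_subset_left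

/-- With nothing to avoid, a lasso can only return to itself, and its loop is a cycle. -/
theorem exists_isCycleAt_of_leafless (hC : C.Finite) (hCE : C ⊆ G.edgeSet) (hl : G.Leafless C)
    (hne : C.Nonempty) : ∃ Z ⊆ C, ∃ W x, G.IsCycleAt Z W x := by
  obtain ⟨f, hf⟩ := hne
  obtain ⟨x, y, hxy⟩ := exists_isLink_of_mem_edgeSet (hCE hf)
  obtain ⟨P, W, z, g, t, hP, hPC, hg, hgP, hzt, -, ht⟩ :=
    exists_lasso (Z := ∅) (A := ∅) hC hl (by simp) (by simpa using hf) hxy.inc_left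
  obtain ⟨P₁, P₂, W₁, W₂, h₁, h₂, rfl, rfl, hW, hdisj⟩ := hP.split (ht.resolve_right (by simp))
  refine ⟨insert g P₁, insert_subset hg.1 ?_, W₁, t, g, P₁, z, hzt.symm, h₁,
    fun h ↦ hgP (Or.inl h), rfl⟩
  exact subset_union_left.trans (hPC.trans sdiff_subset)

/-- If a cycle `Z` is not all of `C`, connectedness gives an edge leaving it at some vertex `x`,
from which a lasso grows outside `Z`. The place where the lasso ends decides the outcome: at `x` a
tight handcuff, at another vertex of `Z` a theta, at another vertex of its own path a loose
handcuff. -/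
theorem exists_theta_or_handcuff (hC : C.Finite) (hCE : C ⊆ G.edgeSet) (hl : G.Leafless C)
    (hc : G.EdgeConnected C) (hne : C.Nonempty) : G.IsCycleSet C ∨
      (∃ P₁ P₂ P₃, G.IsTheta P₁ P₂ P₃ ∧ P₁ ∪ P₂ ∪ P₃ ⊆ C) ∨
      ∃ Z₁ Z₂ P, G.IsHandcuff Z₁ Z₂ P ∧ Z₁ ∪ Z₂ ∪ P ⊆ C := by
  obtain ⟨Z, hZC, A, x₀, hZ⟩ := exists_isCycleAt_of_leafless hC hCE hl hne
  by_cases hZeq : Z = C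
  · exact Or.inl (hZeq ▸ hZ.isCycleSet)
  right
  obtain ⟨e, he, f, hf, x, hex, hfx⟩ := hc Z hZC hZ.nonempty hZeq
  have hZA : ∀ e ∈ Z, ∀ w, G.Inc e w → w ∈ A := fun e he w hw ↦ hZ.vertsOf_eq.subset ⟨e, he, hw⟩
  obtain ⟨P, W, z, g, t, hP, hPC, hg, hgP, hzt, hW, ht⟩ := exists_lasso hC hl hZA hf hfx
  have hxA := hZA e he x hex
  have hxW := hP.right_mem
  have hR : insert g P ⊆ C \ Z := insert_subset hg hPC
  by_cases htx : t = x
  · subst htx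
    have hZ₂ : G.IsCycleAt (insert g P) W t := ⟨g, P, z, hzt.symm, hP, hgP, rfl⟩
    refine Or.inr ⟨Z, insert g P, ∅, ⟨hZ.isCycleSet, hZ₂.isCycleSet, Or.inl ⟨rfl, ?_, t, ?_⟩⟩, ?_⟩
    · exact disjoint_left.2 fun s hs hs' ↦ (hR hs').2 hs
    · rw [hZ.vertsOf_eq, hZ₂.vertsOf_eq, inter_comm]
      exact hW.antisymm (singleton_subset_iff.2 ⟨hxW, hxA⟩)
    · rw [union_empty]
      exact union_subset hZC (hR.trans sdiff_subset)
  by_cases htA : t ∈ A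
  · left
    have htW : t ∉ W := fun h ↦ htx (hW ⟨h, htA⟩)
    have hQ := hP.cons hzt.symm htW
    -- The vertices `t` and `x` cut the cycle into two paths, which with the lasso form the theta.
    obtain ⟨g', P', y', hg', hP', hgP', rfl⟩ := hZ.rotate htA
    obtain ⟨P₁, P₂, W₁, W₂, h₁, h₂, rfl, rfl, hW₁₂, hdisj⟩ := hP'.split hxA
    cases h₂ with
    | nil => exact (htx rfl).elim
    | @cons P₂ W₂ _ y'' _ g'' hg'' h₂ hxW₂ =>
      have hp2 := h₂.cons hg'' hxW₂
      have htW₁ : t ∉ W₁ := fun h ↦ htx (hW₁₂.subset ⟨h, hp2.right_mem⟩)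
      have hp1 := h₁.cons hg' htW₁
      have v1 := hp1.vertsOf_eq (insert_nonempty _ _)
      have v2 := hp2.reverse.vertsOf_eq (insert_nonempty _ _)
      have v3 := hQ.vertsOf_eq (insert_nonempty _ _)
      have htW₂ := hp2.right_mem
      refine ⟨insert g' P₁, insert g'' P₂, insert g P, ⟨t, x, htx, isPathSet_iff.2 ⟨_, hp1⟩,
        isPathSet_iff.2 ⟨_, hp2.reverse⟩, isPathSet_iff.2 ⟨_, hQ⟩, ?_, ?_, ?_, ?_, ?_, ?_⟩, ?_⟩
      · rw [disjoint_insert_left]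
        exact ⟨fun h ↦ hgP' (Or.inr h), hdisj⟩
      · refine disjoint_left.2 fun s hs hs' ↦ (hR hs').2 ?_
        obtain rfl | hs := hs
        · exact mem_insert _ _
        · exact Or.inr (Or.inl hs)
      · exact disjoint_left.2 fun s hs hs' ↦ (hR hs').2 (Or.inr (Or.inr hs))
      · rw [v1, v2]
        ext s
        have := Set.ext_iff.1 hW₁₂ s
        simp only [mem_inter_iff, mem_insert_iff, mem_singleton_iff] at this ⊢ htW₂
        grind
      · rw [v1, v3]
        ext s
        have h1 := Set.ext_iff.1 hW₁₂ s
        have h2 : s ∈ W → s ∈ W₁ → s = x := fun h h' ↦ hW ⟨h, Or.inl h'⟩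
        have h3 := (hW₁₂.symm.subset rfl).1
        simp only [mem_inter_iff, mem_insert_iff, mem_singleton_iff] at h1 ⊢
        grind
      · rw [v2, v3]
        ext s
        have h1 := Set.ext_iff.1 hW₁₂ s
        have h2 : s ∈ W → s ∈ insert x W₂ → s = x := fun h h' ↦ hW ⟨h, Or.inr h'⟩
        simp only [mem_inter_iff, mem_insert_iff, mem_singleton_iff] at h1 h2 ⊢ htW₂
        grind
      · refine union_subset (Subset.trans ?_ hZC) (hR.trans sdiff_subset)
        rw [insert_union]
  · right
    have htW := ht.resolve_right htA
    obtain ⟨P₁, P₂, W₁, W₂, h₁, h₂, rfl, rfl, hW₁₂, hdisj⟩ := hP.split htW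
    have hZ₂ : G.IsCycleAt (insert g P₁) W₁ t :=
      ⟨g, P₁, z, hzt.symm, h₁, fun h ↦ hgP (Or.inl h), rfl⟩
    have hxW₁ : x ∉ W₁ := fun h ↦ htx (hW₁₂.subset ⟨h, h₂.right_mem⟩).symm
    refine ⟨insert g P₁, Z, P₂, ⟨hZ₂.isCycleSet, hZ.isCycleSet, Or.inr ⟨?_, t, x,
      isPathSet_iff.2 ⟨_, h₂⟩, ?_, ?_⟩⟩, ?_⟩
    · rw [hZ₂.vertsOf_eq, hZ.vertsOf_eq, disjoint_left]
      exact fun s hs hs' ↦ hxW₁ (hW ⟨Or.inl hs, hs'⟩ ▸ hs)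
    · rw [hZ₂.vertsOf_eq, h₂.vertsOf_eq (h₂.nonempty htx), inter_comm, hW₁₂]
    · rw [hZ.vertsOf_eq, h₂.vertsOf_eq (h₂.nonempty htx)]
      exact Subset.antisymm (fun s hs ↦ hW ⟨Or.inr hs.1, hs.2⟩)
        (singleton_subset_iff.2 ⟨h₂.right_mem, hxA⟩)
    · refine union_subset (union_subset (insert_subset hg.1 ?_) hZC) ?_
      · exact subset_union_left.trans (hPC.trans sdiff_subset)
      · exact subset_union_right.trans (hPC.trans sdiff_subset)

end Graph

/-! ## Biased graphs and frame maps -/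

namespace Graph

variable {V : Type v} {α : Type u} {G : Graph V α} {C : Set α} {e : α} {x : V}

theorem vertsOf_finite (G : Graph V α) (hC : C.Finite) : (G.vertsOf C).Finite := by
  have : G.vertsOf C = ⋃ e ∈ C, {x | G.Inc e x} := by ext; simp [vertsOf]
  rw [this]
  refine hC.biUnion fun e _ ↦ ?_
  by_cases he : e ∈ G.edgeSet
  · obtain ⟨x, y, hxy⟩ := exists_isLink_of_mem_edgeSet he
    exact (toFinite {x, y}).subset fun z hz ↦ hz.eq_or_eq_of_isLink hxy
  · simp [he]

theorem vertsOf_mono (G : Graph V α) {C D : Set α} (h : C ⊆ D) : G.vertsOf C ⊆ G.vertsOf D :=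
  fun _ ⟨e, he, hx⟩ ↦ ⟨e, h he, hx⟩

theorem isCycleSet_singleton (h : G.IsLoopAt e x) : G.IsCycleSet {e} :=
  isCycleSet_iff.2 ⟨{x}, x, e, ∅, x, h, IsPathOn.nil x, by simp, by simp⟩

/-- Induction on the edge set: an edge at a leaf vertex is removed together with that vertex, and a
disconnected set is split. What is left is leafless and connected, hence a cycle, where equality
holds. -/
theorem ncard_le_ncard_vertsOf (hC : C.Finite) (hCE : C ⊆ G.edgeSet)
    (ht : ∀ P₁ P₂ P₃, G.IsTheta P₁ P₂ P₃ → ¬ P₁ ∪ P₂ ∪ P₃ ⊆ C)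
    (hh : ∀ Z₁ Z₂ P, G.IsHandcuff Z₁ Z₂ P → ¬ Z₁ ∪ Z₂ ∪ P ⊆ C) :
    C.ncard ≤ (G.vertsOf C).ncard := by
  have key : ∀ n, ∀ J ⊆ C, J.ncard = n → J.ncard ≤ (G.vertsOf J).ncard := by
    intro n
    induction n using Nat.strong_induction_on with
    | _ n ih =>
      intro J hJ hn
      have hJf := hC.subset hJ
      have hVf := G.vertsOf_finite hJf
      have ih' : ∀ J' ⊂ J, J'.ncard ≤ (G.vertsOf J').ncard := fun J' hJ' ↦
        ih _ (hn ▸ ncard_lt_ncard hJ' hJf) J' (hJ'.subset.trans hJ) rfl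
      obtain rfl | hne := J.eq_empty_or_nonempty
      · simp
      by_cases hl : G.Leafless J
      · by_cases hc : G.EdgeConnected J
        · obtain h | ⟨P₁, P₂, P₃, h, hs⟩ | ⟨Z₁, Z₂, P, h, hs⟩ :=
            exists_theta_or_handcuff hJf (hJ.trans hCE) hl hc hne
          · exact h.ncard_vertsOf.ge
          · exact (ht _ _ _ h (hs.trans hJ)).elim
          · exact (hh _ _ _ h (hs.trans hJ)).elim
        · simp only [EdgeConnected, not_forall, not_exists, not_and] at hc
          obtain ⟨X, hX, hXne, hXJ, hX'⟩ := hc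
          have h1 := ih' X (hX.ssubset_of_ne hXJ)
          have h2 := ih' (J \ X) (sdiff_ssubset_left_iff.2 (by rwa [inter_eq_right.2 hX]))
          have h3 : Disjoint (G.vertsOf X) (G.vertsOf (J \ X)) := by
            rw [disjoint_left]
            rintro w ⟨e, he, hew⟩ ⟨f, hf, hfw⟩
            exact hX' e he f hf w hew hfw
          have h4 := ncard_union_eq h3 (hVf.subset (G.vertsOf_mono hX))
            (hVf.subset (G.vertsOf_mono sdiff_subset))
          rw [← vertsOf_union, union_sdiff_cancel hX] at h4
          have h5 := ncard_sdiff_add_ncard_of_subset hX hJf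
          omega
      · simp only [Leafless, not_forall, not_exists, not_and] at hl
        obtain ⟨e, he, w, hew, hw⟩ := hl
        have h1 := ih' (J \ {e}) (sdiff_singleton_ssubset.2 he)
        have h2 : G.vertsOf (J \ {e}) ⊂ G.vertsOf J := by
          refine ⟨G.vertsOf_mono sdiff_subset, fun h ↦ ?_⟩
          obtain ⟨f, hf, hfw⟩ := h ⟨e, he, hew⟩
          exact hw f hf.1 hf.2 hfw
        have h3 := ncard_lt_ncard h2 hVf
        have h4 := ncard_sdiff_singleton_add_one he hJf
        omega
  exact key _ C Subset.rfl rfl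

end Graph

namespace BiasedGraph

variable {V : Type v} {α : Type u} {Ω : BiasedGraph V α} {C : Set α} {e : α} {M : Matroid α}

theorem isHandcuff_iff : (Ω.IsTightHandcuff C ∨ Ω.IsLooseHandcuff C) ↔ ∃ Z₁ Z₂ P,
    Ω.graph.IsHandcuff Z₁ Z₂ P ∧ Z₁ ∉ Ω.balanced ∧ Z₂ ∉ Ω.balanced ∧ C = Z₁ ∪ Z₂ ∪ P := by
  constructor
  · rintro (⟨Z₁, Z₂, x, h1, h2, hd, hx, rfl⟩ | ⟨Z₁, Z₂, P, x, y, h1, h2, hd, hP, hx, hy, rfl⟩)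
    · exact ⟨Z₁, Z₂, ∅, ⟨h1.1, h2.1, Or.inl ⟨rfl, hd, x, hx⟩⟩, h1.2, h2.2, by simp⟩
    · exact ⟨Z₁, Z₂, P, ⟨h1.1, h2.1, Or.inr ⟨hd, x, y, hP, hx, hy⟩⟩, h1.2, h2.2, rfl⟩
  · rintro ⟨Z₁, Z₂, P, ⟨h1, h2, ⟨rfl, hd, x, hx⟩ | ⟨hd, x, y, hP, hx, hy⟩⟩, h3, h4, rfl⟩
    · exact Or.inl ⟨Z₁, Z₂, x, ⟨h1, h3⟩, ⟨h2, h4⟩, hd, hx, by simp⟩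
    · exact Or.inr ⟨Z₁, Z₂, P, x, y, ⟨h1, h3⟩, ⟨h2, h4⟩, hd, hP, hx, hy, rfl⟩

theorem Represents.isCircuit_iff (h : Ω.Represents M) : M.IsCircuit C ↔ C ∈ Ω.balanced ∨
    (∃ Z₁ Z₂ P, Ω.graph.IsHandcuff Z₁ Z₂ P ∧ Z₁ ∉ Ω.balanced ∧ Z₂ ∉ Ω.balanced ∧
      C = Z₁ ∪ Z₂ ∪ P) ∨ Ω.IsContrabalancedTheta C := by
  rw [h.2 C, ← isHandcuff_iff, or_assoc]

/-- A balanced loop is a circuit and so lies in no larger one. All other types of circuit have no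
vertex on just one edge; for handcuffs this includes loops, thanks to the point of attachment. -/
theorem Represents.isCircuit_cases (h : Ω.Represents M) (hC : M.IsCircuit C) :
    (∃ e, C = {e} ∧ {e} ∈ Ω.balanced) ∨
      (Ω.graph.Leafless C ∧ Ω.graph.EdgeConnected C ∧ ∀ e ∈ C, {e} ∉ Ω.balanced) := by
  by_cases hs : ∃ e, C = {e} ∧ {e} ∈ Ω.balanced
  · exact Or.inl hs
  right
  have hnb : ∀ e ∈ C, {e} ∉ Ω.balanced := by
    intro e he heb
    refine hs ⟨e, ?_, heb⟩
    exact ((h.isCircuit_iff.2 (Or.inl heb)).eq_of_subset_isCircuit hC (by simpa using he)).symm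
  rw [← and_assoc]
  refine ⟨?_, hnb⟩
  obtain hb | ⟨Z₁, Z₂, P, hH, -, -, rfl⟩ | ⟨P₁, P₂, P₃, hT, -, -, -, rfl⟩ := h.isCircuit_iff.1 hC
  · have hcyc := Ω.isCycleSet_of_balanced C hb
    refine ⟨fun e he w hw ↦ ?_, hcyc.edgeConnected⟩
    obtain ⟨W, x, hcyc⟩ := Graph.isCycleSet_iff.1 hcyc
    obtain rfl | h' := hcyc.exists_ne he hw
    · exact (hnb e he hb).elim
    · exact h'
  · exact ⟨hH.leafless, hH.edgeConnected⟩
  · exact ⟨hT.leafless, hT.edgeConnected⟩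

-- Balanced loops are matroid loops and must receive no vertex: as one-element circuits they have no
-- second element to cover it. The inequality for independent sets holds because these contain no
-- balanced cycle, so every theta or handcuff in them would be a circuit.
open Classical in
theorem Represents.isFrameMap [M.Finite] (h : Ω.Represents M) :
    M.IsFrameMap fun e ↦ if {e} ∈ Ω.balanced then ∅ else {v | Ω.graph.Inc e v} := by
  have hS : ∀ X : Set α, (∀ e ∈ X, {e} ∉ Ω.balanced) →
      Matroid.supp (fun e ↦ if {e} ∈ Ω.balanced then ∅ else {v | Ω.graph.Inc e v}) X =
        Ω.graph.vertsOf X := by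
    intro X hX
    ext v
    rw [Matroid.mem_supp]
    refine exists_congr fun e ↦ and_congr_right fun he ↦ ?_
    rw [if_neg (hX e he)]
    rfl
  refine ⟨fun e he ↦ ?_, fun I hI ↦ ?_, fun C hC e he v hv ↦ ?_, fun C hC X hXC hne hX ↦ ?_⟩
  · obtain ⟨x, y, hxy⟩ := Graph.exists_isLink_of_mem_edgeSet (h.1.subset he)
    refine (encard_le_encard (t := {x, y}) ?_).trans
      ((encard_insert_le _ _).trans (by rw [encard_singleton]; rfl))
    split_ifs
    · exact empty_subset _
    · exact fun z hz ↦ Graph.Inc.eq_or_eq_of_isLink hz hxy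
  · have hnc : ∀ C ⊆ I, ¬ M.IsCircuit C := fun C hCI hC ↦ hC.not_indep (hI.subset hCI)
    rw [hS I fun e he heb ↦ hnc {e} (by simpa using he) (h.isCircuit_iff.2 (Or.inl heb))]
    have hIf := M.set_finite I hI.subset_ground
    rw [← hIf.cast_ncard_eq, ← (Ω.graph.vertsOf_finite hIf).cast_ncard_eq]
    have hnb : ∀ C ⊆ I, C ∉ Ω.balanced := fun C hCI hC ↦ hnc C hCI (h.isCircuit_iff.2 (Or.inl hC))
    refine Nat.cast_le.2 (Graph.ncard_le_ncard_vertsOf hIf (h.1 ▸ hI.subset_ground) ?_ ?_)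
    · intro P₁ P₂ P₃ hT hTI
      refine hnc _ hTI (h.isCircuit_iff.2 (Or.inr (Or.inr ⟨P₁, P₂, P₃, hT, ?_, ?_, ?_, rfl⟩)))
      · exact hnb _ (subset_union_left.trans hTI)
      · exact hnb _ ((union_subset_union_left _ subset_union_left).trans hTI)
      · exact hnb _ ((union_subset_union_left _ subset_union_right).trans hTI)
    · intro Z₁ Z₂ P hH hHI
      refine hnc _ hHI (h.isCircuit_iff.2 (Or.inr (Or.inl ⟨Z₁, Z₂, P, hH, ?_, ?_, rfl⟩)))
      · exact hnb _ ((subset_union_left.trans subset_union_left).trans hHI)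
      · exact hnb _ ((subset_union_right.trans subset_union_left).trans hHI)
  · obtain ⟨e', rfl, heb⟩ | ⟨hl, -, hnb⟩ := h.isCircuit_cases hC
    · obtain rfl := he
      simp [heb] at hv
    · rw [if_neg (hnb e he)] at hv
      obtain ⟨f, hf, hfe, hfv⟩ := hl e he v hv
      exact ⟨f, hf, hfe, by rwa [if_neg (hnb f hf)]⟩
  · obtain ⟨e', rfl, heb⟩ | ⟨-, hc, hnb⟩ := h.isCircuit_cases hC
    · obtain rfl | h' := subset_singleton_iff_eq.1 hXC
      · simp at hne
      · exact (hX h').elim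
    · obtain ⟨e, he, f, hf, w, hew, hfw⟩ := hc X hXC hne hX
      refine ⟨e, he, f, hf, w, ?_⟩
      rw [if_neg (hnb e (hXC he)), if_neg (hnb f hf.1)]
      exact ⟨hew, hfw⟩

end BiasedGraph

/-! ### The biased graph of a frame map -/

namespace Matroid

variable {V : Type v} {α : Type u} {M : Matroid α} {S : α → Set V} {v₀ x y : V} {e : α} {C : Set α}

open Classical in
/-- The ends of an edge of the graph of a frame map; elements without vertices become loops
at `v₀`. -/
def endsOf (S : α → Set V) (v₀ : V) (e : α) : Set V := if S e = ∅ then {v₀} else S e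

theorem endsOf_of_mem (hx : x ∈ S e) : endsOf S v₀ e = S e :=
  if_neg (nonempty_iff_ne_empty.1 ⟨x, hx⟩)

/-- The graph of a frame map. -/
def IsFrameMap.graph (hS : M.IsFrameMap S) (v₀ : V) : Graph V α where
  vertexSet := insert v₀ (supp S M.E)
  IsLink e x y := e ∈ M.E ∧ endsOf S v₀ e = {x, y}
  edgeSet := M.E
  isLink_symm e _ := ⟨fun x y h ↦ ⟨h.1, h.2.trans (pair_comm x y)⟩⟩
  eq_or_eq_of_isLink_of_isLink := by
    rintro e x y z w ⟨-, h⟩ ⟨-, h'⟩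
    rw [h] at h'
    exact h'.subset (mem_insert _ _)
  edge_mem_iff_exists_isLink := by
    intro e
    refine ⟨fun he ↦ ?_, fun ⟨x, y, h⟩ ↦ h.1⟩
    by_cases h0 : S e = ∅
    · exact ⟨v₀, v₀, he, by simp [endsOf, h0]⟩
    obtain ⟨x, hx⟩ := nonempty_iff_ne_empty.2 h0
    by_cases h : ∃ y ∈ S e, x ≠ y
    · obtain ⟨y, hy, hxy⟩ := h
      exact ⟨x, y, he, (endsOf_of_mem hx).trans
        (subset_pair_of_encard_le_two (hS.encard_le e he) hx hy hxy)⟩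
    · push Not at h
      refine ⟨x, x, he, (endsOf_of_mem hx).trans ?_⟩
      rw [pair_eq_singleton]
      exact Subset.antisymm (fun y hy ↦ (h y hy).symm) (singleton_subset_iff.2 hx)
  left_mem_of_isLink := by
    rintro e x y ⟨he, h⟩
    have hx : x ∈ endsOf S v₀ e := h.symm.subset (mem_insert _ _)
    by_cases h0 : S e = ∅
    · rw [endsOf, if_pos h0] at hx
      exact Or.inl hx
    · rw [endsOf, if_neg h0] at hx
      exact Or.inr (subset_supp he hx)

section

variable (hS : M.IsFrameMap S)

theorem IsFrameMap.graph_inc_iff : (hS.graph v₀).Inc e x ↔ e ∈ M.E ∧ x ∈ endsOf S v₀ e := by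
  constructor
  · rintro ⟨y, he, h⟩
    exact ⟨he, h.symm.subset (mem_insert _ _)⟩
  · rintro ⟨he, hx⟩
    obtain ⟨y, z, hyz⟩ := Graph.exists_isLink_of_mem_edgeSet (G := hS.graph v₀) (e := e) he
    obtain rfl | rfl := hyz.2.subset hx
    · exact hyz.inc_left
    · exact hyz.inc_right

theorem IsFrameMap.graph_inc (he : e ∈ M.E) (hx : x ∈ S e) : (hS.graph v₀).Inc e x :=
  hS.graph_inc_iff.2 ⟨he, (endsOf_of_mem hx).symm ▸ hx⟩

theorem IsFrameMap.nonempty (hS : M.IsFrameMap S) (he : M.IsNonloop e) : (S e).Nonempty := by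
  by_contra h
  have := hS.encard_le_of_indep {e} he.indep
  rw [supp_singleton, not_nonempty_iff_eq_empty.1 h] at this
  simp at this

/-- An element without vertices is a matroid loop and hence a whole circuit. On any other circuit
the incidences of the graph are those of `S`, and the last two conditions on a frame map say that
the circuit is leafless and connected. -/
theorem IsFrameMap.isCircuit_cases (hC : M.IsCircuit C) :
    (∃ e, C = {e} ∧ (hS.graph v₀).IsLoopAt e v₀) ∨
      ((hS.graph v₀).Leafless C ∧ (hS.graph v₀).EdgeConnected C) := by
  by_cases h0 : ∃ e ∈ C, S e = ∅
  · obtain ⟨e, he, h0⟩ := h0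
    left
    refine ⟨e, ?_, hC.subset_ground he, by simp [endsOf, h0]⟩
    by_contra hne
    have hi := hC.ssubset_indep ((singleton_subset_iff.2 he).ssubset_of_ne (Ne.symm hne))
    exact (hS.nonempty (indep_singleton.1 hi)).ne_empty h0
  · right
    push Not at h0
    have hinc : ∀ e ∈ C, ∀ x, (hS.graph v₀).Inc e x ↔ x ∈ S e := by
      intro e he x
      rw [hS.graph_inc_iff, endsOf, if_neg (h0 e he).ne_empty]
      exact and_iff_right (hC.subset_ground he)
    refine ⟨fun e he w hw ↦ ?_, fun X hX hne hXC ↦ ?_⟩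
    · obtain ⟨f, hf, hfe, hwf⟩ := hS.exists_ne C hC e he w ((hinc e he w).1 hw)
      exact ⟨f, hf, hfe, (hinc f hf w).2 hwf⟩
    · obtain ⟨e, he, f, hf, w, hw⟩ := hS.connected C hC X hX hne hXC
      exact ⟨e, he, f, hf, w, (hinc e (hX he) w).2 hw.1, (hinc f hf.1 w).2 hw.2⟩

/-- The vertices of `D` in the graph include `supp S D`, possibly with `v₀` in addition. -/
theorem IsFrameMap.not_indep_of_ncard_lt [M.Finite] {D : Set α} (hD : D ⊆ M.E)
    (h : ((hS.graph v₀).vertsOf D).ncard < D.ncard) : ¬ M.Indep D := by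
  intro hi
  have hDf := M.set_finite D hD
  have h1 := hS.encard_le_of_indep D hi
  have h2 : supp S D ⊆ (hS.graph v₀).vertsOf D := by
    intro x hx
    obtain ⟨e, he, hxe⟩ := mem_supp.1 hx
    exact ⟨e, he, hS.graph_inc (hD he) hxe⟩
  have h3 := h1.trans (encard_le_encard h2)
  rw [← hDf.cast_ncard_eq, ← (Graph.vertsOf_finite _ hDf).cast_ncard_eq] at h3
  have h4 : D.ncard ≤ ((hS.graph v₀).vertsOf D).ncard := by exact_mod_cast h3
  omega

theorem _root_.Graph.IsTheta.subset_ground {G : Graph V α} {P₁ P₂ P₃ : Set α}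
    (h : G.IsTheta P₁ P₂ P₃) : P₁ ∪ P₂ ∪ P₃ ⊆ G.edgeSet := by
  obtain ⟨x, y, hxy, h1, h2, h3, -⟩ := h
  obtain ⟨W₁, h1⟩ := Graph.isPathSet_iff.1 h1
  obtain ⟨W₂, h2⟩ := Graph.isPathSet_iff.1 h2
  obtain ⟨W₃, h3⟩ := Graph.isPathSet_iff.1 h3
  exact union_subset (union_subset h1.subset_ground h2.subset_ground) h3.subset_ground

theorem _root_.Graph.IsHandcuff.subset_ground {G : Graph V α} {Z₁ Z₂ P : Set α}
    (h : G.IsHandcuff Z₁ Z₂ P) : Z₁ ∪ Z₂ ∪ P ⊆ G.edgeSet := by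
  obtain ⟨h1, h2, h⟩ := h
  obtain ⟨W₁, x₁, h1⟩ := Graph.isCycleSet_iff.1 h1
  obtain ⟨W₂, x₂, h2⟩ := Graph.isCycleSet_iff.1 h2
  refine union_subset (union_subset h1.subset_ground h2.subset_ground) ?_
  obtain ⟨rfl, -⟩ | ⟨-, x, y, hP, -⟩ := h
  · exact empty_subset _
  · obtain ⟨W, hP⟩ := Graph.isPathSet_iff.1 hP
    exact hP.subset_ground

/-- The biased graph of a frame map: the balanced cycles are those that are circuits. -/
def IsFrameMap.biasedGraph [M.Finite] (hS : M.IsFrameMap S) (v₀ : V) : BiasedGraph V α where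
  graph := hS.graph v₀
  finite_verts := hS.supp_finite.insert v₀
  finite_edges := M.ground_finite
  balanced := {C | (hS.graph v₀).IsCycleSet C ∧ M.IsCircuit C}
  isCycleSet_of_balanced C hC := hC.1
  theta := by
    rintro P₁ P₂ P₃ hT ⟨-, h₁₂⟩ ⟨-, h₁₃⟩
    obtain ⟨e, he⟩ := hT.nonempty
    obtain ⟨g, hg⟩ := hT.swap₁₂.nonempty
    have hd₁₂ : Disjoint P₁ P₂ := by obtain ⟨_, _, _, _, _, _, h, -⟩ := hT; exact h
    have hd₂₃ : Disjoint P₂ P₃ := by obtain ⟨_, _, _, _, _, _, -, -, h, -⟩ := hT; exact h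
    have hne : P₁ ∪ P₂ ≠ P₁ ∪ P₃ := by
      intro h
      obtain h | h := h.subset (Or.inr hg)
      · exact hd₁₂.le_bot ⟨h, hg⟩
      · exact hd₂₃.le_bot ⟨hg, h⟩
    obtain ⟨D, hD, hDc⟩ := h₁₂.elimination h₁₃ hne e
    have hDs : D ⊆ P₁ ∪ P₂ ∪ P₃ := by
      intro z hz
      have := (hD hz).1
      simp only [mem_union] at this ⊢
      tauto
    have heD : e ∉ D := fun h ↦ (hD h).2 rfl
    refine ⟨hT.swap₁₂.swap₂₃.isCycleSet, ?_⟩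
    obtain ⟨f, rfl, hf⟩ | ⟨hl, -⟩ := hS.isCircuit_cases (v₀ := v₀) hDc
    · exact (hT.ne_of_isLink (hDs rfl) hf rfl).elim
    · obtain rfl | rfl | rfl | rfl := hT.eq_of_leafless hDs hl hDc.nonempty
      · exact (heD (Or.inl he)).elim
      · exact (heD (Or.inl he)).elim
      · exact hDc
      · exact (heD (Or.inl (Or.inl he))).elim

/-- Thetas and handcuffs are dependent, having more edges than vertices. So a circuit containing one
equals it, and conversely a circuit inside one is a balanced cycle of it or all of it, because
circuits are leafless and connected. -/
theorem IsFrameMap.represents [M.Finite] (hS : M.IsFrameMap S) (v₀ : V) :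
    (hS.biasedGraph v₀).Represents M := by
  refine ⟨rfl, fun C ↦ ?_⟩
  have hb : ∀ D, D ∈ (hS.biasedGraph v₀).balanced ↔ (hS.graph v₀).IsCycleSet D ∧ M.IsCircuit D :=
    fun _ ↦ Iff.rfl
  have hg : (hS.biasedGraph v₀).graph = hS.graph v₀ := rfl
  rw [← or_assoc (a := BiasedGraph.IsTightHandcuff _ _), BiasedGraph.isHandcuff_iff,
    BiasedGraph.IsContrabalancedTheta]
  simp only [hb, hg]
  have hTd : ∀ P₁ P₂ P₃, (hS.graph v₀).IsTheta P₁ P₂ P₃ → M.Dep (P₁ ∪ P₂ ∪ P₃) :=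
    fun P₁ P₂ P₃ h ↦ ⟨hS.not_indep_of_ncard_lt h.subset_ground h.ncard_lt, h.subset_ground⟩
  have hHd : ∀ Z₁ Z₂ P, (hS.graph v₀).IsHandcuff Z₁ Z₂ P → M.Dep (Z₁ ∪ Z₂ ∪ P) :=
    fun P₁ P₂ P₃ h ↦ ⟨hS.not_indep_of_ncard_lt h.subset_ground h.ncard_lt, h.subset_ground⟩
  constructor
  · intro hC
    have heq : ∀ D ⊆ C, ¬ M.Indep D → C = D := by
      intro D hDC hD
      by_contra hne
      exact hD (hC.ssubset_indep (hDC.ssubset_of_ne (Ne.symm hne)))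
    obtain ⟨e, rfl, he⟩ | ⟨hl, hc⟩ := hS.isCircuit_cases (v₀ := v₀) hC
    · exact Or.inl ⟨Graph.isCycleSet_singleton he, hC⟩
    · obtain h | ⟨P₁, P₂, P₃, h, hs⟩ | ⟨Z₁, Z₂, P, h, hs⟩ := Graph.exists_theta_or_handcuff
        (G := hS.graph v₀) (M.set_finite C hC.subset_ground) hC.subset_ground hl hc hC.nonempty
      · exact Or.inl ⟨h, hC⟩
      · obtain rfl := heq _ hs (hTd _ _ _ h).not_indep
        have key : ∀ A B D : Set α, (A ∪ B ∪ D).Nonempty → A ∪ B ∪ D = P₁ ∪ P₂ ∪ P₃ →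
            (hS.graph v₀).IsTheta A B D → ¬ M.IsCircuit (A ∪ B) := by
          intro A B D _ hABD hT hAB
          have := hAB.eq_of_subset_isCircuit hC (hABD ▸ subset_union_left)
          obtain ⟨g, hg⟩ := hT.swap₂₃.swap₁₂.nonempty
          obtain ⟨_, _, _, _, _, _, -, d13, d23, -⟩ := hT
          have hg' : g ∈ A ∪ B := this ▸ hABD ▸ Or.inr hg
          obtain hg' | hg' := hg'
          · exact d13.le_bot ⟨hg', hg⟩
          · exact d23.le_bot ⟨hg', hg⟩
        refine Or.inr (Or.inr ⟨P₁, P₂, P₃, h, fun h' ↦ ?_, fun h' ↦ ?_, fun h' ↦ ?_, rfl⟩)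
        · exact key P₁ P₂ P₃ hC.nonempty rfl h h'.2
        · exact key P₁ P₃ P₂ (by rw [union_right_comm]; exact hC.nonempty)
            (union_right_comm _ _ _) h.swap₂₃ h'.2
        · have hu : P₂ ∪ P₃ ∪ P₁ = P₁ ∪ P₂ ∪ P₃ := by rw [union_comm, union_assoc]
          exact key P₂ P₃ P₁ (hu ▸ hC.nonempty) hu h.swap₁₂.swap₂₃ h'.2
      · obtain rfl := heq _ hs (hHd _ _ _ h).not_indep
        have hdisj := h.disjoint
        refine Or.inr (Or.inl ⟨Z₁, Z₂, P, h, fun h' ↦ ?_, fun h' ↦ ?_, rfl⟩)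
        · have := h'.2.eq_of_subset_isCircuit hC (subset_union_left.trans subset_union_left)
          obtain ⟨g, hg⟩ := h.2.1.nonempty
          exact hdisj.le_bot ⟨this.symm.subset (Or.inl (Or.inr hg)), hg⟩
        · have := h'.2.eq_of_subset_isCircuit hC (subset_union_right.trans subset_union_left)
          obtain ⟨g, hg⟩ := h.1.nonempty
          exact hdisj.le_bot ⟨hg, this.symm.subset (Or.inl (Or.inl hg))⟩
  · rintro (h | ⟨Z₁, Z₂, P, h, h1, h2, rfl⟩ | ⟨P₁, P₂, P₃, h, h1, h2, h3, rfl⟩)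
    · exact h.2
    · obtain ⟨D, hD, hDc⟩ := (hHd _ _ _ h).exists_isCircuit_subset
      obtain ⟨e, rfl, he⟩ | ⟨hl, hc⟩ := hS.isCircuit_cases (v₀ := v₀) hDc
      · have hcy := Graph.isCycleSet_singleton he
        obtain rfl | rfl := h.isLoopAt (hD rfl) he
        · exact (h1 ⟨hcy, hDc⟩).elim
        · exact (h2 ⟨hcy, hDc⟩).elim
      · obtain rfl | rfl | rfl := h.eq_of_leafless hD hl hc hDc.nonempty
        · exact (h1 ⟨h.1, hDc⟩).elim
        · exact (h2 ⟨h.2.1, hDc⟩).elim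
        · exact hDc
    · obtain ⟨D, hD, hDc⟩ := (hTd _ _ _ h).exists_isCircuit_subset
      obtain ⟨e, rfl, he⟩ | ⟨hl, -⟩ := hS.isCircuit_cases (v₀ := v₀) hDc
      · exact (h.ne_of_isLink (hD rfl) he rfl).elim
      · obtain rfl | rfl | rfl | rfl := h.eq_of_leafless hD hl hDc.nonempty
        · exact (h1 ⟨h.isCycleSet, hDc⟩).elim
        · exact (h2 ⟨h.swap₂₃.isCycleSet, hDc⟩).elim
        · exact (h3 ⟨h.swap₁₂.swap₂₃.isCycleSet, hDc⟩).elim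
        · exact hDc

end

end Matroid

/-- A nonloop has a vertex, so a joint in `L` becomes a graph loop; it is unbalanced because it is
not a circuit. The vertex `none` holds the matroid loops. -/
theorem Matroidal.isFrame_iff_isFramed {α : Type u} (A : Matroidal α) [A.M.Finite] :
    A.IsFrame ↔ A.M.IsFramed A.L := by
  classical
  constructor
  · rintro ⟨V, Ω, hΩ, hL⟩
    refine hΩ.isFrameMap.isFramed fun e he ↦ ?_
    obtain ⟨⟨x, hx⟩, hb⟩ := hL e he
    simp only [hb, if_false]
    intro y hy z hz
    exact (hx.eq_of_inc hy).symm.trans (hx.eq_of_inc hz)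
  · rintro ⟨V, S, hS, hL⟩
    have hS' := hS.comp some (Option.some_injective V).injOn
    refine ⟨Option V, hS'.biasedGraph none, hS'.represents none, fun e he ↦ ?_⟩
    have hnl := A.isNonloop e he
    obtain ⟨x, hx⟩ := hS'.nonempty hnl
    refine ⟨⟨x, hnl.mem_ground, ?_⟩, fun h ↦ h.2.not_indep hnl.indep⟩
    refine (Matroid.endsOf_of_mem (S := fun e ↦ some '' S e) hx).trans ?_
    rw [pair_eq_singleton]
    exact ((hL e he).image some).eq_singleton_of_mem hx

/-! ## 2-sums with uniform matroids of rank two -/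

namespace Matroid

universe w
variable {α : Type u} {V : Type w} {M M₀ : Matroid α} {T : Set α} {e s t x : α} {Y : Set α}

/-- `M` is the 2-sum on `e` of `M₀` and the uniform matroid of rank two on `insert e T`. -/
structure IsLineSum (M M₀ : Matroid α) (e : α) (T : Set α) : Prop where
  mem_ground : e ∈ M₀.E
  disjoint : Disjoint M₀.E T
  ground_eq : M.E = (M₀.E \ {e}) ∪ T
  isCircuit_iff : ∀ C, M.IsCircuit C ↔ (M₀.IsCircuit C ∧ e ∉ C) ∨ (C ⊆ T ∧ C.encard = 3) ∨
    ∃ C₁, M₀.IsCircuit C₁ ∧ e ∈ C₁ ∧ ∃ t ∈ T, ∃ t' ∈ T, t ≠ t' ∧ C = (C₁ \ {e}) ∪ {t, t'}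

namespace IsLineSum

theorem notMem (h : IsLineSum M M₀ e T) : e ∉ T := fun he ↦ h.disjoint.le_bot ⟨h.mem_ground, he⟩

theorem notMem_of_mem (h : IsLineSum M M₀ e T) (ht : t ∈ T) : t ∉ M₀.E :=
  fun he ↦ h.disjoint.le_bot ⟨he, ht⟩

theorem notMem_of_subset (h : IsLineSum M M₀ e T) (hY : Y ⊆ M₀.E \ {e}) (ht : t ∈ T) : t ∉ Y :=
  fun he ↦ h.disjoint.le_bot ⟨(hY he).1, ht⟩

theorem ne_of_mem (h : IsLineSum M M₀ e T) (hx : x ∈ M₀.E) (ht : t ∈ T) : x ≠ t :=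
  fun he ↦ h.disjoint.le_bot ⟨hx, he ▸ ht⟩

theorem mem_ground_of_mem (h : IsLineSum M M₀ e T) (ht : t ∈ T) : t ∈ M.E :=
  h.ground_eq.symm ▸ Or.inr ht

theorem subset_ground (h : IsLineSum M M₀ e T) : M₀.E \ {e} ⊆ M.E :=
  h.ground_eq.symm ▸ subset_union_left

theorem isCircuit_iff_of_subset (h : IsLineSum M M₀ e T) (hY : Y ⊆ M₀.E \ {e}) :
    M.IsCircuit Y ↔ M₀.IsCircuit Y := by
  rw [h.isCircuit_iff]
  constructor
  · rintro (h' | ⟨hT, h3⟩ | ⟨C₁, hC₁, heC₁, t, ht, t', ht', -, rfl⟩)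
    · exact h'.1
    · have : Y = ∅ := eq_empty_of_forall_notMem fun z hz ↦ h.notMem_of_subset hY (hT hz) hz
      simp [this] at h3
    · exact (h.notMem_of_subset hY ht (Or.inr (Or.inl rfl))).elim
  · exact fun h' ↦ Or.inl ⟨h', fun he ↦ (hY he).2 rfl⟩

theorem indep_iff_of_subset (h : IsLineSum M M₀ e T) (hY : Y ⊆ M₀.E \ {e}) :
    M.Indep Y ↔ M₀.Indep Y := by
  rw [indep_iff_forall_subset_not_isCircuit (hY.trans h.subset_ground),
    indep_iff_forall_subset_not_isCircuit (hY.trans sdiff_subset)]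
  exact forall₂_congr fun C hC ↦ not_congr (h.isCircuit_iff_of_subset (hC.trans hY))

theorem isCircuit_of_triple (h : IsLineSum M M₀ e T) {a b c : α} (ha : a ∈ T) (hb : b ∈ T)
    (hc : c ∈ T) (hab : a ≠ b) (hac : a ≠ c) (hbc : b ≠ c) : M.IsCircuit {a, b, c} := by
  refine (h.isCircuit_iff _).2 (Or.inr (Or.inl ⟨?_, ?_⟩))
  · rintro z (rfl | rfl | rfl) <;> assumption
  · rw [encard_insert_of_notMem (by simp [hab, hac]), encard_pair hbc]
    norm_num

theorem isCircuit_of_pair (h : IsLineSum M M₀ e T) (hs : s ∈ T) (ht : t ∈ T) (hst : s ≠ t)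
    {C : Set α} (hC : M₀.IsCircuit C) (he : e ∈ C) : M.IsCircuit ((C \ {e}) ∪ {s, t}) :=
  (h.isCircuit_iff _).2 (Or.inr (Or.inr ⟨C, hC, he, s, hs, t, ht, hst, rfl⟩))

theorem mem_closure_iff (h : IsLineSum M M₀ e T) (hx : x ∈ M₀.E \ {e}) (hY : Y ⊆ M₀.E \ {e}) :
    x ∈ M.closure Y ↔ x ∈ M₀.closure Y := by
  by_cases hxY : x ∈ Y
  · exact iff_of_true (M.mem_closure_of_mem' hxY (h.subset_ground hx))
      (M₀.mem_closure_of_mem' hxY hx.1)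
  rw [mem_closure_iff_exists_isCircuit hxY, mem_closure_iff_exists_isCircuit hxY]
  refine exists_congr fun C ↦ and_congr_right fun hC ↦ ?_
  rw [h.isCircuit_iff_of_subset (hC.trans (insert_subset hx hY))]

theorem notMem_closure (h : IsLineSum M M₀ e T) (ht : t ∈ T) (hY : Y ⊆ M₀.E \ {e}) :
    t ∉ M.closure Y := by
  rw [mem_closure_iff_exists_isCircuit (h.notMem_of_subset hY ht)]
  rintro ⟨C, hC, hCc, htC⟩
  have hCT : ∀ z ∈ C, z ∈ T → z = t := fun z hz hzT ↦
    (hC hz).resolve_right fun h' ↦ h.notMem_of_subset hY hzT h'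
  obtain h' | ⟨hT, h3⟩ | ⟨C₁, hC₁, heC₁, s, hs, s', hs', hne, rfl⟩ := (h.isCircuit_iff C).1 hCc
  · exact h.notMem_of_mem ht (h'.1.subset_ground htC)
  · have : C ⊆ {t} := fun z hz ↦ hCT z hz (hT hz)
    have := encard_le_encard this
    rw [h3, encard_singleton] at this
    exact absurd this (by norm_num)
  · exact hne ((hCT s (Or.inr (Or.inl rfl)) hs).trans (hCT s' (Or.inr (Or.inr rfl)) hs').symm)

/-- Contracting one element of the line turns every other one into a copy of `e`. -/
theorem mem_closure_insert_iff (h : IsLineSum M M₀ e T) (hs : s ∈ T) (ht : t ∈ T) (hst : s ≠ t)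
    (hY : Y ⊆ M₀.E \ {e}) : s ∈ M.closure (insert t Y) ↔ e ∈ M₀.closure Y := by
  have heY : e ∉ Y := fun h' ↦ (hY h').2 rfl
  rw [mem_closure_iff_exists_isCircuit heY, mem_closure_iff_exists_isCircuit
    (by simp [hst, h.notMem_of_subset hY hs])]
  constructor
  · rintro ⟨C, hC, hCc, hsC⟩
    have hCT : ∀ z ∈ C, z ∈ T → z = s ∨ z = t := by
      intro z hz hzT
      obtain h' | h' | h' := hC hz
      · exact Or.inl h'
      · exact Or.inr h'
      · exact (h.notMem_of_subset hY hzT h').elim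
    obtain h' | ⟨hT, h3⟩ | ⟨C₁, hC₁, heC₁, p, hp, p', hp', hne, rfl⟩ := (h.isCircuit_iff C).1 hCc
    · exact (h.notMem_of_mem hs (h'.1.subset_ground hsC)).elim
    · have : C ⊆ {s, t} := fun z hz ↦ hCT z hz (hT hz)
      have := encard_le_encard this
      rw [h3, encard_pair hst] at this
      exact absurd this (by norm_num)
    · refine ⟨C₁, fun z hz ↦ ?_, hC₁, heC₁⟩
      by_cases hze : z = e
      · exact Or.inl hze
      obtain rfl | rfl | h' := hC (Or.inl ⟨hz, hze⟩)
      · exact (h.notMem_of_mem hs (hC₁.subset_ground hz)).elim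
      · exact (h.notMem_of_mem ht (hC₁.subset_ground hz)).elim
      · exact Or.inr h'
  · rintro ⟨C, hC, hCc, heC⟩
    refine ⟨_, ?_, h.isCircuit_of_pair hs ht hst hCc heC, Or.inr (Or.inl rfl)⟩
    rintro z (hz | rfl | rfl)
    · exact Or.inr (Or.inr ((hC hz.1).resolve_left hz.2))
    · exact Or.inl rfl
    · exact Or.inr (Or.inl rfl)

theorem mem_closure_insert_iff_of_mem (h : IsLineSum M M₀ e T) (ht : t ∈ T) (hx : x ∈ M₀.E \ {e})
    (hY : Y ⊆ M₀.E \ {e}) : x ∈ M.closure (insert t Y) ↔ x ∈ M₀.closure Y := by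
  rw [← h.mem_closure_iff hx hY]
  refine ⟨fun h' ↦ ?_, fun h' ↦ M.closure_subset_closure (subset_insert _ _) h'⟩
  by_contra hcon
  exact h.notMem_closure ht (insert_subset hx hY) (mem_closure_insert hcon h')

theorem deleteElem (h : IsLineSum M M₀ e T) (ht : t ∈ T) : IsLineSum (M ＼ {t}) M₀ e (T \ {t}) := by
  refine ⟨h.mem_ground, h.disjoint.mono_right sdiff_subset, ?_, fun C ↦ ?_⟩
  · rw [delete_ground, h.ground_eq, union_sdiff_distrib,
      sdiff_singleton_eq_self fun h' ↦ h.notMem_of_mem ht h'.1]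
  · rw [delete_isCircuit_iff, h.isCircuit_iff, disjoint_singleton_right]
    constructor
    · rintro ⟨h' | ⟨hT, h3⟩ | ⟨C₁, hC₁, heC₁, p, hp, p', hp', hne, rfl⟩, htC⟩
      · exact Or.inl h'
      · exact Or.inr (Or.inl ⟨subset_sdiff_singleton hT htC, h3⟩)
      · refine Or.inr (Or.inr ⟨C₁, hC₁, heC₁, p, ⟨hp, ?_⟩, p', ⟨hp', ?_⟩, hne, rfl⟩)
        · rintro rfl
          exact htC (Or.inr (Or.inl rfl))
        · rintro rfl
          exact htC (Or.inr (Or.inr rfl))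
    · rintro (h' | ⟨hT, h3⟩ | ⟨C₁, hC₁, heC₁, p, hp, p', hp', hne, rfl⟩)
      · exact ⟨Or.inl h', fun htC ↦ h.notMem_of_mem ht (h'.1.subset_ground htC)⟩
      · exact ⟨Or.inr (Or.inl ⟨hT.trans sdiff_subset, h3⟩), fun htC ↦ (hT htC).2 rfl⟩
      · refine ⟨Or.inr (Or.inr ⟨C₁, hC₁, heC₁, p, hp.1, p', hp'.1, hne, rfl⟩), ?_⟩
        rintro (htC | rfl | rfl)
        · exact h.notMem_of_mem ht (hC₁.subset_ground htC.1)
        · exact hp.2 rfl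
        · exact hp'.2 rfl

/-- An independent set has at most two elements on the line. One such element is paid for by the new
vertex `c`. With two, the rest together with `e` is independent in `M₀`, and the two elements cover
`c` and the vertices of `e`. -/
theorem encard_le_supp (h : IsLineSum M M₀ e T) {S S' : α → Set V} {c : V}
    (hS : M₀.IsFrameMap S) (hc : c ∉ supp S M₀.E) (hS' : ∀ x ∈ M₀.E \ {e}, S' x = S x)
    (hcT : ∀ t ∈ T, c ∈ S' t) (hTT : ∀ s ∈ T, ∀ t ∈ T, s ≠ t → S e ⊆ S' s ∪ S' t)
    (I : Set α) (hI : M.Indep I) : I.encard ≤ (supp S' I).encard := by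
  have hsupp : ∀ Y ⊆ M₀.E \ {e}, supp S' Y = supp S Y := fun Y hY ↦
    iUnion₂_congr fun x hx ↦ hS' x (hY hx)
  have hIE := hI.subset_ground
  rw [h.ground_eq] at hIE
  set Y := I \ T with hY
  have hYX : Y ⊆ M₀.E \ {e} := fun z hz ↦ (hIE hz.1).resolve_right hz.2
  have hYi : M₀.Indep Y := (h.indep_iff_of_subset hYX).1 (hI.subset sdiff_subset)
  have hYle : Y.encard ≤ (supp S' Y).encard := by
    rw [hsupp Y hYX]
    exact hS.encard_le_of_indep Y hYi
  have hcY : c ∉ supp S' Y := by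
    rw [hsupp Y hYX]
    exact fun h' ↦ hc (supp_mono (hYX.trans sdiff_subset) h')
  by_cases h1 : ∃ s ∈ I, s ∈ T
  swap
  · push Not at h1
    have : I = Y := by rw [hY]; exact (sdiff_eq_left.2 (disjoint_left.2 h1)).symm
    rwa [this]
  obtain ⟨s, hsI, hs⟩ := h1
  have hsY : s ∉ Y := fun h' ↦ h'.2 hs
  by_cases h2 : ∃ t ∈ I, t ∈ T ∧ s ≠ t
  swap
  · push Not at h2
    have hIY : I = insert s Y := by
      ext z
      by_cases hz : z ∈ T
      · simp only [hY, mem_insert_iff, mem_sdiff, hz, not_true, and_false, or_false]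
        exact ⟨fun h' ↦ (h2 z h' hz).symm, fun h' ↦ h' ▸ hsI⟩
      · simp only [hY, mem_insert_iff, mem_sdiff, hz, not_false_eq_true, and_true]
        exact ⟨Or.inr, fun h' ↦ h'.resolve_left fun h'' ↦ hz (h'' ▸ hs)⟩
    rw [hIY, encard_insert_of_notMem hsY, supp_insert]
    calc Y.encard + 1 ≤ (supp S' Y).encard + 1 := by gcongr
      _ = (insert c (supp S' Y)).encard := (encard_insert_of_notMem hcY).symm
      _ ≤ _ := encard_le_encard (insert_subset (Or.inl (hcT s hs)) subset_union_right)
  obtain ⟨t, htI, ht, hst⟩ := h2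
  have htY : t ∉ Y := fun h' ↦ h'.2 ht
  have hIY : I = insert s (insert t Y) := by
    ext z
    by_cases hz : z ∈ T
    · simp only [hY, mem_insert_iff, mem_sdiff, hz, not_true, and_false, or_false]
      constructor
      · intro hzI
        by_contra! hcon
        refine (h.isCircuit_of_triple hz hs ht hcon.1 hcon.2 hst).not_indep (hI.subset ?_)
        rintro y (rfl | rfl | rfl) <;> assumption
      · rintro (rfl | rfl) <;> assumption
    · simp only [hY, mem_insert_iff, mem_sdiff, hz, not_false_eq_true, and_true]
      refine ⟨fun h' ↦ Or.inr (Or.inr h'), ?_⟩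
      rintro (rfl | rfl | h') <;> assumption
  have heY : e ∉ Y := fun h' ↦ (hYX h').2 rfl
  have hei : M₀.Indep (insert e Y) := by
    rw [indep_iff_forall_subset_not_isCircuit
      (insert_subset h.mem_ground (hYX.trans sdiff_subset))]
    intro C hC hCc
    by_cases heC : e ∈ C
    · refine (h.isCircuit_of_pair hs ht hst hCc heC).not_indep (hI.subset ?_)
      rintro z (hz | rfl | rfl)
      · exact ((hC hz.1).resolve_left hz.2).1
      · exact hsI
      · exact htI
    · exact hCc.not_indep (hYi.subset ((subset_insert_iff_of_notMem heC).1 hC))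
  have hle := hS.encard_le_of_indep _ hei
  rw [encard_insert_of_notMem heY] at hle
  have hce : c ∉ supp S (insert e Y) := fun h' ↦
    hc (supp_mono (insert_subset h.mem_ground (hYX.trans sdiff_subset)) h')
  rw [hIY, encard_insert_of_notMem (by simp [hst, hsY]), encard_insert_of_notMem htY, supp_insert,
    supp_insert]
  calc Y.encard + 1 + 1 ≤ (supp S (insert e Y)).encard + 1 := by gcongr
    _ = (insert c (supp S (insert e Y))).encard := (encard_insert_of_notMem hce).symm
    _ ≤ _ := by
      refine encard_le_encard (insert_subset (Or.inl (hcT s hs)) ?_)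
      rw [supp_insert, ← hsupp Y hYX, ← union_assoc]
      exact union_subset_union_left _ (hTT s hs t ht hst)

/-- All line elements meet at a new vertex `c`, add to it only vertices of `e`, and any two of them
cover the vertices of `e`. So a pair of them plays the role of `e` in a circuit, and any three are
covered twice at each vertex. -/
theorem isFrameMap (h : IsLineSum M M₀ e T) {S S' : α → Set V} {c : V} (hS : M₀.IsFrameMap S)
    (hc : c ∉ supp S M₀.E) (hS' : ∀ x ∈ M₀.E \ {e}, S' x = S x) (hcT : ∀ t ∈ T, c ∈ S' t)
    (hT2 : ∀ t ∈ T, (S' t).encard ≤ 2) (hTe : ∀ t ∈ T, S' t ⊆ insert c (S e))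
    (hTT : ∀ s ∈ T, ∀ t ∈ T, s ≠ t → S e ⊆ S' s ∪ S' t) : M.IsFrameMap S' := by
  refine ⟨fun x hx ↦ ?_, h.encard_le_supp hS hc hS' hcT hTT, fun C hCM f hf v hv ↦ ?_,
    fun C hCM X hX hne hXC ↦ ?_⟩
  · rw [h.ground_eq] at hx
    obtain hx | hx := hx
    · rw [hS' x hx]
      exact hS.encard_le x hx.1
    · exact hT2 x hx
  · obtain ⟨hC₀, heC⟩ | ⟨hCT, h3⟩ | ⟨C, hC, heC, s, hs, t, ht, hst, rfl⟩ := (h.isCircuit_iff C).1 hCM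
    · have hCX : ∀ x ∈ C, S' x = S x :=
        fun x hx ↦ hS' x ⟨hC₀.subset_ground hx, fun h' ↦ heC (h' ▸ hx)⟩
      rw [hCX f hf] at hv
      obtain ⟨g, hg, hgf, hvg⟩ := hS.exists_ne C hC₀ f hf v hv
      exact ⟨g, hg, hgf, by rwa [hCX g hg]⟩
    · have h2 : 1 < (C \ {f}).encard := by
        have := encard_sdiff_singleton_add_one hf
        rw [h3] at this
        have h4 : (C \ {f}).encard = 2 := by
          have h5 : (3 : ℕ∞) = 2 + 1 := by norm_num
          rw [h5] at this
          exact ENat.add_left_injective_of_ne_top (by simp) this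
        rw [h4]
        norm_num
      obtain ⟨s, t, hs, ht, hst⟩ := one_lt_encard_iff.1 h2
      obtain rfl | hv := hTe f (hCT hf) hv
      · exact ⟨s, hs.1, hs.2, hcT s (hCT hs.1)⟩
      · obtain h' | h' := hTT s (hCT hs.1) t (hCT ht.1) hst hv
        · exact ⟨s, hs.1, hs.2, h'⟩
        · exact ⟨t, ht.1, ht.2, h'⟩
    · have hCX : ∀ x ∈ C, x ≠ e → S' x = S x := fun x hx hxe ↦ hS' x ⟨hC.subset_ground hx, hxe⟩
      have key : ∀ p q, p ∈ T → q ∈ T → p ≠ q → ({p, q} : Set α) = {s, t} → v ∈ S' p →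
          ∃ g ∈ C \ {e} ∪ {s, t}, g ≠ p ∧ v ∈ S' g := by
        intro p q hp hq hpq hpqst hv
        obtain rfl | hv := hTe p hp hv
        · exact ⟨q, Or.inr (hpqst ▸ Or.inr rfl), hpq.symm, hcT q hq⟩
        · obtain ⟨g, hg, hge, hvg⟩ := hS.exists_ne C hC e heC v hv
          exact ⟨g, Or.inl ⟨hg, hge⟩, h.ne_of_mem (hC.subset_ground hg) hp,
            (hCX g hg hge).symm ▸ hvg⟩
      obtain hf | rfl | rfl := hf
      · rw [hCX f hf.1 hf.2] at hv
        obtain ⟨g, hg, hgf, hvg⟩ := hS.exists_ne C hC f hf.1 v hv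
        by_cases hge : g = e
        · subst hge
          obtain h' | h' := hTT s hs t ht hst hvg
          · exact ⟨s, Or.inr (Or.inl rfl), (h.ne_of_mem (hC.subset_ground hf.1) hs).symm, h'⟩
          · exact ⟨t, Or.inr (Or.inr rfl), (h.ne_of_mem (hC.subset_ground hf.1) ht).symm, h'⟩
        · exact ⟨g, Or.inl ⟨hg, hge⟩, hgf, (hCX g hg hge).symm ▸ hvg⟩
      · exact key f t hs ht hst rfl hv
      · exact key f s ht hs hst.symm (pair_comm _ _) hv
  · obtain ⟨hC₀, heC⟩ | ⟨hCT, h3⟩ | ⟨C, hC, heC, s, hs, t, ht, hst, rfl⟩ := (h.isCircuit_iff C).1 hCM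
    · have hCX : ∀ x ∈ C, S' x = S x :=
        fun x hx ↦ hS' x ⟨hC₀.subset_ground hx, fun h' ↦ heC (h' ▸ hx)⟩
      obtain ⟨a, ha, b, hb, hab⟩ := hS.connected C hC₀ X hX hne hXC
      exact ⟨a, ha, b, hb, by rwa [hCX a (hX ha), hCX b hb.1]⟩
    · obtain ⟨a, ha⟩ := hne
      obtain ⟨b, hb⟩ := sdiff_nonempty.2 fun h' ↦ hXC (hX.antisymm h')
      exact ⟨a, ha, b, hb, c, hcT a (hCT (hX ha)), hcT b (hCT hb.1)⟩
    · have hCX : ∀ x ∈ C, x ≠ e → S' x = S x := fun x hx hxe ↦ hS' x ⟨hC.subset_ground hx, hxe⟩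
      have hsC : s ∈ C \ {e} ∪ {s, t} := Or.inr (Or.inl rfl)
      have htC : t ∈ C \ {e} ∪ {s, t} := Or.inr (Or.inr rfl)
      by_cases hsX : s ∈ X <;> by_cases htX : t ∈ X
      -- When both line elements are in `X`, they are replaced by `e` and the connectedness of `C`
      -- applies.
      · have hX1 : ∀ z ∈ X ∩ C, z ∈ C \ {e} := by
          rintro z ⟨hzX, hzC⟩
          refine ⟨hzC, ?_⟩
          rintro rfl
          obtain h' | rfl | rfl := hX hzX
          · exact h'.2 rfl
          · exact h.notMem hs
          · exact h.notMem ht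
        obtain ⟨a, ha, b, hb, v, hva, hvb⟩ := hS.connected C hC (insert e (X ∩ C))
          (insert_subset heC inter_subset_right) (insert_nonempty _ _) (by
            intro heq
            refine hXC (hX.antisymm ?_)
            rintro z (hz | rfl | rfl)
            · exact ((heq.symm.subset hz.1).resolve_left hz.2).1
            · exact hsX
            · exact htX)
        rw [mem_sdiff, mem_insert_iff, not_or] at hb
        have hb' : b ∈ (C \ {e} ∪ {s, t}) \ X := ⟨Or.inl ⟨hb.1, hb.2.1⟩, fun h' ↦ hb.2.2 ⟨h', hb.1⟩⟩
        have hvb' : v ∈ S' b := (hCX b hb.1 hb.2.1).symm ▸ hvb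
        obtain rfl | ha := ha
        · obtain h' | h' := hTT s hs t ht hst hva
          · exact ⟨s, hsX, b, hb', v, h', hvb'⟩
          · exact ⟨t, htX, b, hb', v, h', hvb'⟩
        · exact ⟨a, ha.1, b, hb', v, (hCX a ha.2 (hX1 a ha).2).symm ▸ hva, hvb'⟩
      · exact ⟨s, hsX, t, ⟨htC, htX⟩, c, hcT s hs, hcT t ht⟩
      · exact ⟨t, htX, s, ⟨hsC, hsX⟩, c, hcT t ht, hcT s hs⟩
      · have hX1 : X ⊆ C \ {e} := by
          intro z hz
          obtain h' | rfl | rfl := hX hz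
          · exact h'
          · exact (hsX hz).elim
          · exact (htX hz).elim
        obtain ⟨a, ha, b, hb, v, hva, hvb⟩ := hS.connected C hC X (hX1.trans sdiff_subset) hne (by
          rintro rfl
          exact (hX1 heC).2 rfl)
        have hva' : v ∈ S' a := (hCX a (hX1 ha).1 (hX1 ha).2).symm ▸ hva
        by_cases hbe : b = e
        · subst hbe
          obtain h' | h' := hTT s hs t ht hst hvb
          · exact ⟨a, ha, s, ⟨hsC, hsX⟩, v, hva', h'⟩
          · exact ⟨a, ha, t, ⟨htC, htX⟩, v, hva', h'⟩
        · exact ⟨a, ha, b, ⟨Or.inl ⟨hb.1, hbe⟩, hb.2⟩, v, hva', (hCX b hb.1 hbe).symm ▸ hvb⟩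

-- The new vertex is `none`, and `A t` is the vertex of `e`, if any, to which `t` is attached.
open Classical in
theorem isFramed (h : IsLineSum M M₀ e T) {V : Type} {S : α → Set V} (hS : M₀.IsFrameMap S)
    (A : α → Set V) (hA : ∀ t ∈ T, A t ⊆ S e) (hA1 : ∀ t ∈ T, (A t).Subsingleton)
    (hAT : ∀ s ∈ T, ∀ t ∈ T, s ≠ t → S e ⊆ A s ∪ A t) {K : Set α} (hKT : Disjoint K T)
    (hK : ∀ k ∈ K, (S k).Subsingleton) : M.IsFramed K := by
  have hS₁ := hS.comp some (Option.some_injective V).injOn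
  refine ⟨Option V, fun x ↦ if x ∈ T then insert none (some '' A x) else some '' S x,
    h.isFrameMap (c := none) hS₁ ?_ ?_ ?_ ?_ ?_ ?_, fun k hk ↦ ?_⟩
  · simp [mem_supp]
  · intro x hx
    rw [if_neg fun h' ↦ h.notMem_of_mem h' hx.1]
  · intro t ht
    rw [if_pos ht]
    exact mem_insert _ _
  · intro t ht
    rw [if_pos ht]
    refine (encard_insert_le _ _).trans ?_
    calc _ ≤ (1 : ℕ∞) + 1 := by
          gcongr
          exact encard_le_one_iff_subsingleton.2 ((hA1 t ht).image some)
      _ = 2 := by norm_num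
  · intro t ht
    rw [if_pos ht]
    exact insert_subset_insert (image_mono (hA t ht))
  · intro s hs t ht hst
    simp only [if_pos hs, if_pos ht]
    refine (image_mono (hAT s hs t ht hst)).trans ?_
    rw [image_union]
    exact union_subset_union (subset_insert _ _) (subset_insert _ _)
  · simp only [if_neg fun h' ↦ hKT.le_bot ⟨hk, h'⟩]
    exact (hK k hk).image some

/-- If `e` is a joint, then the 2-sum is framed. -/
theorem isFramed_of_joint (h : IsLineSum M M₀ e T) {K : Set α} (hM₀ : M₀.IsFramed (insert e K))
    (hKT : Disjoint K T) : M.IsFramed K := by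
  classical
  obtain ⟨V, S, hS, hK⟩ := hM₀
  by_cases hT : ∃ t₀, t₀ ∈ T
  · obtain ⟨t₀, ht₀⟩ := hT
    -- One line element becomes a loop at the new vertex and the others are links to the vertex of
    -- `e`; only one may be a loop, as any two must cover that vertex.
    refine h.isFramed hS (fun t ↦ if t = t₀ then ∅ else S e) ?_ ?_ ?_ hKT
      fun k hk ↦ hK k (Or.inr hk)
    · intro t ht
      split_ifs
      · exact empty_subset _
      · exact Subset.rfl
    · intro t ht
      split_ifs
      · exact subsingleton_empty
      · exact hK e (Or.inl rfl)
    · intro s hs t ht hst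
      by_cases hs0 : s = t₀
      · have : t ≠ t₀ := fun h ↦ hst (hs0.trans h.symm)
        simp [this]
      · simp [hs0]
  · push Not at hT
    exact h.isFramed hS (fun _ ↦ ∅) (by simp) (by simp) (fun s hs ↦ (hT s hs).elim) hKT
      fun k hk ↦ hK k (Or.inr hk)

/-- A series extension of a framed matroid is framed. -/
theorem isFramed_of_pair (h : IsLineSum M M₀ e {s, t}) {K : Set α} (hM₀ : M₀.IsFramed K)
    (hKT : Disjoint K {s, t}) : M.IsFramed K := by
  classical
  obtain ⟨V, S, hS, hK⟩ := hM₀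
  obtain ⟨A, B, hA, hB, hAB⟩ : ∃ A B : Set V, A.Subsingleton ∧ B.Subsingleton ∧ S e = A ∪ B := by
    by_cases h1 : (S e).Subsingleton
    · exact ⟨S e, ∅, h1, subsingleton_empty, by simp⟩
    · rw [not_subsingleton_iff] at h1
      obtain ⟨x, hx, y, hy, hxy⟩ := h1
      exact ⟨{x}, {y}, subsingleton_singleton, subsingleton_singleton,
        subset_pair_of_encard_le_two (hS.encard_le e h.mem_ground) hx hy hxy⟩
  -- The edge `e` is subdivided at the new vertex: `s` is attached to one end and `t` to the other.
  refine h.isFramed hS (fun z ↦ if z = s then A else B) ?_ ?_ ?_ hKT hK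
  · intro t ht
    rw [hAB]
    split_ifs
    · exact subset_union_left
    · exact subset_union_right
  · intro t ht
    split_ifs <;> assumption
  · rintro p hp q hq hpq
    rw [hAB]
    by_cases hps : p = s
    · have hqs : q ≠ s := fun h' ↦ hpq (hps.trans h'.symm)
      simp [hps, hqs]
    · have hqs : q = s := by
        obtain rfl | rfl := hp
        · exact (hps rfl).elim
        · obtain rfl | rfl := hq
          · rfl
          · exact (hpq rfl).elim
      rw [if_neg hps, if_pos hqs, union_comm]

end IsLineSum

end Matroid

/-! ## From a 2-sum with `U_{2,4}` to a joint -/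

namespace Matroid

variable {α : Type u} {β : Type v} {M M₀ : Matroid α} {P : Matroid β} {f : α → β} {B : Set β}
  {T : Set α} {e : α}

/-- An independent set with no more elements than vertices has full rank on its vertices, so it
spans each of them. -/
theorem IsFrameExtension.mem_closure_of_encard_eq (hE : IsFrameExtension M P f B) {I : Set α}
    (hI : M.Indep I) (hIf : I.Finite)
    (h : (supp (fun x ↦ P.coords B (f x)) I).encard ≤ I.encard) {z : β}
    (hz : z ∈ supp (fun x ↦ P.coords B (f x)) I) : z ∈ P.closure (f '' I) := by
  have hB := hE.isBase.indep
  have hVB := IsFrameExtension.supp_subset P f B I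
  by_contra hcon
  have h1 := hE.isPullbackOn.indep hI
  have h2 : P.Indep (insert z (f '' I)) :=
    (h1.2.notMem_closure_iff (hB.subset_ground (hVB hz))).1 hcon |>.1
  have hzI : z ∉ f '' I := fun h' ↦ hcon (P.mem_closure_of_mem' h' (hB.subset_ground (hVB hz)))
  have h3 := h2.encard_le_eRk_of_subset (X := P.closure (supp (fun x ↦ P.coords B (f x)) I))
    (insert_subset (P.mem_closure_of_mem' hz (hB.subset_ground (hVB hz)))
      (hE.image_subset_closure_supp hI.subset_ground))
  rw [eRk_closure_eq, (hB.subset hVB).eRk_eq_encard, encard_insert_of_notMem hzI,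
    h1.1.encard_image] at h3
  have h4 := h3.trans h
  rw [← hIf.cast_ncard_eq] at h4
  norm_cast at h4
  omega

theorem encard_le_encard_image_update_add_one {V : Type*} [DecidableEq V] (u v : V) (W : Set V) :
    W.encard ≤ (Function.update id v u '' W).encard + 1 := by
  refine (encard_le_encard (t := insert v (Function.update id v u '' W)) fun z hz ↦ ?_).trans
    (encard_insert_le _ _)
  by_cases h : z = v
  · exact Or.inl h
  · exact Or.inr ⟨z, hz, by simp [h]⟩

theorem injOn_update_id {V : Type*} [DecidableEq V] {u v : V} {W : Set V} (h : u ∈ W → v ∉ W) :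
    InjOn (Function.update id v u) W := by
  intro x hx y hy hxy
  simp only [Function.update_apply, id] at hxy
  split_ifs at hxy with h1 h2 h2
  · rw [h1, h2]
  · exact (h (hxy ▸ hy) (h1 ▸ hx)).elim
  · exact (h (hxy ▸ hx) (h2 ▸ hy)).elim
  · exact hxy

namespace IsLineSum

section Triangle

variable {a b c : α} {u v w : β}

/-- The frame map obtained from a triangle `a = uv`, `b = vw`, `c = uw` by identifying `v` with `u`
and making `e` a joint at `w`. -/
def triangleMap [DecidableEq α] [DecidableEq β] (P : Matroid β) (B : Set β) (f : α → β)
    (e : α) (u v w : β) : α → Set β :=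
  Function.update (fun x ↦ Function.update id v u '' P.coords B (f x)) e {w}

/-- In the frame extension `P` of the 2-sum `M`, three elements of the line form a triangle on `u`,
`v`, `w`, and `w` is not spanned by the elements of `M₀` other than `e`. -/
structure IsTriangle (M M₀ : Matroid α) (e : α) (T : Set α) (P : Matroid β) (f : α → β)
    (B : Set β) (a b c : α) (u v w : β) : Prop where
  lineSum : IsLineSum M M₀ e T
  ext : IsFrameExtension M P f B
  ha : a ∈ T
  hb : b ∈ T
  hc : c ∈ T
  hab : a ≠ b
  hac : a ≠ c
  hbc : b ≠ c
  huv : u ≠ v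
  huw : u ≠ w
  hvw : v ≠ w
  coords_a : P.coords B (f a) = {u, v}
  coords_b : P.coords B (f b) = {v, w}
  coords_c : P.coords B (f c) = {u, w}
  hw : w ∉ P.closure (f '' (M₀.E \ {e}))


theorem mem_image_update_id_iff {V : Type*} [DecidableEq V] {u v z : V} {W : Set V} (hu : z ≠ u)
    (hv : z ≠ v) : z ∈ Function.update id v u '' W ↔ z ∈ W := by
  simp only [mem_image, Function.update_apply, id]
  constructor
  · rintro ⟨x, hx, h⟩
    split_ifs at h
    · exact (hu h.symm).elim
    · exact h ▸ hx
  · exact fun h ↦ ⟨z, h, by simp [hv]⟩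

theorem mem_image_update_id_iff_left {V : Type*} [DecidableEq V] {u v : V} {W : Set V} :
    u ∈ Function.update id v u '' W ↔ u ∈ W ∨ v ∈ W := by
  simp only [mem_image, Function.update_apply, id]
  constructor
  · rintro ⟨x, hx, h⟩
    split_ifs at h with h'
    · exact Or.inr (h' ▸ hx)
    · exact Or.inl (h ▸ hx)
  · rintro (h | h)
    · exact ⟨u, h, by simp⟩
    · exact ⟨v, h, by simp⟩

namespace IsTriangle

/-- The set `Y` does not span `a`, while `u` and `v` together do. -/
theorem notMem_closure (h : IsTriangle M M₀ e T P f B a b c u v w) {Y : Set α}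
    (hY : Y ⊆ M₀.E \ {e}) (hu : u ∈ P.closure (f '' Y)) : v ∉ P.closure (f '' Y) := by
  intro hv
  refine h.lineSum.notMem_closure h.ha hY ?_
  have haE := h.lineSum.mem_ground_of_mem h.ha
  rw [h.ext.isPullbackOn a haE Y (hY.trans h.lineSum.subset_ground)]
  exact P.closure_subset_closure_of_subset_closure (pair_subset hu hv)
    ((h.ext.mem_closure_iff haE (h.coords_a ▸ sep_subset _ _)).2 h.coords_a.subset)

/-- If `Y ∪ Z` spanned `e`, then `Y`, `Z` and `a` would span `c`, and hence `w` modulo `u`. Since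
`w` and the vertices of `Y` are disjoint from `u`, `v` and the vertices of `Z`, skewness would leave
`w` spanned by `Y` alone, against `hw`. -/
theorem notMem_closure_union (h : IsTriangle M M₀ e T P f B a b c u v w) {Y Z : Set α}
    (hY : Y ⊆ M₀.E \ {e}) (hZ : Z ⊆ M₀.E \ {e})
    (hd : Disjoint (supp (fun x ↦ P.coords B (f x)) Y) (supp (fun x ↦ P.coords B (f x)) Z))
    (hu : u ∉ supp (fun x ↦ P.coords B (f x)) Y) (hv : v ∉ supp (fun x ↦ P.coords B (f x)) Y)
    (hw : w ∉ supp (fun x ↦ P.coords B (f x)) Z) : e ∉ M₀.closure (Y ∪ Z) := by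
  set S := fun x ↦ P.coords B (f x) with hS
  intro he
  have hB := h.ext.isBase.indep
  have haE := h.lineSum.mem_ground_of_mem h.ha
  have hcE := h.lineSum.mem_ground_of_mem h.hc
  have hYM := hY.trans h.lineSum.subset_ground
  have hZM := hZ.trans h.lineSum.subset_ground
  have huvB : {u, v} ⊆ B := h.coords_a ▸ sep_subset _ _
  have huwB : {u, w} ⊆ B := h.coords_c ▸ sep_subset _ _
  have hYB : supp S Y ⊆ B := IsFrameExtension.supp_subset _ _ _ _
  have hZB : supp S Z ⊆ B := IsFrameExtension.supp_subset _ _ _ _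
  have hwB : w ∈ B := huwB (Or.inr rfl)
  rw [← h.lineSum.mem_closure_insert_iff h.hc h.ha h.hac.symm (union_subset hY hZ),
    h.ext.isPullbackOn c hcE _ (insert_subset haE (union_subset hYM hZM))] at he
  refine h.hw (P.closure_subset_closure (image_mono hY) ?_)
  have hac : f c ∈ P.closure (f '' Y ∪ (supp S Z ∪ {u, v})) := by
    refine P.closure_subset_closure_of_subset_closure ?_ he
    rw [image_insert_eq, image_union]
    refine insert_subset (P.closure_subset_closure ?_
      ((h.ext.mem_closure_iff haE huvB).2 h.coords_a.subset)) (union_subset ?_ ?_)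
    · exact subset_union_right.trans subset_union_right
    · refine (P.subset_closure _ ?_).trans (P.closure_subset_closure subset_union_left)
      rintro _ ⟨y, hy, rfl⟩
      exact h.ext.mem_ground (hYM hy)
    · exact (h.ext.image_subset_closure_supp hZM).trans
        (P.closure_subset_closure (subset_union_left.trans subset_union_right))
  refine Indep.mem_closure_of_mem_closure_union (D₁ := insert w (supp S Y))
    (D₂ := supp S Z ∪ {u, v}) (hB.subset ?_) ?_ ?_ ?_ ?_
  · exact union_subset (insert_subset hwB hYB) (union_subset hZB huvB)
  · rw [disjoint_left]
    rintro z (rfl | hz) (hz' | rfl | rfl)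
    · exact hw hz'
    · exact h.huw rfl
    · exact h.hvw rfl
    · exact hd.le_bot ⟨hz, hz'⟩
    · exact hu hz
    · exact hv hz
  · exact (h.ext.image_subset_closure_supp hYM).trans
      (P.closure_subset_closure (subset_insert _ _))
  · exact P.mem_closure_of_mem' (mem_insert _ _) (hB.subset_ground hwB)
  · have huE : u ∈ P.E := hB.subset_ground (huwB (Or.inl rfl))
    have hcu : f c ∈ P.closure (insert w {u}) := by
      rw [pair_comm, h.ext.mem_closure_iff hcE huwB, h.coords_c]
    have hcu' : f c ∉ P.closure {u} := by
      rw [h.ext.mem_closure_iff hcE ((singleton_subset_iff.2 (huwB (Or.inl rfl)))), h.coords_c]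
      exact fun h' ↦ h.huw (h' (Or.inr rfl)).symm
    refine P.closure_subset_closure_of_subset_closure ?_ (closure_exchange ⟨hcu, hcu'⟩).1
    exact insert_subset hac (singleton_subset_iff.2 (P.mem_closure_of_mem'
      (Or.inr (Or.inr (Or.inl rfl))) huE))

/-- Identifying `u` and `v` costs a vertex only if `I` uses both. It cannot span both, so then it
has a vertex to spare. -/
theorem encard_le_of_indep_of_subset [DecidableEq β] [M.Finite]
    (h : IsTriangle M M₀ e T P f B a b c u v w) {I : Set α}
    (hIX : I ⊆ M₀.E \ {e}) (hI : M.Indep I) :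
    I.encard ≤ (Function.update id v u '' supp (fun x ↦ P.coords B (f x)) I).encard := by
  set W := supp (fun x ↦ P.coords B (f x)) I with hW
  have h1 := h.ext.isFrameMap.encard_le_of_indep I hI
  by_cases h2 : u ∈ W ∧ v ∈ W
  · have hIf := M.ground_finite.subset hI.subset_ground
    have hlt : I.encard < W.encard := by
      refine lt_of_le_of_ne h1 fun heq ↦ ?_
      exact h.notMem_closure hIX (h.ext.mem_closure_of_encard_eq hI hIf heq.symm.le h2.1)
        (h.ext.mem_closure_of_encard_eq hI hIf heq.symm.le h2.2)
    exact (ENat.add_le_add_iff_right (k := 1) (by simp)).1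
      ((Order.add_one_le_of_lt hlt).trans (encard_le_encard_image_update_add_one u v W))
  · rwa [(injOn_update_id fun hu hv ↦ h2 ⟨hu, hv⟩).encard_image]

variable [DecidableEq α] [DecidableEq β]

theorem encard_le (h : IsTriangle M M₀ e T P f B a b c u v w) {x : α} (hx : x ∈ M₀.E) :
    (triangleMap P B f e u v w x).encard ≤ 2 := by
  by_cases hxe : x = e
  · rw [hxe, triangleMap, Function.update_self, encard_singleton]
    norm_num
  · rw [triangleMap, Function.update_of_ne hxe]
    exact (encard_image_le _ _).trans
      (h.ext.isFrameMap.encard_le x (h.lineSum.subset_ground ⟨hx, hxe⟩))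

theorem supp_triangleMap {Y : Set α} (hY : e ∉ Y) : supp (triangleMap P B f e u v w) Y =
    Function.update id v u '' supp (fun x ↦ P.coords B (f x)) Y := by
  rw [supp, supp, image_iUnion₂]
  refine iUnion₂_congr fun x hx ↦ ?_
  rw [triangleMap, Function.update_of_ne]
  rintro rfl
  exact hY hx

/-- If `w` is not used by `Y`, it pays for the joint `e`. If it is, `Y` has a vertex to spare
because it does not span `w`; when `u` and `v` are used as well, a second spare vertex is needed to
pay for their identification. -/
theorem encard_le_supp [M.Finite] (h : IsTriangle M M₀ e T P f B a b c u v w) {I : Set α}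
    (hI : M₀.Indep I) : I.encard ≤ (supp (triangleMap P B f e u v w) I).encard := by
  by_cases heI : e ∈ I
  swap
  · have hIX : I ⊆ M₀.E \ {e} := subset_sdiff_singleton hI.subset_ground heI
    rw [supp_triangleMap heI]
    exact h.encard_le_of_indep_of_subset hIX ((h.lineSum.indep_iff_of_subset hIX).2 hI)
  obtain ⟨Y, heY, rfl⟩ : ∃ Y, e ∉ Y ∧ I = insert e Y :=
    ⟨I \ {e}, by simp, by rw [insert_sdiff_singleton, insert_eq_of_mem heI]⟩
  have hYX : Y ⊆ M₀.E \ {e} :=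
    subset_sdiff_singleton ((subset_insert _ _).trans hI.subset_ground) heY
  have hYi : M.Indep Y := (h.lineSum.indep_iff_of_subset hYX).2 (hI.subset (subset_insert _ _))
  have hYf := M.ground_finite.subset hYi.subset_ground
  set W := supp (fun x ↦ P.coords B (f x)) Y with hW
  rw [supp_insert, supp_triangleMap heY, encard_insert_of_notMem heY, triangleMap,
    Function.update_self, singleton_union, ← hW]
  have hwW : w ∈ Function.update id v u '' W ↔ w ∈ W :=
    mem_image_update_id_iff h.huw.symm h.hvw.symm
  by_cases hw : w ∈ W
  swap
  · rw [encard_insert_of_notMem (mt hwW.1 hw)]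
    gcongr
    exact h.encard_le_of_indep_of_subset hYX hYi
  rw [insert_eq_of_mem (hwW.2 hw)]
  by_cases h2 : u ∈ W ∧ v ∈ W
  -- Since `Y` does not span `e`, adding `b` and `c` keeps independence, and they use no vertex
  -- outside `W`. So `W` exceeds `Y` by at least two.
  · have hbcY : M.Indep (insert c (insert b Y)) := by
      have hbY : M.Indep (insert b Y) :=
        ((hYi.notMem_closure_iff (h.lineSum.mem_ground_of_mem h.hb)).1
          (h.lineSum.notMem_closure h.hb hYX)).1
      refine ((hbY.notMem_closure_iff (h.lineSum.mem_ground_of_mem h.hc)).1 fun hcon ↦ ?_).1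
      rw [h.lineSum.mem_closure_insert_iff h.hc h.hb h.hbc.symm hYX] at hcon
      have := hI.notMem_closure_sdiff_of_mem (mem_insert e Y)
      rw [insert_sdiff_self_of_notMem heY] at this
      exact this hcon
    have h3 := h.ext.isFrameMap.encard_le_of_indep _ hbcY
    rw [supp_insert, supp_insert, ← hW, h.coords_b, h.coords_c, encard_insert_of_notMem,
      encard_insert_of_notMem (h.lineSum.notMem_of_subset hYX h.hb),
      union_eq_self_of_subset_left (s := {v, w}) (pair_subset h2.2 hw),
      union_eq_self_of_subset_left (pair_subset h2.1 hw)] at h3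
    · exact (ENat.add_le_add_iff_right (k := 1) (by simp)).1
        (h3.trans (encard_le_encard_image_update_add_one u v W))
    · rintro (h' | h')
      · exact h.hbc h'.symm
      · exact h.lineSum.notMem_of_subset hYX h.hc h'
  · rw [(injOn_update_id fun hu hv ↦ h2 ⟨hu, hv⟩).encard_image]
    refine Order.add_one_le_of_lt (lt_of_le_of_ne (h.ext.isFrameMap.encard_le_of_indep Y hYi) ?_)
    intro heq
    exact h.hw (P.closure_subset_closure (image_mono hYX)
      (h.ext.mem_closure_of_encard_eq hYi hYf heq.symm.le hw))

theorem triangleMap_self : triangleMap P B f e u v w e = {w} := Function.update_self _ _ _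

theorem triangleMap_of_ne {x : α} (hx : x ≠ e) :
    triangleMap P B f e u v w x = Function.update id v u '' P.coords B (f x) :=
  Function.update_of_ne hx _ _

theorem mem_triangleMap {x : α} (hx : x ≠ e) {z : β} (hz : z ∈ P.coords B (f x)) :
    Function.update id v u z ∈ triangleMap P B f e u v w x :=
  triangleMap_of_ne (P := P) hx ▸ mem_image_of_mem _ hz

theorem left_mem_triangleMap {x : α} (hx : x ≠ e) (h : u ∈ P.coords B (f x) ∨ v ∈ P.coords B (f x)) :
    u ∈ triangleMap P B f e u v w x := by
  rw [triangleMap_of_ne hx]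
  exact mem_image_update_id_iff_left.2 h

/-- A part `Z` separated from the rest avoids `w`, where `e` sits. If it uses `u` or `v`, the rest
avoids both, and `notMem_closure_union` says that `C \ {e}` does not span `e`. If it avoids the
whole triangle, it is already separated in the circuit of `M` obtained by replacing `e` with `a` and
`b`. -/
theorem exists_inter_nonempty (h : IsTriangle M M₀ e T P f B a b c u v w) {C Z : Set α}
    (hC : M₀.IsCircuit C) (heC : e ∈ C) (hZ : Z ⊆ C \ {e}) (hne : Z.Nonempty) :
    ∃ x ∈ Z, ∃ y ∈ C \ Z,
      (triangleMap P B f e u v w x ∩ triangleMap P B f e u v w y).Nonempty := by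
  by_contra! hcon
  have hno : ∀ x ∈ Z, ∀ y ∈ C \ Z, ∀ z, z ∈ triangleMap P B f e u v w x →
      z ∉ triangleMap P B f e u v w y :=
    fun x hx y hy z hz hz' ↦ (hcon x hx y hy).subset ⟨hz, hz'⟩
  set S := fun x ↦ P.coords B (f x) with hS
  have hCX : C \ {e} ⊆ M₀.E \ {e} := sdiff_subset_sdiff_left hC.subset_ground
  have heZ : e ∈ C \ Z := ⟨heC, fun h' ↦ (hZ h').2 rfl⟩
  have hwZ : ∀ x ∈ Z, w ∉ S x := fun x hx hw ↦ by
    refine hno x hx e heZ w ?_ (triangleMap_self (f := f) (u := u) (v := v) ▸ rfl)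
    have := mem_triangleMap (u := u) (v := v) (w := w) (hZ hx).2 hw
    rwa [Function.update_of_ne h.hvw.symm] at this
  have hsh : ∀ x ∈ Z, ∀ y ∈ C \ Z, y ≠ e → ∀ z, z ∈ S x → z ∉ S y := fun x hx y hy hye z hz hz' ↦
    hno x hx y hy _ (mem_triangleMap (hZ hx).2 hz) (mem_triangleMap hye hz')
  by_cases huv : ∃ x ∈ Z, u ∈ S x ∨ v ∈ S x
  · obtain ⟨x, hx, hux⟩ := huv
    have huv' : ∀ y ∈ (C \ {e}) \ Z, ¬ (u ∈ S y ∨ v ∈ S y) := fun y hy hy' ↦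
      hno x hx y ⟨hy.1.1, hy.2⟩ u (left_mem_triangleMap (hZ hx).2 hux)
        (left_mem_triangleMap hy.1.2 hy')
    refine h.notMem_closure_union (Y := (C \ {e}) \ Z) (sdiff_subset.trans hCX) (hZ.trans hCX)
      ?_ ?_ ?_ ?_ ?_
    · rw [disjoint_left]
      intro z hz hz'
      obtain ⟨y, hy, hyz⟩ := mem_supp.1 hz
      obtain ⟨x, hx, hxz⟩ := mem_supp.1 hz'
      exact hsh x hx y ⟨hy.1.1, hy.2⟩ hy.1.2 z hxz hyz
    · exact fun hz ↦ let ⟨y, hy, hyz⟩ := mem_supp.1 hz; huv' y hy (Or.inl hyz)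
    · exact fun hz ↦ let ⟨y, hy, hyz⟩ := mem_supp.1 hz; huv' y hy (Or.inr hyz)
    · exact fun hz ↦ let ⟨y, hy, hyz⟩ := mem_supp.1 hz; hwZ y hy hyz
    · rw [sdiff_union_of_subset hZ]
      exact hC.mem_closure_sdiff_singleton_of_mem heC
  · push Not at huv
    obtain ⟨x, hx, y, ⟨hy, hyZ⟩, z, hxz, hyz⟩ := h.ext.isFrameMap.connected _
      (h.lineSum.isCircuit_of_pair h.ha h.hb h.hab hC heC) Z (hZ.trans subset_union_left) hne
      (by
        rintro rfl
        exact h.lineSum.notMem_of_subset (hZ.trans hCX) h.ha (Or.inr (Or.inl rfl)))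
    obtain hy | rfl | rfl := hy
    · exact hsh x hx y ⟨hy.1, hyZ⟩ hy.2 z hxz hyz
    · rw [h.coords_a] at hyz
      obtain rfl | rfl := hyz
      · exact (huv x hx).1 hxz
      · exact (huv x hx).2 hxz
    · rw [h.coords_b] at hyz
      obtain rfl | rfl := hyz
      · exact (huv x hx).2 hxz
      · exact hwZ x hx hxz

theorem connected (h : IsTriangle M M₀ e T P f B a b c u v w) {C Z : Set α}
    (hC : M₀.IsCircuit C) (hZ : Z ⊆ C) (hne : Z.Nonempty) (hZC : Z ≠ C) :
    ∃ x ∈ Z, ∃ y ∈ C \ Z,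
      (triangleMap P B f e u v w x ∩ triangleMap P B f e u v w y).Nonempty := by
  by_cases heC : e ∈ C
  · by_cases heZ : e ∈ Z
    · obtain ⟨x, hx, y, hy, hxy⟩ := h.exists_inter_nonempty hC heC (Z := C \ Z)
        (sdiff_subset_sdiff_right (singleton_subset_iff.2 heZ))
        (sdiff_nonempty.2 fun h' ↦ hZC (hZ.antisymm h'))
      rw [sdiff_sdiff_cancel_left hZ] at hy
      exact ⟨y, hy, x, hx, by rwa [inter_comm]⟩
    · exact h.exists_inter_nonempty hC heC (subset_sdiff_singleton hZ heZ) hne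
  · have hCX : C ⊆ M₀.E \ {e} := subset_sdiff_singleton hC.subset_ground heC
    obtain ⟨x, hx, y, hy, z, hz⟩ := h.ext.isFrameMap.connected C
      ((h.lineSum.isCircuit_iff_of_subset hCX).2 hC) Z hZ hne hZC
    exact ⟨x, hx, y, hy, _, mem_triangleMap (hCX (hZ hx)).2 hz.1, mem_triangleMap (hCX hy.1).2 hz.2⟩

/-- Replacing `e` by `a, b` or by `a, c` gives circuits of `M`. In the first, `u` lies on `a` but
not on `b`, so an element of `C \ {e}` uses `u`; in the second, one uses `v` in the same way.
Similarly `w` lies on `b` but not on `a`. -/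
theorem exists_ne (h : IsTriangle M M₀ e T P f B a b c u v w) {C : Set α} (hC : M₀.IsCircuit C)
    {x : α} (hx : x ∈ C) {q : β} (hq : q ∈ triangleMap P B f e u v w x) :
    ∃ y ∈ C, y ≠ x ∧ q ∈ triangleMap P B f e u v w y := by
  by_cases heC : e ∉ C
  · have hCX : C ⊆ M₀.E \ {e} := subset_sdiff_singleton hC.subset_ground heC
    rw [triangleMap_of_ne (hCX hx).2] at hq
    obtain ⟨z, hz, rfl⟩ := hq
    obtain ⟨y, hy, hyx, hz⟩ := h.ext.isFrameMap.exists_ne C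
      ((h.lineSum.isCircuit_iff_of_subset hCX).2 hC) x hx z hz
    exact ⟨y, hy, hyx, mem_triangleMap (hCX hy).2 hz⟩
  rw [not_not] at heC
  have hCT : ∀ y ∈ C, y ∉ T := fun y hy hyT ↦ h.lineSum.notMem_of_mem hyT (hC.subset_ground hy)
  have hab := h.ext.isFrameMap.exists_ne _ (h.lineSum.isCircuit_of_pair h.ha h.hb h.hab hC heC)
  have hac := h.ext.isFrameMap.exists_ne _ (h.lineSum.isCircuit_of_pair h.ha h.hc h.hac hC heC)
  by_cases hxe : x = e
  · subst hxe
    rw [triangleMap_self] at hq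
    obtain rfl := hq
    obtain ⟨y, hy, hyb, hyw⟩ := hab b (Or.inr (Or.inr rfl)) q (h.coords_b ▸ Or.inr rfl)
    obtain hy | rfl | rfl := hy
    · have := mem_triangleMap (e := x) (u := u) (v := v) (w := q) hy.2 hyw
      rw [Function.update_of_ne h.hvw.symm] at this
      exact ⟨y, hy.1, hy.2, this⟩
    · rw [h.coords_a] at hyw
      obtain rfl | rfl := hyw
      · exact (h.huw rfl).elim
      · exact (h.hvw rfl).elim
    · exact (hyb rfl).elim
  rw [triangleMap_of_ne hxe] at hq
  obtain ⟨z, hz, rfl⟩ := hq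
  by_cases hzu : z = u ∨ z = v
  · have hqu : Function.update id v u z = u := by
      obtain rfl | rfl := hzu
      · simp [Function.update_apply]
      · simp
    rw [hqu]
    obtain ⟨y, hy, hya, hyu⟩ := hab a (Or.inr (Or.inl rfl)) u (h.coords_a ▸ Or.inl rfl)
    obtain ⟨y', hy', hya', hyv⟩ := hac a (Or.inr (Or.inl rfl)) v (h.coords_a ▸ Or.inr rfl)
    obtain hy | rfl | rfl := hy
    · by_cases hyx : y = x
      · obtain hy' | rfl | rfl := hy'
        · by_cases hyx' : y' = x
          · subst hyx hyx'
            -- When both witnesses are `x` itself, `x` is parallel to the edge `uv` in the graph and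
            -- becomes a loop; connectedness of `C` gives another element at that vertex.
            have hSx : P.coords B (f y') = {u, v} := subset_pair_of_encard_le_two
              (h.ext.isFrameMap.encard_le y' (h.lineSum.subset_ground ⟨hC.subset_ground hx, hxe⟩))
              hyu hyv h.huv
            obtain ⟨p, rfl, y, hy, t, ht, ht'⟩ := h.connected hC (singleton_subset_iff.2 hx)
              (singleton_nonempty _) (fun h' ↦ hxe (h'.symm.subset heC).symm)
            rw [triangleMap_of_ne hxe, hSx, image_pair] at ht
            have htu : t = u := by
              obtain rfl | rfl := ht
              · simp [Function.update_apply]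
              · simp
            exact ⟨y, hy.1, hy.2, htu ▸ ht'⟩
          · exact ⟨y', hy'.1, hyx', left_mem_triangleMap hy'.2 (Or.inr hyv)⟩
        · exact (hya' rfl).elim
        · rw [h.coords_c] at hyv
          obtain h' | h' := hyv
          · exact (h.huv h'.symm).elim
          · exact (h.hvw h').elim
      · exact ⟨y, hy.1, hyx, left_mem_triangleMap hy.2 (Or.inl hyu)⟩
    · exact (hya rfl).elim
    · rw [h.coords_b] at hyu
      obtain h' | h' := hyu
      · exact (h.huv h').elim
      · exact (h.huw h').elim
  · push Not at hzu
    rw [Function.update_of_ne hzu.2, id]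
    obtain ⟨y, hy, hyx, hyz⟩ := hab x (Or.inl ⟨hx, hxe⟩) z hz
    obtain hy | rfl | rfl := hy
    · have := mem_triangleMap (e := e) (u := u) (v := v) (w := w) hy.2 hyz
      rw [Function.update_of_ne hzu.2, id] at this
      exact ⟨y, hy.1, hyx, this⟩
    · rw [h.coords_a] at hyz
      exact (not_or.2 hzu hyz).elim
    · rw [h.coords_b] at hyz
      obtain h' | h' := hyz
      · exact (hzu.2 h').elim
      · exact ⟨e, heC, Ne.symm hxe, by rw [triangleMap_self]; exact h'⟩

theorem isFrameMap [M.Finite] (h : IsTriangle M M₀ e T P f B a b c u v w) :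
    M₀.IsFrameMap (triangleMap P B f e u v w) :=
  ⟨fun _ hx ↦ h.encard_le hx, fun _ hI ↦ h.encard_le_supp hI, fun _ hC _ hx _ hq ↦
    h.exists_ne hC hx hq, fun _ hC _ hZ hne hZC ↦ h.connected hC hZ hne hZC⟩

end IsTriangle

end Triangle

theorem finite [M.Finite] (h : IsLineSum M M₀ e T) : M₀.Finite := by
  refine ⟨((M.ground_finite.subset h.subset_ground).insert e).subset ?_⟩
  rw [insert_sdiff_singleton]
  exact subset_insert _ _

/-- If the line of the 2-sum is spanned by two frame elements `u` and `v`, then contracting `v`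
turns `e` into a joint. -/
theorem isFramed_insert_of_subset_closure [M.Finite] (h : IsLineSum M M₀ e T)
    (hE : IsFrameExtension M P f B) {K : Set α} (hKX : K ⊆ M₀.E \ {e})
    (hK : ∀ k ∈ K, ∃ D ⊆ B, D.Subsingleton ∧ f k ∈ P.closure D) {a b : α} {u v : β}
    (ha : a ∈ T) (hb : b ∈ T) (hab : a ≠ b) (hu : u ∈ B) (hv : v ∈ B) (huv : u ≠ v)
    (huT : u ∈ P.closure {f a, f b}) (hvT : v ∈ P.closure {f a, f b})
    (haD : f a ∈ P.closure {u, v}) (hbD : f b ∈ P.closure {u, v})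
    (hvX : v ∉ P.closure (f '' (M₀.E \ {e}))) : M₀.IsFramed (insert e K) := by
  classical
  have := h.finite
  have hB := hE.isBase.indep
  have hBE := hB.subset_ground
  have hvE := hBE hv
  have hXM := h.subset_ground
  have haM := h.mem_ground_of_mem ha
  have hbM := h.mem_ground_of_mem hb
  have hfX : ∀ x ∈ M₀.E \ {e}, f x ≠ v := fun x hx hxv ↦ hvX
    (P.mem_closure_of_mem' ⟨x, hx, hxv⟩ hvE)
  have hg : ∀ Y ⊆ M₀.E \ {e}, Function.update f e u '' Y = f '' Y := fun Y hY ↦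
    image_congr fun x hx ↦ Function.update_of_ne (hY hx).2 _ _
  have hfY : ∀ Y ⊆ M₀.E \ {e}, f '' Y ⊆ P.E := by
    rintro Y hY _ ⟨y, hy, rfl⟩
    exact hE.mem_ground (hXM (hY hy))
  have hvY : ∀ Y ⊆ M₀.E \ {e}, v ∉ P.closure (f '' Y) := fun Y hY hvY ↦
    hvX (P.closure_subset_closure (image_mono hY) hvY)
  -- The line is spanned by `a, b` and also by `u, v`. Neither `a` nor `v` is spanned by `Y`, so
  -- both sides say that the line has rank one modulo `Y`.
  have hkey : ∀ Y ⊆ M₀.E \ {e}, e ∈ M₀.closure Y ↔ u ∈ P.closure (insert v (f '' Y)) := by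
    intro Y hY
    have hYM := hY.trans hXM
    rw [← h.mem_closure_insert_iff hb ha hab.symm hY, hE.isPullbackOn b hbM _
      (insert_subset haM hYM), image_insert_eq]
    have haY : f a ∉ P.closure (f '' Y) := by
      rw [← hE.isPullbackOn a haM _ hYM]
      exact h.notMem_closure ha hY
    have hsub : ∀ z ∈ P.E, f '' Y ⊆ P.closure (insert z (f '' Y)) := fun z hz ↦
      (P.subset_closure _ (insert_subset hz (hfY Y hY))).trans' (subset_insert _ _)
    constructor
    · intro hbY
      have hvY' : v ∈ P.closure (insert (f a) (f '' Y)) := by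
        refine P.closure_subset_closure_of_subset_closure (pair_subset ?_ hbY) hvT
        exact P.mem_closure_of_mem' (mem_insert _ _) (hE.mem_ground haM)
      have huY : u ∈ P.closure (insert (f a) (f '' Y)) := by
        refine P.closure_subset_closure_of_subset_closure (pair_subset ?_ hbY) huT
        exact P.mem_closure_of_mem' (mem_insert _ _) (hE.mem_ground haM)
      refine P.closure_subset_closure_of_subset_closure (insert_subset ?_ (hsub v hvE)) huY
      exact (closure_exchange ⟨hvY', hvY Y hY⟩).1
    · intro huY
      have hvm : v ∈ P.closure (insert v (f '' Y)) := P.mem_closure_of_mem' (mem_insert _ _) hvE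
      have haY' : f a ∈ P.closure (insert v (f '' Y)) :=
        P.closure_subset_closure_of_subset_closure (pair_subset huY hvm) haD
      have hbY' : f b ∈ P.closure (insert v (f '' Y)) :=
        P.closure_subset_closure_of_subset_closure (pair_subset huY hvm) hbD
      refine P.closure_subset_closure_of_subset_closure (insert_subset ?_
        (hsub _ (hE.mem_ground haM))) hbY'
      exact (closure_exchange ⟨haY', haY⟩).1
  have hcl : ∀ D x, x ≠ v → (x ∈ (P ／ {v}).closure D ↔ x ∈ P.closure (insert v D)) := by
    intro D x hx
    rw [contract_closure_eq, union_singleton, mem_sdiff_singleton, and_iff_left hx]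
  have hpull : IsPullbackOn M₀ (P ／ {v}) (Function.update f e u) (insert e (M₀.E \ {e})) := by
    refine isPullbackOn_insert (fun x hx Y hY ↦ ?_) (fun Y hY ↦ ?_) h.mem_ground ?_
    · rw [hg Y hY, Function.update_of_ne hx.2, hcl _ _ (hfX x hx), ← h.mem_closure_iff hx hY,
        hE.isPullbackOn x (hXM hx) _ (hY.trans hXM)]
      -- Contracting `v` does not change spanning among the elements other than `e`, because they do
      -- not span `v`.
      refine ⟨fun h' ↦ P.closure_subset_closure (subset_insert _ _) h', fun h' ↦ ?_⟩
      by_contra hcon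
      have := (closure_exchange ⟨h', hcon⟩).1
      rw [← image_insert_eq] at this
      exact hvY _ (insert_subset hx hY) this
    · rw [hg Y hY, Function.update_self, hcl _ _ huv, hkey Y hY]
    · rw [Function.update_self]
      exact ⟨hBE hu, huv⟩
  rw [insert_sdiff_singleton, insert_eq_of_mem h.mem_ground] at hpull
  have hbase : (P ／ {v}).IsBase (B \ {v}) := by
    have hvi : P.Indep {v} := hB.subset (singleton_subset_iff.2 hv)
    rw [hvi.contract_isBase_iff, sdiff_union_of_subset (singleton_subset_iff.2 hv)]
    exact ⟨hE.isBase, disjoint_sdiff_left⟩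
  have hdown : ∀ x ∈ M₀.E \ {e}, ∀ D ⊆ B, f x ∈ P.closure D →
      Function.update f e u x ∈ (P ／ {v}).closure (D \ {v}) := by
    intro x hx D hD hxD
    rw [Function.update_of_ne hx.2, hcl _ _ (hfX x hx), insert_sdiff_singleton]
    exact P.closure_subset_closure (subset_insert _ _) hxD
  have heu : Function.update f e u e ∈ (P ／ {v}).closure {u} := by
    rw [Function.update_self]
    exact mem_closure_of_mem' _ rfl ⟨hBE hu, huv⟩
  have huB : {u} ⊆ B \ {v} := singleton_subset_iff.2 ⟨hu, huv⟩
  refine IsFrameExtension.isFramed (f := Function.update f e u) ⟨hbase, hpull, fun x hx ↦ ?_⟩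
    (insert_subset h.mem_ground (hKX.trans sdiff_subset)) ?_
  · by_cases hxe : x = e
    · exact ⟨{u}, huB, by rw [encard_singleton]; norm_num, hxe ▸ heu⟩
    · obtain ⟨D, hD, hD2, hxD⟩ := hE.exists_subset x (hXM ⟨hx, hxe⟩)
      exact ⟨D \ {v}, sdiff_subset_sdiff_left hD, (encard_le_encard sdiff_subset).trans hD2,
        hdown x ⟨hx, hxe⟩ D hD hxD⟩
  · rintro k (rfl | hk)
    · exact ⟨{u}, huB, subsingleton_singleton, heu⟩
    · obtain ⟨D, hD, hD1, hkD⟩ := hK k hk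
      exact ⟨D \ {v}, sdiff_subset_sdiff_left hD, hD1.anti sdiff_subset, hdown k (hKX hk) D hD hkD⟩

/-- Two line elements have rank two, so if they use at most two vertices they span both. The
elements other than `e` cannot span both vertices, as they do not span `a`; the one they miss is
contracted. -/
theorem isFramed_insert_of_encard_le [M.Finite] (h : IsLineSum M M₀ e T)
    (hE : IsFrameExtension M P f B) {K : Set α} (hKX : K ⊆ M₀.E \ {e})
    (hK : ∀ k ∈ K, ∃ D ⊆ B, D.Subsingleton ∧ f k ∈ P.closure D) {a b c : α}
    (ha : a ∈ T) (hb : b ∈ T) (hc : c ∈ T) (hab : a ≠ b) (hac : a ≠ c) (hbc : b ≠ c)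
    (hW : (supp (fun x ↦ P.coords B (f x)) {a, b}).encard ≤ 2) : M₀.IsFramed (insert e K) := by
  have haM := h.mem_ground_of_mem ha
  have hbM := h.mem_ground_of_mem hb
  have hi : M.Indep {a, b} := (h.isCircuit_of_triple ha hb hc hab hac hbc).ssubset_indep
    ⟨by rintro z (rfl | rfl) <;> simp, fun h' ↦ by
      obtain h' | h' := h' (Or.inr (Or.inr rfl) : c ∈ ({a, b, c} : Set α))
      · exact hac h'.symm
      · exact hbc h'.symm⟩
  have h2 := hE.isFrameMap.encard_le_of_indep _ hi
  rw [encard_pair hab] at h2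
  obtain ⟨u, v, hu, hv, huv⟩ := one_lt_encard_iff.1 (lt_of_lt_of_le (by norm_num) h2)
  have hWuv := subset_pair_of_encard_le_two hW hu hv huv
  have hWB := IsFrameExtension.supp_subset P f B {a, b}
  have hcl := fun z hz ↦ hE.mem_closure_of_encard_eq hi (toFinite _)
    (by rwa [encard_pair hab]) (z := z) hz
  rw [image_pair] at hcl
  have hD := hE.image_subset_closure_supp hi.subset_ground
  rw [image_pair, hWuv] at hD
  have haD := hD (Or.inl rfl)
  have hbD := hD (Or.inr rfl)
  by_cases hvX : v ∈ P.closure (f '' (M₀.E \ {e}))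
  · refine h.isFramed_insert_of_subset_closure hE hKX hK ha hb hab (hWB hv) (hWB hu) huv.symm
      (hcl v hv) (hcl u hu) (pair_comm u v ▸ haD) (pair_comm u v ▸ hbD) fun huX ↦ ?_
    refine h.notMem_closure ha Subset.rfl ?_
    rw [hE.isPullbackOn a haM _ h.subset_ground]
    exact P.closure_subset_closure_of_subset_closure (pair_subset huX hvX) haD
  · exact h.isFramed_insert_of_subset_closure hE hKX hK ha hb hab (hWB hu) (hWB hv) huv
      (hcl u hu) (hcl v hv) haD hbD hvX

theorem IsTriangle.isFramed_insert [M.Finite] {a b c : α} {u v w : β}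
    (h : IsTriangle M M₀ e T P f B a b c u v w) {K : Set α} (hKX : K ⊆ M₀.E \ {e})
    (hK : ∀ k ∈ K, ∃ D ⊆ B, D.Subsingleton ∧ f k ∈ P.closure D) : M₀.IsFramed (insert e K) := by
  classical
  have := h.lineSum.finite
  refine h.isFrameMap.isFramed ?_
  rintro k (rfl | hk)
  · rw [triangleMap_self]
    exact subsingleton_singleton
  · obtain ⟨D, hD, hD1, hkD⟩ := hK k hk
    rw [triangleMap_of_ne (hKX hk).2]
    exact (hD1.anti ((h.ext.mem_closure_iff (h.lineSum.subset_ground (hKX hk)) hD).1 hkD)).image _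

/-- If a 2-sum with `U_{2,4}` on `e` is framed, then so is the matroid with `e` as a joint. -/
theorem isFramed_insert [M.Finite] (h : IsLineSum M M₀ e T) {a b c : α} (ha : a ∈ T)
    (hb : b ∈ T) (hc : c ∈ T) (hab : a ≠ b) (hac : a ≠ c) (hbc : b ≠ c) {K : Set α}
    (hKX : K ⊆ M₀.E \ {e}) (hM : M.IsFramed K) : M₀.IsFramed (insert e K) := by
  obtain ⟨V, P, B, hE, hK⟩ := hM.exists_isFrameExtension (hKX.trans h.subset_ground)
  set B' : Set (α ⊕ V) := Sum.inr '' B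
  set S := fun x : α ↦ P.coords B' (Sum.inl x) with hS
  have hC := h.isCircuit_of_triple ha hb hc hab hac hbc
  have hex := hE.isFrameMap.exists_ne _ hC
  have hle : ∀ t ∈ T, (S t).encard ≤ 2 := fun t ht ↦
    hE.isFrameMap.encard_le t (h.mem_ground_of_mem ht)
  -- A vertex of a line element lies on at least two of the three, since the three form a circuit.
  have hcases : ∀ p q r, ({p, q, r} : Set α) = {a, b, c} → ∀ x ∈ S p, x ∉ S q → x ∈ S r := by
    intro p q r hpqr x hx hxq
    obtain ⟨g, hg, hgp, hxg⟩ := hex p (hpqr ▸ Or.inl rfl) x hx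
    rw [← hpqr] at hg
    obtain rfl | rfl | rfl := hg
    · exact (hgp rfl).elim
    · exact (hxq hxg).elim
    · exact hxg
  have hsub : ∀ p ∈ T, ∀ q ∈ T, ∀ r ∈ T, p ≠ q → p ≠ r → q ≠ r → S p ⊆ S q →
      M₀.IsFramed (insert e K) := by
    intro p hp q hq r hr hpq hpr hqr hpqS
    refine h.isFramed_insert_of_encard_le hE hKX hK hp hq hr hpq hpr hqr ?_
    rw [supp_insert, supp_singleton]
    exact (encard_le_encard (union_subset hpqS Subset.rfl)).trans (hle q hq)
  by_cases h1 : S a ⊆ S b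
  · exact hsub a ha b hb c hc hab hac hbc h1
  by_cases h2 : S b ⊆ S c
  · exact hsub b hb c hc a ha hbc hab.symm hac.symm h2
  by_cases h3 : S c ⊆ S a
  · exact hsub c hc a ha b hb hac.symm hbc.symm hab h3
  -- No support contains the next one cyclically, and each element has at most two vertices: this
  -- forces a triangle.
  obtain ⟨u, hua, hub⟩ := not_subset.1 h1
  obtain ⟨v, hvb, hvc⟩ := not_subset.1 h2
  obtain ⟨w, hwc, hwa⟩ := not_subset.1 h3
  have huc := hcases a b c rfl u hua hub
  have hva := hcases b c a (by rw [pair_comm c a, insert_comm]) v hvb hvc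
  have hwb := hcases c a b (by rw [insert_comm, pair_comm c b]) w hwc hwa
  have huv : u ≠ v := fun h' ↦ hub (h' ▸ hvb)
  have hvw : v ≠ w := fun h' ↦ hvc (h' ▸ hwc)
  have huw : u ≠ w := fun h' ↦ hwa (h' ▸ hua)
  have hSa := subset_pair_of_encard_le_two (hle a ha) hua hva huv
  have hSb := subset_pair_of_encard_le_two (hle b hb) hvb hwb hvw
  have hSc := subset_pair_of_encard_le_two (hle c hc) huc hwc huw
  -- The corners `v` and `w` are not both spanned by the elements other than `e`, since they span
  -- `b`. The triangle is relabelled so that a missed corner is in the role of `w`.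
  by_cases hw : w ∈ P.closure (Sum.inl '' (M₀.E \ {e}))
  swap
  · exact IsTriangle.isFramed_insert ⟨h, hE, ha, hb, hc, hab, hac, hbc, huv, huw, hvw, hSa, hSb,
      hSc, hw⟩ hKX hK
  by_cases hv : v ∈ P.closure (Sum.inl '' (M₀.E \ {e}))
  swap
  · exact IsTriangle.isFramed_insert ⟨h, hE, hc, hb, ha, hbc.symm, hac.symm, hab.symm, huw, huv,
      hvw.symm, hSc, hSb.trans (pair_comm _ _), hSa, hv⟩ hKX hK
  refine (h.notMem_closure hb Subset.rfl ?_).elim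
  have hbM := h.mem_ground_of_mem hb
  rw [hE.isPullbackOn b hbM _ h.subset_ground]
  exact P.closure_subset_closure_of_subset_closure (pair_subset hv hw)
    ((hE.mem_closure_iff hbM (hSb ▸ sep_subset _ _)).2 hSb.subset)

end IsLineSum

end Matroid

/-! ## Minors of framed matroids -/

namespace Matroid

variable {α : Type u} {β : Type v} {M M' : Matroid α}

/-- Since `g` need not be injective, this covers restrictions, isomorphic copies and parallel
extensions at once. -/
theorem IsFramed.of_isPullbackOn {N : Matroid β} [M.Finite] [N.Finite] {K : Set α}
    (hM : M.IsFramed K) (hK : K ⊆ M.E) {g : β → α} (hg : IsPullbackOn N M g N.E)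
    (hgE : MapsTo g N.E M.E) {K' : Set β} (hK' : K' ⊆ N.E) (hKK' : MapsTo g K' K) :
    N.IsFramed K' := by
  obtain ⟨V, P, B, hE, hKP⟩ := hM.exists_isFrameExtension hK
  exact (hE.comp hg hgE).isFramed hK' fun k hk ↦ hKP (g k) (hKK' hk)

theorem isPullbackOn_delete (M : Matroid α) (D : Set α) : IsPullbackOn (M ＼ D) M id (M ＼ D).E := by
  intro x hx Y hY
  rw [image_id, delete_closure_eq, id, (subset_sdiff.1 hY).2.sdiff_eq_left, mem_sdiff,
    and_iff_left hx.2]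

theorem IsFramed.delete [M.Finite] {K D : Set α} (hM : M.IsFramed K) (hK : K ⊆ M.E \ D) :
    (M ＼ D).IsFramed K :=
  hM.of_isPullbackOn (hK.trans sdiff_subset) (isPullbackOn_delete M D)
    (fun x (hx : x ∈ (M ＼ D).E) ↦ hx.1) hK (mapsTo_id _)

/-- The extension is contracted by `x`, and a vertex `b` of `x` is dropped from the base. Modulo
`x`, that vertex is spanned by the other vertex of `x`, if there is one, so no element needs more
vertices than before. -/
theorem IsFramed.contractElem [M.Finite] {K : Set α} {x : α} (hM : M.IsFramed K)
    (hK : K ⊆ M.E \ {x}) : (M ／ {x}).IsFramed K := by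
  by_cases hx : M.IsNonloop x
  swap
  · rw [← contract_inter_ground_eq]
    by_cases hxE : x ∈ M.E
    · rw [inter_eq_left.2 (singleton_subset_iff.2 hxE), contract_eq_delete_of_subset_loops]
      · exact hM.delete hK
      · exact singleton_subset_iff.2 ((not_isNonloop_iff hxE).1 hx)
    · rw [singleton_inter_eq_empty.2 hxE, contract_empty]
      exact hM
  obtain ⟨V, P, B, hE, hKP⟩ := hM.exists_isFrameExtension (hK.trans sdiff_subset)
  set B' : Set (α ⊕ V) := Sum.inr '' B with hB'
  have hB := hE.isBase.indep
  obtain ⟨b, hb⟩ := hE.isFrameMap.nonempty hx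
  have hxP : Sum.inl x ∈ P.E := hE.mem_ground hx.mem_ground
  have hxB : Sum.inl x ∉ B' := by simp [hB']
  have hxi : P.Indep {Sum.inl x} := by
    have := (hE.isPullbackOn.indep hx.indep).2
    rwa [image_singleton] at this
  have hcl : ∀ D y, y ≠ Sum.inl x → (y ∈ (P ／ {Sum.inl x}).closure D ↔
      y ∈ P.closure (insert (Sum.inl x) D)) := by
    intro D y hy
    rw [contract_closure_eq, union_singleton, mem_sdiff_singleton, and_iff_left hy]
  have hSx : P.coords B' (Sum.inl x) ⊆ B' := sep_subset _ _
  have hbx : b ∈ P.closure (insert (Sum.inl x) (P.coords B' (Sum.inl x) \ {b})) := by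
    have h1 : Sum.inl x ∈ P.closure (insert b (P.coords B' (Sum.inl x) \ {b})) := by
      rw [insert_sdiff_singleton, insert_eq_of_mem hb, hE.mem_closure_iff hx.mem_ground hSx]
    have h2 : Sum.inl x ∉ P.closure (P.coords B' (Sum.inl x) \ {b}) := by
      rw [hE.mem_closure_iff hx.mem_ground (sdiff_subset.trans hSx)]
      exact fun h ↦ (h hb).2 rfl
    exact (closure_exchange ⟨h1, h2⟩).1
  have h1 : ∀ A : Set (α ⊕ V), b ∈ A → A.encard ≤ 2 → (A \ {b}).encard ≤ 1 := by
    intro A hA hA2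
    rw [← encard_sdiff_singleton_add_one hA] at hA2
    exact (ENat.add_le_add_iff_right (k := 1) (by simp)).1 (hA2.trans (by norm_num))
  have hSx1 := h1 _ hb (hE.isFrameMap.encard_le x hx.mem_ground)
  have hdown : ∀ y ∈ M.E, y ≠ x → ∀ D ⊆ B', b ∈ D → Sum.inl y ∈ P.closure D →
      Sum.inl y ∈ (P ／ {Sum.inl x}).closure ((D \ {b}) ∪ (P.coords B' (Sum.inl x) \ {b})) := by
    intro y hy hyx D hD hbD hyD
    rw [hcl _ _ fun h ↦ hyx (Sum.inl_injective h)]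
    refine P.closure_subset_closure_of_subset_closure (fun d hd ↦ ?_) hyD
    by_cases hdb : d = b
    · rw [hdb]
      exact P.closure_subset_closure (insert_subset_insert subset_union_right) hbx
    · exact P.mem_closure_of_mem' (Or.inr (Or.inl ⟨hd, hdb⟩)) (hB.subset_ground (hD hd))
  have hdown' : ∀ y ∈ M.E, y ≠ x → ∀ D, Sum.inl y ∈ P.closure D →
      Sum.inl y ∈ (P ／ {Sum.inl x}).closure D := by
    intro y hy hyx D hyD
    rw [hcl _ _ fun h ↦ hyx (Sum.inl_injective h)]
    exact P.closure_subset_closure (subset_insert _ _) hyD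
  refine IsFrameExtension.isFramed (P := P ／ {Sum.inl x}) (f := Sum.inl) (B := B' \ {b})
    ⟨?_, fun y hy Y hY ↦ ?_, fun y hy ↦ ?_⟩ hK fun k hk ↦ ?_
  · rw [hxi.contract_isBase_iff]
    refine ⟨?_, disjoint_singleton_right.2 fun h ↦ hxB h.1⟩
    have h1 : P.Indep (insert (Sum.inl x) (B' \ {b})) :=
      (((hB.subset sdiff_subset).notMem_closure_iff hxP).1 hb.2).1
    rw [union_singleton]
    exact hE.isBase.exchange_isBase_of_indep hxB h1
  · have hYE : Y ⊆ M.E := hY.trans sdiff_subset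
    rw [contract_closure_eq, union_singleton, mem_sdiff_singleton,
      and_iff_left (show y ≠ x from hy.2), hcl _ _ (fun h ↦ hy.2 (Sum.inl_injective h)),
      ← image_insert_eq]
    exact hE.isPullbackOn y hy.1 _ (insert_subset hx.mem_ground hYE)
  · obtain ⟨D, hD, hD2, hyD⟩ := hE.exists_subset y hy.1
    by_cases hbD : b ∈ D
    · refine ⟨_, union_subset (sdiff_subset_sdiff_left hD) (sdiff_subset_sdiff_left hSx),
        (encard_union_le _ _).trans ?_, hdown y hy.1 hy.2 D hD hbD hyD⟩
      calc _ ≤ (1 : ℕ∞) + 1 := add_le_add (h1 D hbD hD2) hSx1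
        _ = 2 := by norm_num
    · exact ⟨D, subset_sdiff_singleton hD hbD, hD2, hdown' y hy.1 hy.2 D hyD⟩
  · obtain ⟨D, hD, hD1, hkD⟩ := hKP k hk
    by_cases hbD : b ∈ D
    · obtain rfl := hD1.eq_singleton_of_mem hbD
      refine ⟨_, union_subset (sdiff_subset_sdiff_left hD) (sdiff_subset_sdiff_left hSx), ?_,
        hdown k (hK hk).1 (hK hk).2 _ hD hbD hkD⟩
      rw [sdiff_eq_empty.2 Subset.rfl, empty_union]
      exact encard_le_one_iff_subsingleton.1 hSx1
    · exact ⟨D, subset_sdiff_singleton hD hbD, hD1, hdown' k (hK hk).1 (hK hk).2 D hkD⟩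

theorem IsFramed.of_isMinor [M.Finite] (hM : M.IsFramed ∅) (h : M' ≤m M) : M'.IsFramed ∅ := by
  obtain ⟨C, D, hC, -, -, rfl⟩ := h.exists_eq_contract_delete_disjoint
  refine IsFramed.delete ?_ (empty_subset _)
  have hCf := M.ground_finite.subset hC
  clear hC h
  induction C, hCf using Set.Finite.induction_on with
  | empty => rwa [contract_empty]
  | @insert x C _ _ ih =>
    rw [← union_singleton, ← contract_contract]
    exact ih.contractElem (empty_subset _)

theorem isPullbackOn_map (f : α → β) (hf : f.Injective) (A : Set α) :
    IsPullbackOn M (M.map f hf.injOn) f A := by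
  intro x hx Y hY
  rw [map_closure_eq, hf.mem_set_image, preimage_image_eq _ hf]

theorem isFramed_map_iff [M.Finite] {f : α → β} {g : β → α} (hg : Function.LeftInverse g f)
    {K : Set α} (hK : K ⊆ M.E) :
    (M.map f hg.injective.injOn).IsFramed (f '' K) ↔ M.IsFramed K := by
  constructor
  · intro h
    exact h.of_isPullbackOn (image_mono hK) (isPullbackOn_map f hg.injective _)
      (fun x hx ↦ ⟨x, hx, rfl⟩) hK (fun x hx ↦ ⟨x, hx, rfl⟩)
  · intro h
    refine h.of_isPullbackOn hK (g := g) ?_ ?_ (image_mono hK) ?_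
    · rintro _ ⟨x, hx, rfl⟩ Y hY
      obtain ⟨Z, hZ, rfl⟩ := subset_image_iff.1 hY
      rw [map_closure_eq, hg.injective.mem_set_image, preimage_image_eq _ hg.injective, hg x,
        hg.image_image]
    · rintro _ ⟨x, hx, rfl⟩
      rwa [hg x]
    · rintro _ ⟨x, hx, rfl⟩
      rwa [hg x]

/-! ## Joints and 2-sums with `U_{2,4}` -/

instance u24Sum_finite (N : Matroid α) [N.Finite] (L : Set α) : (N.u24Sum L).Finite := by
  refine ⟨?_⟩
  rw [u24Sum_ground]
  exact (N.ground_finite.sdiff.image _).union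
    (((N.ground_finite.inter_of_left L).prod finite_univ).image _)

/-- The three elements that replace `f` in a 2-sum with `U_{2,4}`. -/
def u24Line (f : α) : Set (α ⊕ α × Fin 3) := range fun i ↦ Sum.inr (f, i)

theorem inr_mem_u24Line (f : α) (i : Fin 3) : Sum.inr (f, i) ∈ u24Line f := ⟨i, rfl⟩

theorem u24Set_sdiff (f : α) : u24Set f \ {Sum.inl f} = u24Line f := by
  rw [u24Set, insert_sdiff_self_of_notMem (by simp), u24Line]

theorem u24Sum_insert_isLineSum (N : Matroid α) [N.Finite] (L : Set α) {f : α}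
    (hf : N.IsNonloop f) (hfL : f ∉ L) :
    IsLineSum (N.u24Sum (insert f L)) (N.u24Sum L) (Sum.inl f) (u24Line f) := by
  obtain ⟨h1, -, h3, h4, h5⟩ := u24Sum_insert N L hf hfL
  have hE : (uniformTwo (u24Set f) (u24Set_finite f)).E = u24Set f := rfl
  rw [hE, u24Set_sdiff] at h3 h4
  refine ⟨h1, ?_, h4, fun C ↦ ?_⟩
  · rw [← insert_eq_of_mem h1, ← insert_sdiff_singleton, disjoint_insert_left]
    exact ⟨by simp [u24Line], h3⟩
  rw [h5]
  simp only [uniformTwo_isCircuit_iff]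
  refine or_congr Iff.rfl (or_congr ?_ ?_)
  · rw [and_right_comm, ← u24Set_sdiff, subset_sdiff, disjoint_singleton_right]
  · constructor
    · rintro ⟨C₁, C₂, h1, h2, ⟨h3, h4⟩, h5, rfl⟩
      have h6 : (C₂ \ {Sum.inl f}).encard = 2 := by
        have := encard_sdiff_singleton_add_one h5
        rw [h4] at this
        exact ENat.add_left_injective_of_ne_top (n := 1) (by simp) (this.trans (by norm_num))
      obtain ⟨s, t, hst, hC₂⟩ := encard_eq_two.1 h6
      have h7 : C₂ \ {Sum.inl f} ⊆ u24Line f := u24Set_sdiff f ▸ sdiff_subset_sdiff_left h3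
      rw [hC₂] at h7 ⊢
      exact ⟨C₁, h1, h2, s, h7 (Or.inl rfl), t, h7 (Or.inr rfl), hst, rfl⟩
    · rintro ⟨C₁, h1, h2, s, hs, t, ht, hst, rfl⟩
      rw [← u24Set_sdiff] at hs ht
      have h6 : Sum.inl f ∉ ({s, t} : Set (α ⊕ α × Fin 3)) := by
        rintro (h | h)
        · exact hs.2 h.symm
        · exact ht.2 h.symm
      refine ⟨C₁, insert (Sum.inl f) {s, t}, h1, h2, ⟨?_, ?_⟩, Or.inl rfl, ?_⟩
      · exact insert_subset (Or.inl rfl) (pair_subset hs.1 ht.1)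
      · rw [encard_insert_of_notMem h6, encard_pair hst]
        norm_num
      · rw [insert_sdiff_self_of_notMem h6]

/-- The set `K` carries the joints already obtained: each induction step trades one 2-sum on `f` for
the condition that `f` be a joint, by `IsLineSum.isFramed_insert` and `IsLineSum.isFramed_of_joint`.
-/
theorem u24Sum_isFramed_image_iff (N : Matroid α) [N.Finite] {L : Set α}
    (hL : ∀ e ∈ L, N.IsNonloop e) {K : Set α} (hK : K ⊆ N.E \ L) :
    (N.u24Sum L).IsFramed (Sum.inl '' K) ↔ N.IsFramed (L ∪ K) := by
  have hLf : L.Finite := N.ground_finite.subset fun e he ↦ (hL e he).mem_ground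
  induction L, hLf using Set.Finite.induction_on generalizing K with
  | empty =>
    rw [u24Sum_empty, empty_union]
    exact isFramed_map_iff (g := Sum.elim id Prod.fst) (fun _ ↦ rfl) (hK.trans sdiff_subset)
  | @insert f L hfL _ ih =>
    have hf := hL f (Or.inl rfl)
    have h := u24Sum_insert_isLineSum N L hf hfL
    have hfK : f ∉ K := fun h' ↦ (hK h').2 (Or.inl rfl)
    have hKL : K ⊆ N.E \ L := hK.trans (sdiff_subset_sdiff_right (subset_insert _ _))
    have ih' := ih (fun e he ↦ hL e (Or.inr he)) (insert_subset ⟨hf.mem_ground, hfL⟩ hKL)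
    rw [insert_union, ← union_insert]
    refine Iff.trans ?_ ih'
    rw [image_insert_eq]
    constructor
    · refine h.isFramed_insert (inr_mem_u24Line f 0) (inr_mem_u24Line f 1) (inr_mem_u24Line f 2)
        (by simp) (by simp) (by simp) ?_
      rintro _ ⟨k, hk, rfl⟩
      refine ⟨?_, fun h' ↦ hfK (Sum.inl_injective h' ▸ hk)⟩
      rw [u24Sum_ground]
      exact Or.inl ⟨k, hKL hk, rfl⟩
    · refine fun h' ↦ h.isFramed_of_joint h' ?_
      rw [disjoint_left]
      rintro _ ⟨k, -, rfl⟩ ⟨i, hi⟩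
      cases hi

/-- `N ⊕₂ U_{2,4}^L` is frame if and only if `(N, L)` is. -/
theorem u24Sum_isFramed_iff (N : Matroid α) [N.Finite] {L : Set α}
    (hL : ∀ e ∈ L, N.IsNonloop e) : (N.u24Sum L).IsFramed ∅ ↔ N.IsFramed L := by
  have := u24Sum_isFramed_image_iff N hL (empty_subset _)
  rwa [image_empty, union_empty] at this

end Matroid

/-! ## Minors of 2-sums with `U_{2,4}` -/

namespace Matroid

variable {α : Type u} {M M' M₀ : Matroid α} {T : Set α} {e a b c x y : α}

theorem mem_contractElem_closure_iff {Y : Set α} (hxy : y ≠ x) :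
    y ∈ (M ／ {x}).closure Y ↔ y ∈ M.closure (insert x Y) := by
  rw [contract_closure_eq, union_singleton, mem_sdiff_singleton, and_iff_left hxy]

theorem isPullbackOn_of_parallel {A : Set α} {g : α → α}
    (hg : ∀ z ∈ A, g z ∈ M.closure {z} ∧ z ∈ M.closure {g z}) : IsPullbackOn M M g A := by
  intro z hz Y hY
  have hcl : M.closure (g '' Y) = M.closure Y := by
    refine (M.closure_subset_closure_of_subset_closure ?_).antisymm
      (M.closure_subset_closure_of_subset_closure fun w hw ↦ ?_)
    · rintro _ ⟨w, hw, rfl⟩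
      exact M.closure_subset_closure (singleton_subset_iff.2 hw) (hg w (hY hw)).1
    · exact M.closure_subset_closure (singleton_subset_iff.2 (mem_image_of_mem g hw))
        (hg w (hY hw)).2
  rw [hcl]
  exact ⟨fun h ↦ M.closure_subset_closure_of_subset_closure (singleton_subset_iff.2 h) (hg z hz).1,
    fun h ↦ M.closure_subset_closure_of_subset_closure (singleton_subset_iff.2 h) (hg z hz).2⟩

theorem isPullbackOn_id_delete (M : Matroid α) (D : Set α) :
    IsPullbackOn M (M ＼ D) id (M ＼ D).E := by
  intro x hx Y hY
  have h := isPullbackOn_delete M D x hx Y hY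
  rw [image_id, id] at h ⊢
  exact h.symm

/-- Every element spans and is spanned by an element outside `D`, so the frame map can be pulled
back along `g`. -/
theorem IsFramed.of_parallel [M.Finite] {D : Set α} {g : α → α} (hM : (M ＼ D).IsFramed ∅)
    (hg : ∀ z ∈ M.E, g z ∈ M.closure {z} ∧ z ∈ M.closure {g z}) (hgD : ∀ z ∈ M.E, g z ∉ D) :
    M.IsFramed ∅ := by
  have hmaps : MapsTo g M.E (M ＼ D).E := fun z hz ↦
    ⟨M.closure_subset_ground _ (hg z hz).1, hgD z hz⟩
  exact hM.of_isPullbackOn (empty_subset _)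
    ((isPullbackOn_of_parallel hg).comp (isPullbackOn_id_delete M D) hmaps) hmaps (empty_subset _)
    (mapsTo_empty _ _)

namespace IsLineSum

/-- After contracting `b`, the element `c` plays the role of `e`, so `M₀` is a copy of a restriction
of the contraction. -/
theorem isFramed_of_contract [M.Finite] (h : IsLineSum M M₀ e T) (hb : b ∈ T) (hc : c ∈ T)
    (hbc : b ≠ c) (hM : (M ／ {b}).IsFramed ∅) : M₀.IsFramed ∅ := by
  classical
  have := h.finite
  have hXb : ∀ x ∈ M₀.E \ {e}, x ≠ b := fun x hx ↦ h.ne_of_mem hx.1 hb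
  have hg : ∀ Y ⊆ M₀.E \ {e}, Function.update id e c '' Y = Y := fun Y hY ↦ by
    rw [image_congr fun x hx ↦ Function.update_of_ne (hY hx).2 _ _, image_id]
  have hpull : IsPullbackOn M₀ (M ／ {b}) (Function.update id e c) (insert e (M₀.E \ {e})) := by
    refine isPullbackOn_insert (fun x hx Y hY ↦ ?_) (fun Y hY ↦ ?_) h.mem_ground ?_
    · rw [hg Y hY, Function.update_of_ne hx.2, id, mem_contractElem_closure_iff (hXb x hx),
        h.mem_closure_insert_iff_of_mem hb hx hY]
    · rw [hg Y hY, Function.update_self, mem_contractElem_closure_iff hbc.symm,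
        h.mem_closure_insert_iff hc hb hbc.symm hY]
    · rw [Function.update_self]
      exact ⟨h.mem_ground_of_mem hc, hbc.symm⟩
  rw [insert_sdiff_singleton, insert_eq_of_mem h.mem_ground] at hpull
  refine hM.of_isPullbackOn (empty_subset _) hpull (fun x hx ↦ ?_) (empty_subset _)
    (mapsTo_empty _ _)
  by_cases hxe : x = e
  · rw [hxe, Function.update_self]
    exact ⟨h.mem_ground_of_mem hc, hbc.symm⟩
  · rw [Function.update_of_ne hxe]
    exact ⟨h.subset_ground ⟨hx, hxe⟩, hXb x ⟨hx, hxe⟩⟩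

/-- After contracting `b`, the elements `a` and `c` are parallel and each is a copy of `e`: the
contraction is a parallel extension of `M₀`. -/
theorem isFramed_contract [M.Finite] (h : IsLineSum M M₀ e {a, b, c}) (hab : a ≠ b) (hac : a ≠ c)
    (hbc : b ≠ c) (hM₀ : M₀.IsFramed ∅) : (M ／ {b}).IsFramed ∅ := by
  classical
  have := h.finite
  have ha : a ∈ ({a, b, c} : Set α) := Or.inl rfl
  have hb : b ∈ ({a, b, c} : Set α) := Or.inr (Or.inl rfl)
  have hc : c ∈ ({a, b, c} : Set α) := Or.inr (Or.inr rfl)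
  have haM := h.mem_ground_of_mem ha
  have hcM := h.mem_ground_of_mem hc
  have hC := h.isCircuit_of_triple ha hb hc hab hac hbc
  have hca : c ∈ M.closure {b, a} := by
    refine M.closure_subset_closure ?_ (hC.mem_closure_sdiff_singleton_of_mem hc)
    rintro z ⟨rfl | rfl | rfl, hz⟩
    exacts [Or.inr rfl, Or.inl rfl, (hz rfl).elim]
  have hac' : a ∈ M.closure {b, c} := by
    refine M.closure_subset_closure ?_ (hC.mem_closure_sdiff_singleton_of_mem ha)
    rintro z ⟨rfl | rfl | rfl, hz⟩
    exacts [(hz rfl).elim, Or.inl rfl, Or.inr rfl]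
  have hXb : ∀ x ∈ M₀.E \ {e}, x ≠ b := fun x hx ↦ h.ne_of_mem hx.1 hb
  have hground : (M ／ {b} ＼ {a}).E = insert c (M₀.E \ {e}) := by
    rw [delete_ground, contract_ground, h.ground_eq]
    ext z
    have h1 : z ∈ M₀.E → z ≠ a ∧ z ≠ b ∧ z ≠ c := fun hz ↦
      ⟨h.ne_of_mem hz ha, h.ne_of_mem hz hb, h.ne_of_mem hz hc⟩
    simp only [mem_sdiff, mem_union, mem_singleton_iff, mem_insert_iff]
    constructor
    · tauto
    · rintro (rfl | ⟨h2, h3⟩)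
      · exact ⟨⟨by tauto, hbc.symm⟩, hac.symm⟩
      · tauto
  refine IsFramed.of_parallel (D := {a}) (g := Function.update id a c) ?_ (fun z hz ↦ ?_)
    fun z hz ↦ ?_
  · have hg : ∀ Y ⊆ M₀.E \ {e}, Function.update id c e '' Y = Y := fun Y hY ↦ by
      rw [image_congr fun x hx ↦ Function.update_of_ne (h.ne_of_mem (hY hx).1 hc) _ _, image_id]
    have hpull : IsPullbackOn (M ／ {b}) M₀ (Function.update id c e)
        (insert c (M₀.E \ {e})) := by
      refine isPullbackOn_insert (fun x hx Y hY ↦ ?_) (fun Y hY ↦ ?_) ⟨hcM, hbc.symm⟩ ?_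
      · rw [hg Y hY, Function.update_of_ne (h.ne_of_mem hx.1 hc), id,
          mem_contractElem_closure_iff (hXb x hx), h.mem_closure_insert_iff_of_mem hb hx hY]
      · rw [hg Y hY, Function.update_self, mem_contractElem_closure_iff hbc.symm,
          h.mem_closure_insert_iff hc hb hbc.symm hY]
      · rw [Function.update_self]
        exact h.mem_ground
    rw [← hground] at hpull
    refine hM₀.of_isPullbackOn (empty_subset _)
      ((isPullbackOn_delete _ _).comp hpull (mapsTo_id _)) (fun x hx ↦ ?_) (empty_subset _)
      (mapsTo_empty _ _)
    rw [hground] at hx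
    obtain rfl | hx := hx
    · rw [Function.comp, id, Function.update_self]
      exact h.mem_ground
    · rw [Function.comp, id, Function.update_of_ne (h.ne_of_mem hx.1 hc)]
      exact hx.1
  · by_cases hza : z = a
    · subst hza
      rw [Function.update_self, mem_contractElem_closure_iff hbc.symm,
        mem_contractElem_closure_iff hab]
      exact ⟨hca, hac'⟩
    · rw [Function.update_of_ne hza, id, and_self]
      exact mem_closure_self _ z hz
  · by_cases hza : z = a
    · rw [hza, Function.update_self]
      exact hac.symm
    · rwa [Function.update_of_ne hza]

/-- Two line elements remain, which form a series pair in place of `e`. -/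
theorem isFramed_delete [M.Finite] (h : IsLineSum M M₀ e {a, b, c}) (hab : a ≠ b)
    (hbc : b ≠ c) (hM₀ : M₀.IsFramed ∅) : (M ＼ {b}).IsFramed ∅ := by
  have h1 := h.deleteElem (t := b) (Or.inr (Or.inl rfl))
  rw [insert_comm, insert_sdiff_self_of_notMem (by simp [hab.symm, hbc])] at h1
  exact h1.isFramed_of_pair hM₀ (empty_disjoint _)

/-- Contracting an element that spans `e` makes the three line elements parallel, so it is enough to
keep one of them. With only one line element left, no frame obstruction arises beyond that of `M₀`.
-/
theorem isFramed_contract_of_parallel [M.Finite] (h : IsLineSum M M₀ e {a, b, c}) (hab : a ≠ b)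
    (hac : a ≠ c) (hbc : b ≠ c) (hM₀ : M₀.IsFramed ∅) (hy : y ∈ M₀.E \ {e})
    (hey : e ∈ M₀.closure {y}) : (M ／ {y}).IsFramed ∅ := by
  classical
  have ha : a ∈ ({a, b, c} : Set α) := Or.inl rfl
  have hb : b ∈ ({a, b, c} : Set α) := Or.inr (Or.inl rfl)
  have hc : c ∈ ({a, b, c} : Set α) := Or.inr (Or.inr rfl)
  have h1 := (h.deleteElem ha).deleteElem (t := b) ⟨hb, hab.symm⟩
  -- The one remaining line element is written as a degenerate pair, so that `isFramed_of_pair`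
  -- applies.
  have hT : (({a, b, c} : Set α) \ {a}) \ {b} = {c, c} := by
    rw [insert_sdiff_self_of_notMem (by simp [hab, hac]),
      insert_sdiff_self_of_notMem (by simp [hbc]), pair_eq_singleton]
  rw [hT, delete_delete] at h1
  have h2 : (M ＼ ({a} ∪ {b})).IsFramed ∅ := h1.isFramed_of_pair hM₀ (empty_disjoint _)
  have hyT : ∀ t ∈ ({a, b, c} : Set α), t ≠ y := fun t ht ↦ (h.ne_of_mem hy.1 ht).symm
  have hpar : ∀ s ∈ ({a, b, c} : Set α), ∀ t ∈ ({a, b, c} : Set α),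
      s ∈ (M ／ {y}).closure {t} := by
    intro s hs t ht
    rw [mem_contractElem_closure_iff (hyT s hs)]
    by_cases hst : s = t
    · exact M.mem_closure_of_mem' (Or.inr hst) (h.mem_ground_of_mem hs)
    · rwa [pair_comm, h.mem_closure_insert_iff hs ht hst (singleton_subset_iff.2 hy)]
  refine IsFramed.of_parallel (D := {a} ∪ {b})
    (g := fun z ↦ if z ∈ ({a, b, c} : Set α) then c else z) ?_ (fun z hz ↦ ?_) fun z hz ↦ ?_
  · rw [contract_delete_comm]
    · exact h2.contractElem (empty_subset _)
    · rw [disjoint_singleton_left]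
      rintro (rfl | rfl)
      · exact hyT y ha rfl
      · exact hyT y hb rfl
  · split_ifs with hzT
    · exact ⟨hpar c hc z hzT, hpar z hzT c hc⟩
    · rw [and_self]
      exact mem_closure_self _ z hz
  · split_ifs with hzT
    · rintro (h' | h')
      · exact hac h'.symm
      · exact hbc h'.symm
    · rintro (rfl | rfl)
      · exact hzT ha
      · exact hzT hb

end IsLineSum

/-! ### Minors at elements of `N` outside `L` -/

theorem u24Sum_delete (N : Matroid α) [N.Finite] {L : Set α} (hx : x ∉ L) :
    (N ＼ {x}).u24Sum L = (N.u24Sum L) ＼ {Sum.inl x} := by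
  refine ext_indep ?_ fun I _ ↦ ?_
  · rw [delete_ground, u24Sum_ground, u24Sum_ground, delete_ground]
    ext (z | ⟨z, i⟩)
    · simp; tauto
    · have : z ∈ L → z ≠ x := fun h h' ↦ hx (h' ▸ h)
      simp; tauto
  · rw [delete_indep_iff, u24Sum_indep_iff, u24Sum_indep_iff, U24Indep, U24Indep,
      disjoint_singleton_right, delete_indep_iff, disjoint_singleton_right]
    constructor
    · rintro ⟨h1, h2, h3, h4, h5⟩
      exact ⟨⟨fun z hz ↦ ⟨(h1 z hz).1.1, (h1 z hz).2⟩, fun z i hz ↦ ⟨(h2 z i hz).1.1, (h2 z i hz).2⟩,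
        h3, h4⟩, fun h ↦ h5 (Or.inl h)⟩
    · rintro ⟨⟨h1, h2, h3, h4⟩, h5⟩
      refine ⟨fun z hz ↦ ⟨⟨(h1 z hz).1, ?_⟩, (h1 z hz).2⟩, fun z i hz ↦
        ⟨⟨(h2 z i hz).1, ?_⟩, (h2 z i hz).2⟩, h3, h4, ?_⟩
      · rintro rfl
        exact h5 hz
      · rintro rfl
        exact hx (h2 z i hz).2
      · rintro (h | ⟨i, -, -, h, -⟩)
        · exact h5 h
        · exact hx (h2 x i h).2

theorem u24Trace_insert_inl (I : Set (α ⊕ α × Fin 3)) :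
    u24Trace (insert (Sum.inl x) I) = insert x (u24Trace I) := by
  ext z
  simp [u24Trace, or_assoc]

theorem u24Sum_isNonloop_inl_iff (N : Matroid α) [N.Finite] {L : Set α} (hx : x ∉ L) :
    (N.u24Sum L).IsNonloop (Sum.inl x) ↔ N.IsNonloop x := by
  have h1 : u24Trace {(Sum.inl x : α ⊕ α × Fin 3)} = {x} := by
    ext z
    simp [u24Trace]
  rw [← indep_singleton, ← indep_singleton, u24Sum_indep_iff, U24Indep, h1]
  refine ⟨fun h ↦ h.2.2.2, fun h ↦ ⟨?_, by simp, by simp, h⟩⟩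
  intro z hz
  obtain rfl : z = x := by simpa using hz
  exact ⟨h.subset_ground rfl, hx⟩

theorem u24Sum_contract (N : Matroid α) [N.Finite] {L : Set α} (hx : x ∈ N.E \ L) :
    (N ／ {x}).u24Sum L = (N.u24Sum L) ／ {Sum.inl x} := by
  by_cases hxl : N.IsNonloop x
  · refine ext_indep ?_ fun I _ ↦ ?_
    · have h := congrArg Matroid.E (u24Sum_delete N hx.2)
      rw [delete_ground, u24Sum_ground, delete_ground] at h
      rw [contract_ground, u24Sum_ground, contract_ground, h]
    · rw [((u24Sum_isNonloop_inl_iff N hx.2).2 hxl).contractElem_indep_iff, u24Sum_indep_iff,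
        u24Sum_indep_iff, U24Indep, U24Indep, u24Trace_insert_inl, hxl.contractElem_indep_iff]
      constructor
      · rintro ⟨h1, h2, h3, h4, h5⟩
        refine ⟨fun h ↦ h4 (Or.inl h), fun z hz ↦ ?_, fun z i hz ↦ ?_, fun z ↦ ?_, h5⟩
        · obtain h | h := hz
          · obtain rfl := Sum.inl_injective h
            exact hx
          · exact ⟨(h1 z h).1.1, (h1 z h).2⟩
        · have hz := hz.resolve_left (by simp)
          exact ⟨(h2 z i hz).1.1, (h2 z i hz).2⟩
        · exact (h3 z).imp fun i hi ↦ by simpa using hi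
      · rintro ⟨h5, h1, h2, h3, h4⟩
        refine ⟨fun z hz ↦ ?_, fun z i hz ↦ ?_, fun z ↦ ?_, ?_, h4⟩
        · have := h1 z (Or.inr hz)
          refine ⟨⟨this.1, ?_⟩, this.2⟩
          rintro rfl
          exact h5 hz
        · have := h2 z i (Or.inr hz)
          refine ⟨⟨this.1, ?_⟩, this.2⟩
          rintro rfl
          exact hx.2 this.2
        · exact (h3 z).imp fun i hi h ↦ hi (Or.inr h)
        · rintro (h | ⟨i, -, -, h, -⟩)
          · exact h5 h
          · exact hx.2 (h2 x i (Or.inr h)).2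
  -- For a loop, contraction is deletion on both sides.
  · have hxM : Sum.inl x ∈ (N.u24Sum L).E := Or.inl ⟨x, hx, rfl⟩
    have h1 : N ／ {x} = N ＼ {x} := contract_eq_delete_of_subset_loops
      (singleton_subset_iff.2 ((not_isNonloop_iff hx.1).1 hxl))
    have h2 : (N.u24Sum L) ／ {Sum.inl x} = (N.u24Sum L) ＼ {Sum.inl x} :=
      contract_eq_delete_of_subset_loops (singleton_subset_iff.2
        ((not_isNonloop_iff hxM).1 (mt (u24Sum_isNonloop_inl_iff N hx.2).1 hxl)))
    rw [h2, ← u24Sum_delete N hx.2]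
    congr

/-- A proper minor lies below the deletion or the contraction of an element. -/
theorem IsStrictMinor.exists_isMinor (h : M' <m M) :
    ∃ x ∈ M.E, M' ≤m M ＼ {x} ∨ M' ≤m M ／ {x} := by
  obtain ⟨C, D, hC, hD, hCD, rfl⟩ := h.isMinor.exists_eq_contract_delete_disjoint
  obtain rfl | ⟨x, hx⟩ := C.eq_empty_or_nonempty
  · obtain rfl | ⟨x, hx⟩ := D.eq_empty_or_nonempty
    · exact (h.ne (by simp)).elim
    · refine ⟨x, hD hx, Or.inl ⟨∅, D, ?_⟩⟩
      rw [contract_empty, contract_empty, delete_delete,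
        union_eq_self_of_subset_left (singleton_subset_iff.2 hx)]
  · refine ⟨x, hC hx, Or.inr ⟨C, D, ?_⟩⟩
    rw [contract_contract, union_eq_self_of_subset_left (singleton_subset_iff.2 hx)]

end Matroid

/-! ## The excluded minors -/

namespace Matroid

variable {α : Type u} {N : Matroid α} {L : Set α} {e : α}

theorem exists_u24Line_eq (e : α) (i : Fin 3) : ∃ j k : Fin 3, j ≠ i ∧ i ≠ k ∧ j ≠ k ∧
    u24Line e = {Sum.inr (e, j), Sum.inr (e, i), Sum.inr (e, k)} := by
  have key : ∀ i : Fin 3, i + 1 ≠ i ∧ i ≠ i + 2 ∧ i + 1 ≠ i + 2 ∧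
      ∀ l, l = i + 1 ∨ l = i ∨ l = i + 2 := by decide
  obtain ⟨h1, h2, h3, h4⟩ := key i
  refine ⟨i + 1, i + 2, h1, h2, h3, ?_⟩
  ext z
  constructor
  · rintro ⟨l, rfl⟩
    obtain rfl | rfl | rfl := h4 l <;> simp
  · rintro (rfl | rfl | rfl) <;> exact ⟨_, rfl⟩

/-- Each element of `L` gives a 2-sum with a line having any given middle element. -/
theorem u24Sum_exists_isLineSum (N : Matroid α) [N.Finite] (hL : ∀ e ∈ L, N.IsNonloop e)
    (he : e ∈ L) (i : Fin 3) : ∃ a c : α ⊕ α × Fin 3, a ≠ Sum.inr (e, i) ∧ a ≠ c ∧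
      Sum.inr (e, i) ≠ c ∧
      IsLineSum (N.u24Sum L) (N.u24Sum (L \ {e})) (Sum.inl e) {a, Sum.inr (e, i), c} := by
  have h := u24Sum_insert_isLineSum N (L \ {e}) (hL e he) (fun h ↦ h.2 rfl)
  rw [insert_sdiff_singleton, insert_eq_of_mem he] at h
  obtain ⟨j, k, hji, hik, hjk, hline⟩ := exists_u24Line_eq e i
  rw [hline] at h
  exact ⟨_, _, by simpa using hji, by simpa using hjk, by simpa using hik, h⟩

/-- Elements outside `L` that are parallel in `N` stay parallel in the 2-sum; this serves when
contracting `y` would make some `e ∈ L` a loop. -/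
theorem inl_mem_closure_u24Sum (N : Matroid α) [N.Finite] {x y : α} (hx : N.IsNonloop x)
    (hxL : x ∉ L) (hy : y ∈ N.E \ L) (hxy : x ∈ N.closure {y}) :
    Sum.inl x ∈ (N.u24Sum L).closure {Sum.inl y} := by
  have hyl : N.IsNonloop y := by
    by_contra h
    exact hx.not_isLoop (N.closure_subset_closure_of_subset_closure
      (singleton_subset_iff.2 ((not_isNonloop_iff hy.1).1 h)) hxy)
  have hyl' := (u24Sum_isNonloop_inl_iff N hy.2).2 hyl
  have hxl' := (u24Sum_isNonloop_inl_iff N hxL).2 hx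
  obtain rfl | hne := eq_or_ne x y
  · exact mem_closure_self _ _ hxl'.mem_ground
  by_contra h
  have h1 := ((hyl'.indep.notMem_closure_iff hxl'.mem_ground).1 h).1
  rw [u24Sum_indep_iff] at h1
  have h2 := hyl.indep.notMem_closure_iff_of_notMem hne hx.mem_ground
  refine h2.2 (h1.2.2.2.subset ?_) hxy
  exact pair_subset (Or.inl (Or.inl rfl)) (Or.inl (Or.inr rfl))

end Matroid

namespace Matroidal

open Matroid

variable {α : Type u} {A B : Matroidal α}

theorem IsStep.finite [A.M.Finite] (h : A.IsStep B) : B.M.Finite := by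
  obtain ⟨e, -, hM | hM, -⟩ | ⟨e, -, hM, -⟩ := h <;> rw [hM] <;> infer_instance

theorem subset_ground (A : Matroidal α) : A.L ⊆ A.M.E := fun e he ↦ (A.isNonloop e he).mem_ground

theorem IsStep.isFramed [A.M.Finite] (h : A.IsStep B) (hA : A.M.IsFramed A.L) :
    B.M.IsFramed B.L := by
  obtain ⟨e, he, hM, hL⟩ | ⟨e, he, hM, hL⟩ := h
  · have hAe : A.L ⊆ A.M.E \ {e} := subset_sdiff_singleton A.subset_ground he.2
    obtain hM | hM := hM <;> rw [hM, hL]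
    · exact hA.delete hAe
    · exact hA.contractElem hAe
  · rw [hM, hL]
    exact hA.mono sdiff_subset

/-- If every proper minor of the 2-sum is framed, then so is each matroidal obtained in one
step. -/
theorem IsStep.isFramed_of_forall [A.M.Finite] (h : A.IsStep B)
    (hA : ∀ M' : Matroid (α ⊕ α × Fin 3), M' <m A.M.u24Sum A.L → M'.IsFramed ∅) :
    B.M.IsFramed B.L := by
  have hdel : ∀ x ∈ (A.M.u24Sum A.L).E, (A.M.u24Sum A.L ＼ {x}).IsFramed ∅ ∧
      (A.M.u24Sum A.L ／ {x}).IsFramed ∅ := by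
    intro x hx
    refine ⟨hA _ ?_, hA _ ?_⟩ <;> rw [isStrictMinor_iff_isMinor_ssubset]
    · exact ⟨⟨∅, {x}, by rw [contract_empty]⟩, sdiff_singleton_ssubset.2 hx⟩
    · exact ⟨⟨{x}, ∅, by rw [delete_empty]⟩, sdiff_singleton_ssubset.2 hx⟩
  have := h.finite
  obtain ⟨e, he, hM, hL⟩ | ⟨e, he, hM, hL⟩ := h
  · have hx := hdel (Sum.inl e) (Or.inl ⟨e, he, rfl⟩)
    rw [← u24Sum_delete _ he.2, ← u24Sum_contract _ he, ← hL] at hx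
    obtain ⟨M, L, hBL⟩ := B
    obtain rfl | rfl := hM
    · exact (u24Sum_isFramed_iff _ hBL).1 hx.1
    · exact (u24Sum_isFramed_iff _ hBL).1 hx.2
  -- Removing `e` from `L` corresponds to contracting one of the three elements at `e`: another of
  -- them then stands for `e`.
  · obtain ⟨a, c, hab, hac, hbc, h⟩ := u24Sum_exists_isLineSum A.M A.isNonloop he 0
    have hb : Sum.inr (e, 0) ∈ (A.M.u24Sum A.L).E :=
      h.mem_ground_of_mem (Or.inr (Or.inl rfl))
    rw [hM, hL, ← u24Sum_isFramed_iff _ fun x hx ↦ A.isNonloop x hx.1]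
    exact h.isFramed_of_contract (Or.inr (Or.inl rfl)) (Or.inr (Or.inr rfl)) hbc (hdel _ hb).2

theorem IsMinor.finite [A.M.Finite] (h : B.IsMinor A) : B.M.Finite := by
  induction h with
  | refl => infer_instance
  | tail _ h ih => exact h.finite

theorem IsMinor.isFramed_of_forall [A.M.Finite] (h : B.IsMinor A) (hBA : B ≠ A)
    (hA : ∀ M' : Matroid (α ⊕ α × Fin 3), M' <m A.M.u24Sum A.L → M'.IsFramed ∅) :
    B.M.IsFramed B.L := by
  suffices h : B = A ∨ B.M.IsFramed B.L from h.resolve_left hBA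
  clear hBA
  induction h with
  | refl => exact Or.inl rfl
  | @tail C D hAC hCD ih =>
    have := IsMinor.finite hAC
    obtain rfl | ih := ih
    · exact Or.inr (hCD.isFramed_of_forall hA)
    · exact Or.inr (hCD.isFramed ih)

theorem IsStep.ne (h : A.IsStep B) : B ≠ A := by
  rintro rfl
  obtain ⟨e, he, hM, hL⟩ | ⟨e, he, hM, hL⟩ := h
  · have hE : B.M.E = B.M.E \ {e} := by
      obtain hM | hM := hM
      · exact congrArg Matroid.E hM
      · exact congrArg Matroid.E hM
    exact (hE.subset he.1).2 rfl
  · exact (hL.subset he).2 rfl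

theorem IsStep.isMinor (h : A.IsStep B) : B.IsMinor A := Relation.ReflTransGen.single h

/-- Framed matroids are closed under minors, so only the deletion and the contraction of a single
element matter. Each of these is governed by a one-step minor of the matroidal. -/
theorem isFramed_of_isStrictMinor_u24Sum [A.M.Finite]
    (hA : ∀ B, A.IsStep B → B.M.IsFramed B.L)
    {M' : Matroid (α ⊕ α × Fin 3)} (hM' : M' <m A.M.u24Sum A.L) : M'.IsFramed ∅ := by
  have hrem : ∀ e ∈ A.L, (A.M.u24Sum (A.L \ {e})).IsFramed ∅ := by
    intro e he
    have hL : ∀ x ∈ A.L \ {e}, A.M.IsNonloop x := fun x hx ↦ A.isNonloop x hx.1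
    rw [u24Sum_isFramed_iff _ hL]
    exact hA ⟨A.M, A.L \ {e}, hL⟩ (Or.inr ⟨e, he, rfl, rfl⟩)
  suffices h : ∀ x ∈ (A.M.u24Sum A.L).E, (A.M.u24Sum A.L ＼ {x}).IsFramed ∅ ∧
      (A.M.u24Sum A.L ／ {x}).IsFramed ∅ by
    obtain ⟨x, hx, hM | hM⟩ := hM'.exists_isMinor
    · exact (h x hx).1.of_isMinor hM
    · exact (h x hx).2.of_isMinor hM
  rintro _ (⟨y, hy, rfl⟩ | ⟨⟨e, i⟩, he, rfl⟩)
  · constructor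
    · have hL : ∀ x ∈ A.L, (A.M ＼ {y}).IsNonloop x := fun x hx ↦ by
        rw [delete_isNonloop_iff]
        exact ⟨A.isNonloop x hx, fun h ↦ hy.2 (h ▸ hx)⟩
      rw [← u24Sum_delete _ hy.2, u24Sum_isFramed_iff _ hL]
      exact hA ⟨_, A.L, hL⟩ (Or.inl ⟨y, hy, Or.inl rfl, rfl⟩)
    · by_cases hL : ∀ x ∈ A.L, (A.M ／ {y}).IsNonloop x
      · rw [← u24Sum_contract _ hy, u24Sum_isFramed_iff _ hL]
        exact hA ⟨_, A.L, hL⟩ (Or.inl ⟨y, hy, Or.inr rfl, rfl⟩)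
      -- Contracting `y` makes some `e ∈ L` a loop, so it is not an operation on matroidals. Here
      -- `y` is parallel to `e`, and removing `e` from `L` is used instead.
      · push Not at hL
        obtain ⟨e, he, hey⟩ := hL
        have hye : y ≠ e := fun h ↦ hy.2 (h ▸ he)
        obtain ⟨a, c, hab, hac, hbc, h⟩ := u24Sum_exists_isLineSum A.M A.isNonloop he 0
        refine h.isFramed_contract_of_parallel hab hac hbc (hrem e he) ?_ ?_
        · exact ⟨Or.inl ⟨y, ⟨hy.1, fun h' ↦ hy.2 h'.1⟩, rfl⟩, fun h' ↦ hye (Sum.inl_injective h')⟩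
        · rw [contract_isNonloop_iff] at hey
          have hey' : e ∈ A.M.closure {y} := by
            by_contra h'
            exact hey ⟨(A.isNonloop e he).mem_ground, h'⟩
          exact inl_mem_closure_u24Sum A.M (A.isNonloop e he) (fun h' ↦ h'.2 rfl)
            ⟨hy.1, fun h' ↦ hy.2 h'.1⟩ hey'
  · obtain ⟨a, c, hab, hac, hbc, h⟩ := u24Sum_exists_isLineSum A.M A.isNonloop he.1.2 i
    exact ⟨h.isFramed_delete hab hbc (hrem e he.1.2), h.isFramed_contract hab hac hbc
      (hrem e he.1.2)⟩

end Matroidal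

theorem mainTheorem7 {α : Type u} (N : Matroid α) [N.Finite] (L : Set α)
    (hL : ∀ e ∈ L, N.IsNonloop e) :
    (N.u24Sum L).IsExcludedMinorFrame ↔ (Matroidal.mk N L hL).IsExcludedMinor := by
  set A : Matroidal α := ⟨N, L, hL⟩
  have hfin : A.M.Finite := inferInstanceAs N.Finite
  have hframe : (N.u24Sum L).IsFrame ↔ A.IsFrame := by
    rw [Matroid.isFrame_iff_isFramed, A.isFrame_iff_isFramed]
    exact N.u24Sum_isFramed_iff hL
  have hM' : ∀ M', M' <m N.u24Sum L → M'.Finite := fun M' h ↦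
    ⟨(N.u24Sum L).ground_finite.subset h.isMinor.subset⟩
  refine and_congr (not_congr hframe) ⟨fun h B hB hBA ↦ ?_, fun h M' hM ↦ ?_⟩
  · have hBf : B.M.Finite := hB.finite
    rw [B.isFrame_iff_isFramed]
    refine hB.isFramed_of_forall hBA fun M' hM ↦ ?_
    have := hM' M' hM
    exact M'.isFrame_iff_isFramed.1 (h M' hM)
  · have := hM' M' hM
    rw [M'.isFrame_iff_isFramed]
    refine Matroidal.isFramed_of_isStrictMinor_u24Sum (A := A) (fun B hB ↦ ?_) hM
    have := hB.finite
    exact B.isFrame_iff_isFramed.1 (h B hB.isMinor hB.ne)
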